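/- Proposition 5.3 (the orientation preserving tree is a cycle). Setting. Let $D$ be an oriented knot diagram on the sphere with at least one crossing, with a checkerboard coloring and a dotted arc $p$. Let $G$ be its Tait graph: the vertices are the black regions, the edges are the crossings, and an edge is positive if the $A$-smoothing of its crossing connects the two black regions, negative otherwise. Let $n_-$ be the number of negative crossings of $D$. Orientation preserving tree. Call an edge red if the oriented smoothing of its crossing connects the two black regions (both strands run along the edge), and black otherwise. From the subgraph of red edges remove positive red edges as long as no component becomes disconnected, until this is no longer possible, then do the same with negative red edges. Add all black edges. Remove positive black edges as long as no component becomes disconnected, until this is no longer possible, then do the same with negative black edges. Let $\mathfrak{T}_o$ be any resulting subgraph, and fix any total order of the edges of $G$ with $$\{\text{red}, \notin \mathfrak{T}_o\} < \{\text{black}, \in \mathfrak{T}_o\} < \{\text{red}, \in \mathfrak{T}_o\} < \{\text{black}, \notin \mathfrak{T}_o\}.$$ Lee complex. It is the $\mathbb{Q}$-vector space on the enhanced spanning subgraphs $(H,\epsilon)$, where $H$ is a set of edges and $\epsilon$ labels the faces of the components of $H$ (the circles of the corresponding resolved state) by $1$ or $x$. The homological grading is $i(H,\epsilon)=\#\{\text{positive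 edges not in } H\}+\#\{\text{negative edges in } H\}-n_-$. The differential is the sum, over the positive edges in $H$ and the negative edges not in $H$, of the maps that remove respectively insert the edge, with merge map $1\cdot 1=x\cdot x=1$, $1\cdot x=x\cdot 1=x$ and split map $1\mapsto 1\otimes x+x\otimes 1$, $x\mapsto x\otimes x+1\otimes 1$, and with sign $(-1)^{w}$, $w$ the number of smaller edges that are not among these edges. Matching. For a spanning tree $T$, an edge is live if it is the smallest edge of its fundamental cut (if it is in $T$) or of its fundamental cycle (if it is not in $T$), and dead otherwise. The twisted unknot $U(T)$ has as its states the $H$ that agree with $T$ on all dead edges. Let $H_T$ be the state of $U(T)$ that contains exactly the dead edges in $T$ and the live edges not in $T$. The graph $G(T)$ has the circles of $H_T$ as vertices and the live edges as edges; it is a tree, rooted at the circle through $p$. A live edge $e$ is a negative twist if ($e\in T$ and $e$ is positive) or ($e\notin T$ and $e$ is negative), and a positive twist otherwise. Put $c_e=1$ for a negative and $c_e=x$ for a positive twist, and let $\bar c_e$ be the other label. The states of $U(T)$ are spanning subgraphs of $G(T)$ with labelled components. They are matched recursively: for the least leaf edge $e$ of $G(T)$ whose end $v$ of degree one is not the root,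 a state containing $e$ is paired with the state in which $e$ is removed, $v$ is labelled $\bar c_e$ and all else is unchanged; the remaining states, in which $v$ is isolated with label $c_e$, are paired by the matching of $G(T)\setminus v$. Let $\mathcal{M}$ be the union of these matchings over all $T$. Spanning tree model. $\mathrm{CST}_{Lee}(D)$ is the Morse complex of $\mathcal{M}$: it is spanned over $\mathbb{Q}$ by the critical (unmatched) enhanced spanning subgraphs, and $$\partial_{ST}(S)=\sum_{S' \text{ critical},\ i(S')=i(S)+1}\Gamma(S,S')\,S',$$ where $\Gamma(S,S')$ is the sum of the weights of all directed paths from $S$ to $S'$ in the Hasse diagram with matched edges reversed; an unmatched edge has its incidence number as weight, a reversed edge of incidence number $c$ has weight $-1/c$, and the weight of a path is the product of the weights of its edges. The signed tree $T^+$ (respectively $T^-$) is the critical enhanced spanning subgraph of $U(T)$ whose circle through $p$ is labelled $1$ (respectively $x$). Claim. $\mathfrak{T}_o$ is a spanning tree of $G$. Each of $\mathfrak{T}_o^+$ and $\mathfrak{T}_o^-$ exists and is unique, $i(\mathfrak{T}_o^\pm)=0$, and $\mathfrak{T}_o^\pm$ is a cycle: $\partial_{ST}(\mathfrak{T}_o^\pm)=0$.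 In particular $\Gamma(\mathfrak{T}_o^+,T_1^-)=0$ for every spanning tree $T_1$ with $i(T_1^-)=i(\mathfrak{T}_o^+)+1$. -/

import Mathlib

/-- An oriented knot diagram with `n` crossings, drawn on the sphere (the plane with its point at
infinity), up to isotopy. Every crossing `c` has four half-edges `(c, 0), (c, 1), (c, 2), (c, 3)`,
listed counterclockwise; the strand through `(c, 0)` and `(c, 2)` runs under the strand through
`(c, 1)` and `(c, 3)`. The arcs of the diagram are the pairs `{h, glue h}`. The *corner* `(c, k)` is
the corner between the half-edges `(c, k)` and `(c, k + 1)` at `c`. -/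
structure KnotDiagram where
  /-- the number of crossings -/
  n : ℕ
  /-- the two half-edges of an arc are exchanged by `glue` -/
  glue : Equiv.Perm (Fin n × ZMod 4)
  glue_glue : ∀ h, glue (glue h) = h
  /-- the orientation: `out h` says that the half-edge `h` is directed away from its crossing -/
  out : Fin n × ZMod 4 → Bool
  out_glue : ∀ h, out (glue h) = !out h
  out_opposite : ∀ c k, out (c, k + 2) = !out (c, k)
  /-- there is only one component: going along arcs and straight through crossings one reaches
  everything (in particular the diagram is connected) -/
  one_component : ∀ a b,
    Relation.EqvGen (fun a b => b = glue a ∨ b = (a.1, a.2 + 2)) a b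
  /-- the surface carrying the diagram is a sphere: `n` vertices, `2 n` edges, and `n + 2` regions.
  The corner to the left when leaving along `h` is followed, on the boundary of its region, by the
  corner clockwise of `glue h`. -/
  planar : Nat.card (Quotient (Equiv.Perm.SameCycle.setoid
    (glue.trans ((Equiv.refl (Fin n)).prodCongr (Equiv.subRight (1 : ZMod 4)))))) = n + 2

/-- The two labels `1` and `x`. They are also used as the signs of a signed spanning tree: the
label of the circle through the dotted arc is `1` for `T⁺` and `x` for `T⁻`. -/
inductive KhLabel
  | one
  | x
  deriving DecidableEq

instance : Finite KhLabel :=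
  Finite.of_injective (fun a : KhLabel => decide (a = KhLabel.one)) (fun a b h => by
    cases a <;> cases b <;> simp_all)

namespace KnotDiagram

noncomputable section

open scoped Classical

/-- half-edges, also used to index corners -/
abbrev HalfEdge (D : KnotDiagram) : Type := Fin D.n × ZMod 4

/-- the next corner on the boundary of the same region -/
abbrev nextCorner (D : KnotDiagram) : Equiv.Perm D.HalfEdge :=
  D.glue.trans ((Equiv.refl (Fin D.n)).prodCongr (Equiv.subRight (1 : ZMod 4)))

/-- the regions (faces) of the diagram -/
abbrev Region (D : KnotDiagram) : Type :=
  Quotient (Equiv.Perm.SameCycle.setoid D.nextCorner)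

/-- the region to which a corner belongs -/
def region (D : KnotDiagram) (a : D.HalfEdge) : D.Region :=
  Quotient.mk (Equiv.Perm.SameCycle.setoid D.nextCorner) a

/-- A crossing is positive when, seen with the understrand entering at `(c, 0)`, the overstrand
leaves at `(c, 1)` (or the same rotated by a half turn). -/
def PosCrossing (D : KnotDiagram) (c : Fin D.n) : Prop := D.out (c, 0) ≠ D.out (c, 1)

/-- the number `n₋` of negative crossings -/
def nMinus (D : KnotDiagram) : ℕ :=
  (Finset.univ.filter fun c : Fin D.n => ¬ D.PosCrossing c).card

/-- A checkerboard coloring: every region is black or white, and regions that share an arc have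
different colors. -/
structure Checkerboard (D : KnotDiagram) where
  black : D.HalfEdge → Bool
  black_next : ∀ a, black (D.nextCorner a) = black a
  black_adj : ∀ c k, black (c, k + 1) = !black (c, k)

namespace Checkerboard

variable {D : KnotDiagram} (κ : D.Checkerboard)

/-! ### The Tait graph -/

/-- the vertices of the Tait graph: the black regions. The edges are the crossings. -/
def Vertex : Type := {v : D.Region // ∃ a, κ.black a = true ∧ D.region a = v}

/-- the edge (crossing) `e` joins `u` and `v`: they are the regions at the two black corners of
`e` -/
def Link (e : Fin D.n) (u v : κ.Vertex) : Prop :=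
  ∃ k, κ.black (e, k) = true ∧ D.region (e, k) = u.1 ∧ D.region (e, k + 2) = v.1

/-- An edge is positive when the `A`-smoothing of its crossing connects the two black regions. The
`A`-smoothing connects the corners swept by the overstrand when it is turned counterclockwise,
which are `(e, 1)` and `(e, 3)`. -/
def PosEdge (e : Fin D.n) : Prop := κ.black (e, 1) = true

/-- `u` and `v` lie in the same component of the spanning subgraph with edge set `H` -/
def Joined (H : Finset (Fin D.n)) (u v : κ.Vertex) : Prop :=
  Relation.EqvGen (fun a b => ∃ e ∈ H, κ.Link e a b) u v

/-- the spanning subgraph with edge set `H` is connected -/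
def ConnectedSub (H : Finset (Fin D.n)) : Prop := ∀ u v, κ.Joined H u v

/-- the edge `f` lies on a cycle of `H`: it belongs to `H` and its ends are joined in `H` by a path
that does not use `f` -/
def OnCycle (H : Finset (Fin D.n)) (f : Fin D.n) : Prop :=
  f ∈ H ∧ ∀ u v, κ.Link f u v → κ.Joined (H.erase f) u v

/-- spanning trees of the Tait graph -/
def IsSpanningTree (T : Finset (Fin D.n)) : Prop :=
  κ.ConnectedSub T ∧ ∀ e, ¬ κ.OnCycle T e

/-- `cut(T, e)` for `e ∈ T` : the edges that connect `T \ e` -/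
def cut (T : Finset (Fin D.n)) (e : Fin D.n) : Set (Fin D.n) :=
  {e' | κ.ConnectedSub (insert e' (T.erase e))}

/-- `cyc(T, f)` for `f ∉ T` : the edges of the unique cycle of `T ∪ f` -/
def cyc (T : Finset (Fin D.n)) (f : Fin D.n) : Set (Fin D.n) :=
  {f' | κ.OnCycle (insert f T) f'}

/-- With the edges ordered by their position `ord`, an edge is live (active) with respect to `T` if
it is the smallest edge of its cut (if it is in `T`) or of its cycle (if it is not in `T`). Otherwise
it is dead. -/
def Live (ord : Fin D.n ≃ Fin D.n) (T : Finset (Fin D.n)) (e : Fin D.n) : Prop :=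
  (e ∈ T → ∀ e' ∈ κ.cut T e, ord e ≤ ord e') ∧ (e ∉ T → ∀ e' ∈ κ.cyc T e, ord e ≤ ord e')

/-! ### Enhanced spanning subgraphs -/

/-- The boundary of a neighbourhood of the spanning subgraph `H`, at a crossing `e`: it turns around
the white corners if `e ∈ H` (the black regions are connected) and around the black corners if
`e ∉ H`. -/
def turn (H : Finset (Fin D.n)) (a : D.HalfEdge) : D.HalfEdge :=
  if κ.black a = true ↔ a.1 ∉ H then (a.1, a.2 + 1) else (a.1, a.2 - 1)

/-- Two half-edges lie on the same circle of the resolved state of `H`. The circles are the faces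
`F(H)` of the components of the plane subgraph `H`. -/
def SameFace (H : Finset (Fin D.n)) (a b : D.HalfEdge) : Prop :=
  Relation.EqvGen (fun a b => b = D.glue a ∨ b = κ.turn H a) a b

/-- An enhanced spanning subgraph: an edge set `H` and a labelling of the faces `F(H)`, written as a
function on half-edges that is constant on every face. -/
@[ext]
structure Enhanced where
  H : Finset (Fin D.n)
  lab : D.HalfEdge → KhLabel
  lab_eq : ∀ a b, κ.SameFace H a b → lab a = lab b

instance : Finite κ.Enhanced :=
  Finite.of_injective (fun S : κ.Enhanced => (S.H, S.lab)) (fun S S' h => by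
    have h1 := congrArg Prod.fst h
    have h2 := congrArg Prod.snd h
    exact Enhanced.ext h1 h2)

instance : Fintype κ.Enhanced := Fintype.ofFinite _

/-- the homological grading `i` -/
def hdeg (S : κ.Enhanced) : ℤ :=
  ((Finset.univ.filter fun e => κ.PosEdge e ∧ e ∉ S.H).card : ℤ)
    + ((Finset.univ.filter fun e => ¬ κ.PosEdge e ∧ e ∈ S.H).card : ℤ) - (D.nMinus : ℤ)

/-! ### The Lee complex -/

/-- the edges with an `A`-marker: the positive edges in `H` and the negative edges not in `H` -/
def aEdges (H : Finset (Fin D.n)) : Finset (Fin D.n) :=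
  Finset.univ.filter fun e => κ.PosEdge e ↔ e ∈ H

/-- `LeeTerm e S S'`: the enhanced subgraph `S'` is a term of the Lee map of `S` at the edge `e`.
The faces that do not touch `e` keep their label. If the half-edges `(e, 0)` and `(e, 2)` are on the
same face of `S`, this face splits into the faces of `(e, 0)` and `(e, 2)` in `S'`, by
`1 ↦ 1 ⊗ x + x ⊗ 1`, `x ↦ x ⊗ x + 1 ⊗ 1`; otherwise the two faces merge, by `1 ⊗ 1 ↦ 1`,
`x ⊗ x ↦ 1`, `1 ⊗ x ↦ x`, `x ⊗ 1 ↦ x`. -/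
def LeeTerm (e : Fin D.n) (S S' : κ.Enhanced) : Prop :=
  S'.H = symmDiff S.H {e} ∧
  (∀ a, (∀ k, ¬ κ.SameFace S.H a (e, k)) → S'.lab a = S.lab a) ∧
  (κ.SameFace S.H (e, 0) (e, 2) →
    match S.lab (e, 0), S'.lab (e, 0), S'.lab (e, 2) with
    | .one, .one, .x => True
    | .one, .x, .one => True
    | .x, .x, .x => True
    | .x, .one, .one => True
    | _, _, _ => False) ∧
  (¬ κ.SameFace S.H (e, 0) (e, 2) →
    match S.lab (e, 0), S.lab (e, 2), S'.lab (e, 0) with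
    | .one, .one, .one => True
    | .x, .x, .one => True
    | .one, .x, .x => True
    | .x, .one, .x => True
    | _, _, _ => False)

/-- the incidence number `[S : S']`, the coefficient of `S'` in the Lee differential of `S`; the sign
at `e` is given by the number of edges before `e` without `A`-marker -/
def incidence (ord : Fin D.n ≃ Fin D.n) (S S' : κ.Enhanced) : ℚ :=
  ∑ e ∈ κ.aEdges S.H, if κ.LeeTerm e S S' then
    (-1 : ℚ) ^ (Finset.univ.filter fun f => ord f < ord e ∧ f ∉ κ.aEdges S.H).card else 0

/-! ### The twisted unknot of a spanning tree and its matching -/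

/-- The spanning subgraph of the critical states of `T`: it contains the internally dead and the
externally live edges. (So positive edges have the markers `L ↦ B`, `D ↦ A`, `l ↦ A`, `d ↦ B`, and
negative edges the opposite ones.) -/
def critEdges (ord : Fin D.n ≃ Fin D.n) (T : Finset (Fin D.n)) : Finset (Fin D.n) :=
  Finset.univ.filter fun e => (e ∈ T ∧ ¬ κ.Live ord T e) ∨ (e ∉ T ∧ κ.Live ord T e)

/-- `S` is a state of the partial smoothing `U(T)`, in which exactly the dead edges of `T` are
smoothed, with the markers above -/
def InUnknot (ord : Fin D.n ≃ Fin D.n) (T : Finset (Fin D.n)) (S : κ.Enhanced) : Prop :=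
  ∀ e, ¬ κ.Live ord T e → (e ∈ S.H ↔ e ∈ κ.critEdges ord T)

/-- The tree `G(T)` has the circles of the critical state of `T` as vertices, and an edge for every
live edge `e`, joining the two circles that meet at the crossing `e`. A vertex is given by any
half-edge on it; this says that `a` and `b` give the same vertex. -/
def SameVertex (ord : Fin D.n ≃ Fin D.n) (T : Finset (Fin D.n)) (a b : D.HalfEdge) : Prop :=
  κ.SameFace (κ.critEdges ord T) a b

/-- the live edge `e` belongs to the spanning subgraph of `G(T)` that represents `S` -/
def Present (ord : Fin D.n ≃ Fin D.n) (T : Finset (Fin D.n)) (S : κ.Enhanced)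
    (e : Fin D.n) : Prop :=
  ¬ (e ∈ S.H ↔ e ∈ κ.critEdges ord T)

/-- In the subgraph of `G(T)` with the set `R` of edges, `e` is a leaf: its end `v` given by the
half-edge `a` has degree one, and `v` is not the root, which is the circle of the dotted arc `p`. -/
def IsLeaf (ord : Fin D.n ≃ Fin D.n) (p : D.HalfEdge) (T R : Finset (Fin D.n))
    (e : Fin D.n) (a : D.HalfEdge) : Prop :=
  e ∈ R ∧ a.1 = e ∧ ¬ κ.SameVertex ord T a p ∧
    ∀ f ∈ R, ∀ k, κ.SameVertex ord T (f, k) a → f = e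

/-- `e` is the least leaf -/
def IsLeastLeaf (ord : Fin D.n ≃ Fin D.n) (p : D.HalfEdge) (T R : Finset (Fin D.n))
    (e : Fin D.n) (a : D.HalfEdge) : Prop :=
  κ.IsLeaf ord p T R e a ∧ ∀ e' a', κ.IsLeaf ord p T R e' a' → ord e ≤ ord e'

/-- A live edge of `T` is a negative twist of `U(T)` if its activity is `L` (in `T` and positive) or
`l̄` (not in `T` and negative), and a positive twist otherwise. -/
def NegTwist (T : Finset (Fin D.n)) (e : Fin D.n) : Prop := e ∈ T ↔ κ.PosEdge e

/-- the label of the outer vertex of `e` in the critical states -/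
def critLabel (T : Finset (Fin D.n)) (e : Fin D.n) : KhLabel :=
  if κ.NegTwist T e then .one else .x

/-- the other label -/
def nonCritLabel (T : Finset (Fin D.n)) (e : Fin D.n) : KhLabel :=
  if κ.NegTwist T e then .x else .one

/-- The matching on the states of `U(T)`, by recursion on the set `R` of edges of `G(T)` that are
left. Let `e` be the least leaf and `v` its outer vertex. A state that contains `e` is paired with
the state in which `e` is removed, `v` is labelled by `nonCritLabel`, and nothing else changes. The
states left over have `v` isolated and labelled by `critLabel`; they are paired by the matching for
`R \ e`. -/
inductive PairedIn (ord : Fin D.n ≃ Fin D.n) (p : D.HalfEdge) (T : Finset (Fin D.n)) :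
    Finset (Fin D.n) → κ.Enhanced → κ.Enhanced → Prop
  | leaf (R : Finset (Fin D.n)) (e : Fin D.n) (a : D.HalfEdge) (S S' : κ.Enhanced)
      (least : κ.IsLeastLeaf ord p T R e a)
      (present : κ.Present ord T S e)
      (remove : S'.H = symmDiff S.H {e})
      (outer : ∀ b, κ.SameVertex ord T b a → S'.lab b = κ.nonCritLabel T e)
      (rest : ∀ b, ¬ κ.SameVertex ord T b a → S'.lab b = S.lab b) :
      PairedIn ord p T R S S'
  | step (R : Finset (Fin D.n)) (e : Fin D.n) (a : D.HalfEdge) (S S' : κ.Enhanced)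
      (least : κ.IsLeastLeaf ord p T R e a)
      (absent : ¬ κ.Present ord T S e) (absent' : ¬ κ.Present ord T S' e)
      (crit : S.lab a = κ.critLabel T e) (crit' : S'.lab a = κ.critLabel T e)
      (paired : PairedIn ord p T (R.erase e) S S') :
      PairedIn ord p T R S S'

/-- two states are paired in the union of the matchings of all twisted unknots `U(T)` -/
def Paired (ord : Fin D.n ≃ Fin D.n) (p : D.HalfEdge) (S S' : κ.Enhanced) : Prop :=
  ∃ T, κ.IsSpanningTree T ∧ κ.InUnknot ord T S ∧ κ.InUnknot ord T S' ∧
    κ.PairedIn ord p T (Finset.univ.filter fun e => κ.Live ord T e) S S'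

/-- the edge `S → S'` of the Hasse diagram of the Lee complex belongs to the matching -/
def Matched (ord : Fin D.n ≃ Fin D.n) (p : D.HalfEdge) (S S' : κ.Enhanced) : Prop :=
  κ.incidence ord S S' ≠ 0 ∧ (κ.Paired ord p S S' ∨ κ.Paired ord p S' S)

/-! ### The Morse complex -/

/-- The weighted directed graph obtained from the Hasse diagram by reversing the matched edges: the
weight of the edge from `S` to `S'` (`0` if there is none). -/
def weight (ord : Fin D.n ≃ Fin D.n) (p : D.HalfEdge) : Matrix κ.Enhanced κ.Enhanced ℚ :=
  fun S S' =>
    if κ.Matched ord p S' S then - (κ.incidence ord S' S)⁻¹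
    else if κ.Matched ord p S S' then 0
    else κ.incidence ord S S'

/-- `Γ(S, S')`, the sum of the weights of all directed paths from `S` to `S'`. The entry of the
`k`-th power of the weight matrix is the sum over the paths with `k` edges; since the graph is
acyclic, a path has fewer edges than the graph has vertices. -/
def Gam (ord : Fin D.n ≃ Fin D.n) (p : D.HalfEdge) (S S' : κ.Enhanced) : ℚ :=
  ∑ k ∈ Finset.range (Fintype.card κ.Enhanced), (κ.weight ord p ^ k) S S'

/-- the critical enhanced spanning subgraphs, those which no edge of the matching meets -/
def Critical (ord : Fin D.n ≃ Fin D.n) (p : D.HalfEdge) : Type :=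
  {S : κ.Enhanced // ∀ S', ¬ κ.Matched ord p S S' ∧ ¬ κ.Matched ord p S' S}

instance (ord : Fin D.n ≃ Fin D.n) (p : D.HalfEdge) : Fintype (κ.Critical ord p) :=
  inferInstanceAs (Fintype
    {S : κ.Enhanced // ∀ S', ¬ κ.Matched ord p S S' ∧ ¬ κ.Matched ord p S' S})

/-- The spanning tree complex of Lee's complex, the Morse complex of the matching: the free module
on the critical enhanced spanning subgraphs. -/
abbrev CSTLee (ord : Fin D.n ≃ Fin D.n) (p : D.HalfEdge) : Type := κ.Critical ord p →₀ ℚ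

/-- its differential, which sends a critical `S` to the sum of `Γ(S, S') S'` over all critical `S'`
whose grading `i` is larger by one -/
def dST (ord : Fin D.n ≃ Fin D.n) (p : D.HalfEdge) : κ.CSTLee ord p →ₗ[ℚ] κ.CSTLee ord p :=
  Finsupp.linearCombination ℚ fun S =>
    ∑ S' ∈ Finset.univ.filter fun S' : κ.Critical ord p => κ.hdeg S'.1 = κ.hdeg S.1 + 1,
      Finsupp.single S' (κ.Gam ord p S.1 S'.1)

/-- The critical `S` is the generator `T⁺` (for `s = 1`) or `T⁻` (for `s = x`): it is a state of
`U(T)` with the label `s` on the dotted arc `p`. -/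
def IsSignedTree (ord : Fin D.n ≃ Fin D.n) (p : D.HalfEdge) (T : Finset (Fin D.n)) (s : KhLabel)
    (S : κ.Critical ord p) : Prop :=
  κ.InUnknot ord T S.1 ∧ S.1.lab p = s

/-! ### The orientation preserving tree -/

/-- An edge is red if both strands of its crossing run in the direction of the edge, from one of its
black corners to the other: the two half-edges at a white corner are directed oppositely, one into
and one out of the crossing. Otherwise it is black (uncolored). -/
def Red (e : Fin D.n) : Prop :=
  ∃ k, κ.black (e, k) = false ∧ D.out (e, k) ≠ D.out (e, k + 1)

/-- `K` is obtained from `H` by removing edges with the property `P`, keeping every component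
connected, until this is not possible any more. -/
def Pruned (P : Fin D.n → Prop) (H K : Finset (Fin D.n)) : Prop :=
  K ⊆ H ∧ (∀ e ∈ H, e ∉ K → P e) ∧ (∀ u v, κ.Joined H u v ↔ κ.Joined K u v) ∧
    ∀ e ∈ K, P e → ¬ κ.OnCycle K e

/-- `T` is an outcome of the construction of the orientation preserving tree: prune the red subgraph,
first its positive and then its negative edges; add all black edges; prune the black edges, first
the positive and then the negative ones. -/
def IsOrientationTree (T : Finset (Fin D.n)) : Prop :=
  ∃ H₁ H₂ H₃ : Finset (Fin D.n),
    κ.Pruned (fun e => κ.PosEdge e) (Finset.univ.filter fun e => κ.Red e) H₁ ∧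
    κ.Pruned (fun e => ¬ κ.PosEdge e) H₁ H₂ ∧
    κ.Pruned (fun e => ¬ κ.Red e ∧ κ.PosEdge e)
      (H₂ ∪ Finset.univ.filter fun e => ¬ κ.Red e) H₃ ∧
    κ.Pruned (fun e => ¬ κ.Red e ∧ ¬ κ.PosEdge e) H₃ T

/-- the position of the block of an edge in
`{red, not in T} < {black, in T} < {red, in T} < {black, not in T}` -/
def block (T : Finset (Fin D.n)) (e : Fin D.n) : ℕ :=
  if κ.Red e then (if e ∈ T then 2 else 0) else (if e ∈ T then 1 else 3)

/-- the edge order is compatible with the order of the blocks -/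
def IsAdaptedOrder (T : Finset (Fin D.n)) (ord : Fin D.n ≃ Fin D.n) : Prop :=
  ∀ e f, κ.block T e < κ.block T f → ord e < ord f

end Checkerboard

end

end KnotDiagram

/-! The critical states of the orientation preserving tree live on the oriented resolution, and
Lee's canonical cycles there, suitably truncated, show that they are cycles of the Morse complex.

The block order makes an edge live exactly when its color disagrees with its membership in the tree
(`OrientationTreeFacts.live_iff`). Hence the critical states of `U(T)` have the red edges as edge
set: they are enhancements of the oriented resolution, of degree 0. At every crossing two different
circles of this resolution meet (`not_pinched_redEdges`), and they carry opposite signs. All Lee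
maps leaving the resolution are therefore merges, one for each positive crossing. For a critical
`S₀`, take the product over all circles of (label in `S₀`) ± (other label). Each merge kills it,
because `(1 + x) * (1 - x) = 0`. The terms that cancel differ by exchanging both labels at one
positive crossing. So one may keep only the labellings that deviate from `S₀` on an even number of
circles in each class of circles linked by positive crossings. The result `leeCycle S₀` is still a
cycle, and `S₀` has coefficient 1 in it.

If every other term of such a cycle is the source of a matched edge, then `Γ(S₀, X) = 0` for all
critical `X` one degree higher (`Gam_eq_zero_of_cycle`). To verify this for `leeCycle S₀`
(`OrientationTreeFacts.matched_of_parity`), follow the recursion of the matching to the first leaf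
whose outer vertex has the noncritical label. At a positive twist the term is a source. At a
negative twist it would be a target, but parity supplies a second deviating circle in the same
linked class. The pruning order ensures that positive crossings never link the two sides of a
negative twist (`OrientationTreeFacts.conn_of_posCrossing`). So the second circle lies beyond the
leaf edge, where all circles but the outer vertex were removed earlier and agree with `S₀`: a
contradiction. If no such leaf occurs, only the root could deviate, which parity forbids.

Underneath lie three general facts. Euler's formula on the sphere translates statements about
circles into connectivity in the Tait graph (`pinched_iff_spans`). A greedy algorithm assigns each
state to exactly one twisted unknot (`agrees_tree`, `eq_tree`). The matching is acyclic
(`weight_acyclic`), so `Gam` is the matrix inverse of one minus the weight matrix. -/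

/-! ### Permutations that differ by a transposition -/

section Perm

variable {α : Type*} [Finite α] {π π' : Equiv.Perm α} {B : α → Prop} {a b : α}

/-- Exchanging the images of two points on different cycles joins the two cycles. -/
theorem sameCycle_of_swap_images (hB : ∀ x, B x → B (π x)) (hb : B b)
    (h1 : π' a = π b) (ho : ∀ x, B x → x ≠ a → x ≠ b → π' x = π x)
    (hn : ¬ π.SameCycle a b) : π'.SameCycle a b := by
  classical
  have hBpow : ∀ i : ℕ, B ((π ^ i) b) := by
    intro i
    induction i with
    | zero => simpa using hb
    | succ i ih => rw [pow_succ']; exact hB _ ih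
  -- Starting at `a`, `π'` runs along the `π`-orbit of `b` until that orbit returns to `b`; it never
  -- meets `a`, which is on another cycle.
  have key : ∀ i : ℕ, (∀ j, 0 < j → j ≤ i → (π ^ j) b ≠ b) →
      (π' ^ (i + 1)) a = (π ^ (i + 1)) b := by
    intro i
    induction i with
    | zero => intro _; simpa using h1
    | succ i ih =>
      intro h
      rw [pow_succ', Equiv.Perm.mul_apply, ih (fun j hj hji => h j hj (by omega)),
        pow_succ' π (i + 1), Equiv.Perm.mul_apply]
      refine ho _ (hBpow _) ?_ (h _ (by omega) (by omega))
      intro hh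
      exact hn (Equiv.Perm.SameCycle.symm ⟨((i + 1 : ℕ) : ℤ), by rw [zpow_natCast]; exact hh⟩)
  have hex : ∃ m : ℕ, 0 < m ∧ (π ^ m) b = b :=
    ⟨orderOf π, orderOf_pos π, by rw [pow_orderOf_eq_one]; rfl⟩
  obtain ⟨hm0, hmb⟩ := Nat.find_spec hex
  have hmin : ∀ j, 0 < j → j < Nat.find hex → (π ^ j) b ≠ b :=
    fun j hj hjm hh => Nat.find_min hex hjm ⟨hj, hh⟩
  have := key (Nat.find hex - 1) (fun j hj hji => hmin j hj (by omega))
  rw [Nat.sub_add_cancel hm0, hmb] at this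
  exact ⟨((Nat.find hex : ℕ) : ℤ), by rw [zpow_natCast]; exact this⟩

/-- Exchanging the images of two points on the same cycle splits the cycle. -/
theorem not_sameCycle_of_swap_images (hB : ∀ x, B x → B (π x)) (ha : B a) (hab : a ≠ b)
    (h2 : π' b = π a) (ho : ∀ x, B x → x ≠ a → x ≠ b → π' x = π x)
    (hs : π.SameCycle a b) : ¬ π'.SameCycle a b := by
  classical
  cases nonempty_fintype α
  have hBpow : ∀ i : ℕ, B ((π ^ i) a) := by
    intro i
    induction i with
    | zero => simpa using ha
    | succ i ih => rw [pow_succ']; exact hB _ ih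
  have hex : ∃ m : ℕ, 0 < m ∧ (π ^ m) a = b := by
    obtain ⟨i, hi, -, h⟩ := hs.exists_pow_eq π
    exact ⟨i, hi, h⟩
  obtain ⟨hm0, hmb⟩ := Nat.find_spec hex
  have hmin : ∀ j, 0 < j → j < Nat.find hex → (π ^ j) a ≠ b :=
    fun j hj hjm hh => Nat.find_min hex hjm ⟨hj, hh⟩
  set m := Nat.find hex
  have hna : ∀ j, 0 < j → j ≤ m → (π ^ j) a ≠ a := by
    intro j hj hjm hh
    rcases Nat.lt_or_ge j m with hlt | hge
    · refine hmin (m - j) (by omega) (by omega) ?_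
      have : (π ^ m) a = (π ^ (m - j)) ((π ^ j) a) := by
        rw [← Equiv.Perm.mul_apply, ← pow_add]; congr 2; omega
      rw [hh] at this
      rw [← this, hmb]
    · obtain rfl : j = m := le_antisymm hjm hge
      exact hab (hh ▸ hmb)
  -- The segment `π a, …, π ^ m a = b`, with `m` the first time that `b` is reached, is closed under
  -- `π'` and omits `a`.
  have hclosed : ∀ n : ℕ, ∃ j, 0 < j ∧ j ≤ m ∧ (π' ^ n) b = (π ^ j) a := by
    intro n
    induction n with
    | zero => exact ⟨m, hm0, le_rfl, by simpa using hmb.symm⟩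
    | succ n ih =>
      obtain ⟨j, hj0, hjm, hj⟩ := ih
      rw [pow_succ', Equiv.Perm.mul_apply, hj]
      rcases Nat.lt_or_ge j m with hlt | hge
      · refine ⟨j + 1, by omega, by omega, ?_⟩
        rw [ho _ (hBpow j) (hna j hj0 hjm) (hmin j hj0 hlt), pow_succ', Equiv.Perm.mul_apply]
      · obtain rfl : j = m := le_antisymm hjm hge
        refine ⟨1, by omega, by omega, ?_⟩
        rw [hmb, h2, pow_one]
  intro h
  obtain ⟨i, -, -, hi⟩ := h.symm.exists_pow_eq π'
  obtain ⟨j, hj0, hjm, hj⟩ := hclosed i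
  exact hna j hj0 hjm (by rw [← hj, hi])

end Perm

namespace KnotDiagram
namespace Checkerboard
noncomputable section
open scoped Classical

variable {D : KnotDiagram} (κ : D.Checkerboard)

/-! ### The circles of a state -/

theorem black_sub_one (c : Fin D.n) (k : ZMod 4) : κ.black (c, k - 1) = !κ.black (c, k) := by
  have := κ.black_adj c (k - 1)
  rw [sub_add_cancel] at this
  rw [this, Bool.not_not]

theorem black_add_two (c : Fin D.n) (k : ZMod 4) : κ.black (c, k + 2) = κ.black (c, k) := by
  have h : k + 2 = k + 1 + 1 := by ring
  rw [h, κ.black_adj, κ.black_adj, Bool.not_not]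

theorem black_glue (a : D.HalfEdge) : κ.black (D.glue a) = !κ.black a := by
  have h := κ.black_next a
  have h' : D.nextCorner a = ((D.glue a).1, (D.glue a).2 - 1) := rfl
  rw [h', black_sub_one] at h
  rw [← h, Bool.not_not]

@[simp] theorem turn_fst (H : Finset (Fin D.n)) (a : D.HalfEdge) : (κ.turn H a).1 = a.1 := by
  unfold turn; split_ifs <;> rfl

theorem black_turn (H : Finset (Fin D.n)) (a : D.HalfEdge) :
    κ.black (κ.turn H a) = !κ.black a := by
  unfold turn
  split_ifs
  · exact κ.black_adj a.1 a.2
  · exact κ.black_sub_one a.1 a.2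

theorem turn_turn (H : Finset (Fin D.n)) (a : D.HalfEdge) : κ.turn H (κ.turn H a) = a := by
  have hb := κ.black_turn H a
  have h1 := κ.turn_fst H a
  rw [turn]
  rw [hb, h1]
  unfold turn
  obtain ⟨c, k⟩ := a
  by_cases h : c ∈ H <;> cases hk : κ.black (c, k) <;> simp [h]

theorem turn_add_two (H : Finset (Fin D.n)) (c : Fin D.n) (k : ZMod 4) :
    κ.turn H (c, k + 2) = ((κ.turn H (c, k)).1, (κ.turn H (c, k)).2 + 2) := by
  unfold turn
  simp only [black_add_two]
  split_ifs
  · simp only [Prod.mk.injEq, true_and]; ring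
  · simp only [Prod.mk.injEq, true_and]; ring

theorem zmod_four_sub_one (k : ZMod 4) : k - 1 = k + 1 + 2 := by revert k; decide

theorem zmod_four_add_four (k : ZMod 4) : k + 2 + 2 = k := by revert k; decide

theorem turn_toggle_self (H : Finset (Fin D.n)) (e : Fin D.n) (k : ZMod 4) :
    κ.turn (symmDiff H {e}) (e, k) = κ.turn H (e, k + 2) := by
  have hm : e ∈ symmDiff H {e} ↔ e ∉ H := by simp [Finset.mem_symmDiff]
  unfold turn
  simp only [black_add_two, hm]
  by_cases h : e ∈ H <;> cases κ.black (e, k) <;> simp [h] <;> (revert k; decide)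

theorem turn_toggle_of_ne (H : Finset (Fin D.n)) (e : Fin D.n) (a : D.HalfEdge) (h : a.1 ≠ e) :
    κ.turn (symmDiff H {e}) a = κ.turn H a := by
  have hm : a.1 ∈ symmDiff H {e} ↔ a.1 ∈ H := by simp [Finset.mem_symmDiff, h]
  unfold turn
  simp only [hm]

/-- the permutation which follows a circle of the state of `H` -/
def walk (H : Finset (Fin D.n)) : Equiv.Perm D.HalfEdge :=
  (Function.Involutive.toPerm (κ.turn H) (κ.turn_turn H)).trans D.glue

theorem walk_apply (H : Finset (Fin D.n)) (a : D.HalfEdge) :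
    κ.walk H a = D.glue (κ.turn H a) := rfl

theorem black_walk (H : Finset (Fin D.n)) (a : D.HalfEdge) :
    κ.black (κ.walk H a) = κ.black a := by
  rw [walk_apply, black_glue, black_turn, Bool.not_not]

/-- the half-edge of the arc of `a` which has a black corner on its left -/
def rep (a : D.HalfEdge) : D.HalfEdge := if κ.black a = true then a else D.glue a

variable {κ}

theorem SameFace.refl (H : Finset (Fin D.n)) (a : D.HalfEdge) : κ.SameFace H a a :=
  Relation.EqvGen.refl a

theorem SameFace.symm {H : Finset (Fin D.n)} {a b : D.HalfEdge} (h : κ.SameFace H a b) :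
    κ.SameFace H b a := Relation.EqvGen.symm _ _ h

theorem SameFace.trans {H : Finset (Fin D.n)} {a b c : D.HalfEdge} (h : κ.SameFace H a b)
    (h' : κ.SameFace H b c) : κ.SameFace H a c := Relation.EqvGen.trans _ _ _ h h'

theorem sameFace_glue (H : Finset (Fin D.n)) (a : D.HalfEdge) : κ.SameFace H a (D.glue a) :=
  Relation.EqvGen.rel _ _ (Or.inl rfl)

theorem sameFace_turn (H : Finset (Fin D.n)) (a : D.HalfEdge) : κ.SameFace H a (κ.turn H a) :=
  Relation.EqvGen.rel _ _ (Or.inr rfl)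

/-- induction for `SameFace`: it is the least equivalence relation containing `glue` and `turn` -/
theorem SameFace.induct {H : Finset (Fin D.n)} {r : D.HalfEdge → D.HalfEdge → Prop}
    (hr : Equivalence r) (hg : ∀ a, r a (D.glue a)) (ht : ∀ a, r a (κ.turn H a))
    {a b : D.HalfEdge} (h : κ.SameFace H a b) : r a b := by
  induction h with
  | rel x y h => rcases h with rfl | rfl; exacts [hg _, ht _]
  | refl x => exact hr.refl x
  | symm x y _ ih => exact hr.symm ih
  | trans x y z _ _ ih ih' => exact hr.trans ih ih'

theorem sameFace_walk (H : Finset (Fin D.n)) (a : D.HalfEdge) : κ.SameFace H a (κ.walk H a) :=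
  (sameFace_turn H a).trans (sameFace_glue H _)

theorem sameFace_rep (H : Finset (Fin D.n)) (a : D.HalfEdge) : κ.SameFace H a (κ.rep a) := by
  unfold rep
  split_ifs
  exacts [SameFace.refl H a, sameFace_glue H a]

/-- The walk preserves colors, so each circle carries two of its cycles, one for each direction.
Choosing in each arc the half-edge with black corner on its left selects one of the two. -/
theorem sameFace_iff_sameCycle (H : Finset (Fin D.n)) (a b : D.HalfEdge) :
    κ.SameFace H a b ↔ (κ.walk H).SameCycle (κ.rep a) (κ.rep b) := by
  constructor
  · intro h
    refine SameFace.induct (r := fun a b => (κ.walk H).SameCycle (κ.rep a) (κ.rep b))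
      ⟨fun _ => Equiv.Perm.SameCycle.refl _ _, fun h => h.symm, fun h h' => h.trans h'⟩
      (fun a => ?_) (fun a => ?_) h
    · have : κ.rep (D.glue a) = κ.rep a := by
        unfold rep
        rw [black_glue]
        cases h : κ.black a <;> simp [D.glue_glue]
      rw [this]
    · cases h : κ.black a
      · have h1 : κ.rep (κ.turn H a) = κ.turn H a := by
          unfold rep; rw [black_turn, h]; rfl
        have h2 : κ.rep a = κ.walk H (κ.turn H a) := by
          unfold rep; rw [walk_apply, turn_turn, h]; rfl
        rw [h1, h2]
        exact (Equiv.Perm.sameCycle_apply_left).2 (Equiv.Perm.SameCycle.refl _ _)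
      · have h1 : κ.rep (κ.turn H a) = κ.walk H a := by
          unfold rep; rw [black_turn, h]; rfl
        have h2 : κ.rep a = a := by
          unfold rep; rw [h]; rfl
        rw [h1, h2]
        exact (Equiv.Perm.sameCycle_apply_right).2 (Equiv.Perm.SameCycle.refl _ _)
  · rintro ⟨i, hi⟩
    have key : ∀ (j : ℤ) (x : D.HalfEdge), κ.SameFace H x ((κ.walk H ^ j) x) := by
      intro j
      induction j using Int.induction_on with
      | zero => intro x; exact SameFace.refl H x
      | succ j ih =>
        intro x
        rw [zpow_add_one, Equiv.Perm.mul_apply]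
        exact (sameFace_walk H x).trans (ih _)
      | pred j ih =>
        intro x
        rw [zpow_sub_one, Equiv.Perm.mul_apply]
        refine SameFace.trans (SameFace.symm ?_) (ih _)
        have h := sameFace_walk (κ := κ) H ((κ.walk H)⁻¹ x)
        rwa [← Equiv.Perm.mul_apply, mul_inv_cancel] at h
    exact ((sameFace_rep H a).trans (hi ▸ key i _)).trans (sameFace_rep H b).symm

/-- the two strands of the smoothed crossing `e` are on the same circle -/
def Pinched (κ : D.Checkerboard) (H : Finset (Fin D.n)) (e : Fin D.n) : Prop :=
  κ.SameFace H (e, 0) (e, 2)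

theorem sameFace_add_two_iff_turn (H : Finset (Fin D.n)) (e : Fin D.n) (k : ZMod 4) :
    κ.SameFace H (e, k) (e, k + 2) ↔ κ.SameFace H (e, k + 1) (e, k + 1 + 2) := by
  have ht : κ.turn H (e, k) = (e, k + 1) ∨ κ.turn H (e, k) = (e, k + 1 + 2) := by
    unfold turn
    split_ifs
    · exact Or.inl rfl
    · right; simp only [zmod_four_sub_one]
  have h1 := sameFace_turn (κ := κ) H (e, k)
  have h2 := sameFace_turn (κ := κ) H (e, k + 2)
  rw [turn_add_two] at h2
  rcases ht with ht | ht
  · rw [ht] at h1 h2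
    exact ⟨fun h => (h1.symm.trans h).trans h2, fun h => (h1.trans h).trans h2.symm⟩
  · rw [ht] at h1 h2
    simp only [zmod_four_add_four] at h2
    exact ⟨fun h => ((h1.symm.trans h).trans h2).symm, fun h => (h1.trans h.symm).trans h2.symm⟩

theorem pinched_iff (H : Finset (Fin D.n)) (e : Fin D.n) (k : ZMod 4) :
    κ.SameFace H (e, k) (e, k + 2) ↔ κ.Pinched H e := by
  have h0 := sameFace_add_two_iff_turn (κ := κ) H e 0
  have h1 := sameFace_add_two_iff_turn (κ := κ) H e 1
  have h2 := sameFace_add_two_iff_turn (κ := κ) H e 2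
  fin_cases k
  · rfl
  · exact h0.symm
  · exact (h0.trans h1).symm
  · exact ((h0.trans h1).trans h2).symm

theorem at_crossing (H : Finset (Fin D.n)) (e : Fin D.n) (k : ZMod 4) :
    κ.SameFace H (e, k) (e, 0) ∨ κ.SameFace H (e, k) (e, 2) := by
  have ht : κ.turn H (e, 1) = (e, 2) ∨ κ.turn H (e, 1) = (e, 0) := by
    unfold turn
    split_ifs
    exacts [Or.inl rfl, Or.inr rfl]
  have h1 := sameFace_turn (κ := κ) H (e, 1)
  have h3 := sameFace_turn (κ := κ) H (e, 1 + 2)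
  rw [turn_add_two] at h3
  fin_cases k
  · exact Or.inl (SameFace.refl _ _)
  · rcases ht with ht | ht <;> rw [ht] at h1
    exacts [Or.inr h1, Or.inl h1]
  · exact Or.inr (SameFace.refl _ _)
  · rcases ht with ht | ht <;> rw [ht] at h3
    exacts [Or.inl h3, Or.inr h3]

theorem exists_black_at (κ : D.Checkerboard) (e : Fin D.n) : ∃ k, κ.black (e, k) = true := by
  cases h : κ.black (e, 0)
  · exact ⟨0 + 1, by rw [κ.black_adj, h]; rfl⟩
  · exact ⟨0, h⟩

theorem black_at_iff (e : Fin D.n) {k : ZMod 4} (hk : κ.black (e, k) = true) (j : ZMod 4) :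
    κ.black (e, j) = true ↔ j = k ∨ j = k + 2 := by
  have h1 := κ.black_adj e k
  have h2 := κ.black_add_two e k
  have h3 := κ.black_add_two e (k + 1)
  rw [hk] at h1 h2
  rw [h1] at h3
  have hj : ∀ j k : ZMod 4, j = k ∨ j = k + 1 ∨ j = k + 2 ∨ j = k + 1 + 2 := by decide
  have hd1 : ∀ k : ZMod 4, ¬ (k + 1 = k ∨ k + 1 = k + 2) := by decide
  have hd3 : ∀ k : ZMod 4, ¬ (k + 1 + 2 = k ∨ k + 1 + 2 = k + 2) := by decide
  rcases hj j k with rfl | rfl | rfl | rfl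
  · simp [hk]
  · exact iff_of_false (by rw [h1]; decide) (hd1 k)
  · simp [h2]
  · exact iff_of_false (by rw [h3]; decide) (hd3 k)

/-- Toggling an edge merges two circles or splits a circle. -/
theorem pinched_toggle (H : Finset (Fin D.n)) (e : Fin D.n) :
    κ.Pinched (symmDiff H {e}) e ↔ ¬ κ.Pinched H e := by
  obtain ⟨k, hk⟩ := exists_black_at κ e
  have hk2 : κ.black (e, k + 2) = true := by rw [black_add_two, hk]
  have hr : κ.rep (e, k) = (e, k) := by unfold rep; rw [hk]; rfl
  have hr2 : κ.rep (e, k + 2) = (e, k + 2) := by unfold rep; rw [hk2]; rfl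
  have hne : ((e, k) : D.HalfEdge) ≠ (e, k + 2) := by
    intro h
    have := congrArg Prod.snd h
    have hd : ∀ k : ZMod 4, k ≠ k + 2 := by decide
    exact hd k this
  rw [← pinched_iff _ e k, ← pinched_iff _ e k, sameFace_iff_sameCycle, sameFace_iff_sameCycle,
    hr, hr2]
  -- Of the four half-edges at `e` only two are black, and toggling `e` exchanges their images under
  -- the walk. Restricted to black half-edges the two walks thus differ by a transposition.
  have hB : ∀ x, κ.black x = true → κ.black (κ.walk H x) = true := by
    intro x hx; rw [black_walk, hx]
  have h1 : κ.walk (symmDiff H {e}) (e, k) = κ.walk H (e, k + 2) := by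
    rw [walk_apply, walk_apply, turn_toggle_self]
  have h2 : κ.walk (symmDiff H {e}) (e, k + 2) = κ.walk H (e, k) := by
    rw [walk_apply, walk_apply, turn_toggle_self, zmod_four_add_four]
  have ho : ∀ x, κ.black x = true → x ≠ (e, k) → x ≠ (e, k + 2) →
      κ.walk (symmDiff H {e}) x = κ.walk H x := by
    rintro ⟨c, j⟩ hx hx1 hx2
    rw [walk_apply, walk_apply, turn_toggle_of_ne]
    rintro rfl
    rcases (black_at_iff _ hk j).1 hx with rfl | rfl
    exacts [hx1 rfl, hx2 rfl]
  constructor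
  · intro h h'
    exact not_sameCycle_of_swap_images hB hk hne h2 ho h' h
  · exact sameCycle_of_swap_images hB hk2 h1 ho

/-- If the two strands at `e` are on different circles, then toggling `e` merges these. -/
theorem sameFace_toggle {H : Finset (Fin D.n)} {e : Fin D.n} (h : ¬ κ.Pinched H e)
    (a b : D.HalfEdge) :
    κ.SameFace (symmDiff H {e}) a b ↔ κ.SameFace H a b ∨
      (κ.SameFace H a (e, 0) ∧ κ.SameFace H b (e, 2)) ∨
      (κ.SameFace H a (e, 2) ∧ κ.SameFace H b (e, 0)) := by
  have hp : κ.Pinched (symmDiff H {e}) e := (pinched_toggle H e).2 h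
  have hall : ∀ j, κ.SameFace (symmDiff H {e}) (e, j) (e, 0) := by
    intro j
    rcases at_crossing (κ := κ) (symmDiff H {e}) e j with h' | h'
    exacts [h', h'.trans hp.symm]
  -- After the merge all four half-edges at `e` are on one circle, so an old turn at `e` stays
  -- within it.
  have hle : ∀ {a b}, κ.SameFace H a b → κ.SameFace (symmDiff H {e}) a b := by
    intro a b hab
    refine SameFace.induct (r := κ.SameFace (symmDiff H {e}))
      ⟨SameFace.refl _, SameFace.symm, SameFace.trans⟩ (sameFace_glue _) (fun a => ?_) hab
    by_cases ha : a.1 = e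
    · obtain ⟨c, j⟩ := a
      obtain rfl : c = e := ha
      have ht : κ.turn H (c, j) = (c, (κ.turn H (c, j)).2) := Prod.ext (κ.turn_fst H _) rfl
      rw [ht]
      exact (hall _).trans (hall _).symm
    · rw [← turn_toggle_of_ne κ H e a ha]
      exact sameFace_turn _ _
  constructor
  · intro hab
    refine SameFace.induct (r := fun a b => κ.SameFace H a b ∨
      (κ.SameFace H a (e, 0) ∧ κ.SameFace H b (e, 2)) ∨
      (κ.SameFace H a (e, 2) ∧ κ.SameFace H b (e, 0))) ⟨?_, ?_, ?_⟩ ?_ ?_ hab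
    · exact fun a => Or.inl (SameFace.refl _ _)
    · rintro a b (h | ⟨h, h'⟩ | ⟨h, h'⟩)
      exacts [Or.inl h.symm, Or.inr (Or.inr ⟨h', h⟩), Or.inr (Or.inl ⟨h', h⟩)]
    · rintro a b c (h1 | ⟨h1, h2⟩ | ⟨h1, h2⟩) (h3 | ⟨h3, h4⟩ | ⟨h3, h4⟩)
      · exact Or.inl (h1.trans h3)
      · exact Or.inr (Or.inl ⟨h1.trans h3, h4⟩)
      · exact Or.inr (Or.inr ⟨h1.trans h3, h4⟩)
      · exact Or.inr (Or.inl ⟨h1, h3.symm.trans h2⟩)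
      · exact absurd (h3.symm.trans h2) h
      · exact Or.inl (h1.trans h4.symm)
      · exact Or.inr (Or.inr ⟨h1, h3.symm.trans h2⟩)
      · exact Or.inl (h1.trans h4.symm)
      · exact absurd (h2.symm.trans h3) h
    · exact fun a => Or.inl (sameFace_glue H a)
    · intro a
      by_cases ha : a.1 = e
      · obtain ⟨c, j⟩ := a
        obtain rfl : c = e := ha
        have ht : κ.turn (symmDiff H {c}) (c, j) = (c, (κ.turn (symmDiff H {c}) (c, j)).2) :=
          Prod.ext (κ.turn_fst _ _) rfl
        rw [ht]
        rcases at_crossing (κ := κ) H c j with h1 | h1 <;>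
          rcases at_crossing (κ := κ) H c (κ.turn (symmDiff H {c}) (c, j)).2 with h2 | h2
        exacts [Or.inl (h1.trans h2.symm), Or.inr (Or.inl ⟨h1, h2⟩), Or.inr (Or.inr ⟨h1, h2⟩),
          Or.inl (h1.trans h2.symm)]
      · rw [turn_toggle_of_ne κ H e a ha]
        exact Or.inl (sameFace_turn _ _)
  · rintro (h1 | ⟨h1, h2⟩ | ⟨h1, h2⟩)
    · exact hle h1
    · exact ((hle h1).trans hp).trans (hle h2).symm
    · exact ((hle h1).trans hp.symm).trans (hle h2).symm

end
end Checkerboard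
end KnotDiagram


/-- Joining two different classes of an equivalence relation lowers the number of classes by one. -/
theorem card_quotient_merge {α : Type*} [Finite α] (s t : Setoid α) (u v : α) (h : ¬ s u v)
    (ht : ∀ a b, t a b ↔ s a b ∨ (s a u ∧ s b v) ∨ (s a v ∧ s b u)) :
    Nat.card (Quotient t) + 1 = Nat.card (Quotient s) := by
  classical
  have hle : ∀ a b, s a b → t a b := fun a b hab => (ht a b).2 (Or.inl hab)
  have huv : t u v := (ht u v).2 (Or.inr (Or.inl ⟨s.refl u, s.refl v⟩))
  let f : Quotient s → Quotient t := Quotient.map' id hle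
  have hf : ∀ a, f (Quotient.mk s a) = Quotient.mk t a := fun a => rfl
  -- With the class of `v` left out, no two classes are identified any more, and the class of `u`
  -- covers the merged one.
  let g : {q : Quotient s // q ≠ Quotient.mk s v} → Quotient t := fun q => f q.1
  have hg : Function.Bijective g := by
    constructor
    · rintro ⟨q, hq⟩ ⟨q', hq'⟩ hqq
      induction q using Quotient.inductionOn with | _ a =>
      induction q' using Quotient.inductionOn with | _ b =>
      have hav : ¬ s a v := fun h => hq (Quotient.sound h)
      have hbv : ¬ s b v := fun h => hq' (Quotient.sound h)
      have hab : t a b := Quotient.exact hqq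
      rcases (ht a b).1 hab with h1 | ⟨_, h1⟩ | ⟨h1, _⟩
      · exact Subtype.ext (Quotient.sound h1)
      · exact absurd h1 hbv
      · exact absurd h1 hav
    · intro q
      induction q using Quotient.inductionOn with | _ a =>
      by_cases hav : s a v
      · refine ⟨⟨Quotient.mk s u, fun hh => h (Quotient.exact hh)⟩, ?_⟩
        exact Quotient.sound (t.trans huv (t.symm (hle _ _ hav)))
      · exact ⟨⟨Quotient.mk s a, fun hh => hav (Quotient.exact hh)⟩, rfl⟩
  rw [← Nat.card_congr (Equiv.ofBijective g hg), ← Finite.card_option]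
  exact Nat.card_congr (Equiv.optionSubtypeNe _)

namespace KnotDiagram
namespace Checkerboard
noncomputable section
open scoped Classical

variable {D : KnotDiagram} (κ : D.Checkerboard)

/-! ### Regions as circles of the two extreme states -/

instance : Finite κ.Vertex :=
  inferInstanceAs (Finite {v : D.Region // ∃ a, κ.black a = true ∧ D.region a = v})

/-- the corner of the color `c` at the half-edge `a` -/
def cornerOf (c : Bool) (a : D.HalfEdge) : D.HalfEdge :=
  if κ.black a = c then a else (a.1, a.2 - 1)

/-- the state whose circles are the boundaries of the regions of color `c` -/
def extremeState (D : KnotDiagram) (c : Bool) : Finset (Fin D.n) :=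
  if c = true then ∅ else Finset.univ

variable {κ}

theorem black_cornerOf (c : Bool) (a : D.HalfEdge) : κ.black (κ.cornerOf c a) = c := by
  unfold cornerOf
  split_ifs with h
  · exact h
  · rw [black_sub_one]
    cases c <;> cases h' : κ.black (a.1, a.2) <;> simp_all

theorem turn_extreme (c : Bool) (a : D.HalfEdge) :
    κ.turn (extremeState D c) a = if κ.black a = c then (a.1, a.2 + 1) else (a.1, a.2 - 1) := by
  unfold turn extremeState
  cases c <;> cases h : κ.black a <;> simp

theorem nextCorner_apply (a : D.HalfEdge) :
    D.nextCorner a = ((D.glue a).1, (D.glue a).2 - 1) := rfl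

theorem region_nextCorner (a : D.HalfEdge) : D.region (D.nextCorner a) = D.region a :=
  Quotient.sound ((Equiv.Perm.sameCycle_apply_left).2 (Equiv.Perm.SameCycle.refl _ _))

theorem black_eq_of_region_eq {a b : D.HalfEdge} (h : D.region a = D.region b) :
    κ.black a = κ.black b := by
  have h' : D.nextCorner.SameCycle a b := Quotient.exact h
  obtain ⟨i, -, -, rfl⟩ := h'.exists_pow_eq D.nextCorner
  clear h h'
  induction i with
  | zero => rfl
  | succ i ih => rw [pow_succ', Equiv.Perm.mul_apply, κ.black_next, ← ih]

/-- In this state every turn follows a corner of color `c`, so a circle runs along the boundary of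
one region of that color. -/
theorem sameFace_extreme_iff (c : Bool) (a b : D.HalfEdge) :
    κ.SameFace (extremeState D c) a b ↔
      D.region (κ.cornerOf c a) = D.region (κ.cornerOf c b) := by
  constructor
  · intro h
    refine SameFace.induct (r := fun a b => D.region (κ.cornerOf c a) = D.region (κ.cornerOf c b))
      ⟨fun _ => rfl, fun h => h.symm, fun h h' => h.trans h'⟩ (fun a => ?_) (fun a => ?_) h
    · have hg := κ.black_glue a
      by_cases ha : κ.black a = c
      · have h1 : κ.cornerOf c a = a := if_pos ha
        have h2 : κ.cornerOf c (D.glue a) = D.nextCorner a := by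
          unfold cornerOf
          rw [if_neg (by rw [hg, ha]; cases c <;> decide)]
          rfl
        rw [h1, h2, region_nextCorner]
      · have h1 : κ.cornerOf c a = D.nextCorner (D.glue a) := by
          unfold cornerOf
          rw [if_neg ha, nextCorner_apply, D.glue_glue]
        have h2 : κ.cornerOf c (D.glue a) = D.glue a := by
          unfold cornerOf
          rw [if_pos (by rw [hg]; revert ha; cases c <;> cases κ.black a <;> decide)]
        rw [h1, h2, region_nextCorner]
    · congr 1
      rw [turn_extreme]
      unfold cornerOf
      by_cases ha : κ.black a = c
      · rw [if_pos ha, if_pos ha, κ.black_adj, if_neg (by rw [ha]; cases c <;> decide)]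
        simp
      · rw [if_neg ha, if_neg ha, κ.black_sub_one,
          if_pos (by revert ha; cases c <;> cases κ.black a <;> decide)]
  · intro h
    have hcorner : ∀ a, κ.SameFace (extremeState D c) a (κ.cornerOf c a) := by
      intro a
      unfold cornerOf
      split_ifs with ha
      · exact SameFace.refl _ _
      · have := sameFace_turn (κ := κ) (extremeState D c) a
        rwa [turn_extreme, if_neg ha] at this
    have hnext : ∀ a, κ.black a = c → κ.SameFace (extremeState D c) a (D.nextCorner a) := by
      intro a ha
      have h1 := (sameFace_glue (κ := κ) (extremeState D c) a).trans
        (sameFace_turn _ (D.glue a))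
      rwa [turn_extreme, if_neg (by rw [κ.black_glue, ha]; cases c <;> decide)] at h1
    have hpow : ∀ (i : ℕ) (a), κ.black a = c →
        κ.black ((D.nextCorner ^ i) a) = c ∧
          κ.SameFace (extremeState D c) a ((D.nextCorner ^ i) a) := by
      intro i a ha
      induction i with
      | zero => exact ⟨ha, SameFace.refl _ _⟩
      | succ i ih =>
        rw [pow_succ', Equiv.Perm.mul_apply]
        exact ⟨by rw [κ.black_next]; exact ih.1, ih.2.trans (hnext _ ih.1)⟩
    have h' : D.nextCorner.SameCycle (κ.cornerOf c a) (κ.cornerOf c b) := Quotient.exact h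
    obtain ⟨i, -, -, hi⟩ := h'.exists_pow_eq D.nextCorner
    have := (hpow i _ (black_cornerOf c a)).2
    rw [hi] at this
    exact ((hcorner a).trans this).trans (hcorner b).symm

/-- the circles of the state of `H`, as an equivalence relation on half-edges -/
def faceSetoid (κ : D.Checkerboard) (H : Finset (Fin D.n)) : Setoid D.HalfEdge :=
  ⟨κ.SameFace H, SameFace.refl H, SameFace.symm, SameFace.trans⟩

/-- the number of circles of the state of `H` -/
def faces (κ : D.Checkerboard) (H : Finset (Fin D.n)) : ℕ := Nat.card (Quotient (κ.faceSetoid H))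

theorem faces_extreme (c : Bool) : κ.faces (extremeState D c) =
    Nat.card {v : D.Region // ∃ a, κ.black a = c ∧ D.region a = v} := by
  refine Nat.card_congr (Equiv.ofBijective (Quotient.lift
    (fun a => (⟨D.region (κ.cornerOf c a), κ.cornerOf c a, black_cornerOf c a, rfl⟩ :
      {v : D.Region // ∃ a, κ.black a = c ∧ D.region a = v}))
    (fun a b h => Subtype.ext ((sameFace_extreme_iff c a b).1 h))) ⟨?_, ?_⟩)
  · intro q q' h
    induction q using Quotient.inductionOn with | _ a =>
    induction q' using Quotient.inductionOn with | _ b =>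
    exact Quotient.sound ((sameFace_extreme_iff c a b).2 (congrArg Subtype.val h))
  · rintro ⟨v, a, ha, rfl⟩
    refine ⟨Quotient.mk _ a, Subtype.ext ?_⟩
    change D.region (κ.cornerOf c a) = D.region a
    rw [show κ.cornerOf c a = a from if_pos ha]

/-- The two extreme states see the black and the white regions. This is where planarity enters. -/
theorem faces_empty_add_faces_univ : κ.faces ∅ + κ.faces Finset.univ = D.n + 2 := by
  have h1 := faces_extreme (κ := κ) true
  have h2 := faces_extreme (κ := κ) false
  have e1 : extremeState D true = ∅ := rfl
  have e2 : extremeState D false = Finset.univ := rfl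
  rw [e1] at h1
  rw [e2] at h2
  rw [h1, h2, ← D.planar, ← Nat.card_sum]
  have h3 : ∀ v : D.Region, (∃ a, κ.black a = false ∧ D.region a = v) ↔
      ¬ ∃ a, κ.black a = true ∧ D.region a = v := by
    intro v
    constructor
    · rintro ⟨a, ha, rfl⟩ ⟨b, hb, hab⟩
      rw [black_eq_of_region_eq hab, ha] at hb
      cases hb
    · intro h
      induction v using Quotient.inductionOn with | _ a =>
      refine ⟨a, ?_, rfl⟩
      cases ha : κ.black a
      · rfl
      · exact absurd ⟨a, ha, rfl⟩ h
  exact Nat.card_congr ((Equiv.sumCongr (Equiv.refl _) (Equiv.subtypeEquivRight h3)).trans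
    (Equiv.sumCompl _))

/-! ### Connectivity in the Tait graph -/

/-- the black region at the half-edge `a` -/
def vtx (κ : D.Checkerboard) (a : D.HalfEdge) : κ.Vertex :=
  ⟨D.region (κ.cornerOf true a), κ.cornerOf true a, black_cornerOf true a, rfl⟩

theorem sameFace_empty_iff (a b : D.HalfEdge) : κ.SameFace ∅ a b ↔ κ.vtx a = κ.vtx b :=
  (sameFace_extreme_iff true a b).trans ⟨fun h => Subtype.ext h, fun h => congrArg Subtype.val h⟩

theorem vtx_surjective (v : κ.Vertex) : ∃ a, κ.vtx a = v := by
  obtain ⟨v, a, ha, rfl⟩ := v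
  exact ⟨a, Subtype.ext (by change D.region (κ.cornerOf true a) = _
                            rw [show κ.cornerOf true a = a from if_pos ha])⟩

theorem vtx_of_black {a : D.HalfEdge} (h : κ.black a = true) : (κ.vtx a).1 = D.region a := by
  change D.region (κ.cornerOf true a) = _
  rw [show κ.cornerOf true a = a from if_pos h]

theorem vtx_at_crossing (e : Fin D.n) (k : ZMod 4) :
    κ.vtx (e, k) = κ.vtx (e, 0) ∨ κ.vtx (e, k) = κ.vtx (e, 2) := by
  rw [← sameFace_empty_iff, ← sameFace_empty_iff]
  exact at_crossing ∅ e k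

theorem vtx_add_two (e : Fin D.n) (k : ZMod 4) :
    (κ.vtx (e, k) = κ.vtx (e, 0) ∧ κ.vtx (e, k + 2) = κ.vtx (e, 2)) ∨
    (κ.vtx (e, k) = κ.vtx (e, 2) ∧ κ.vtx (e, k + 2) = κ.vtx (e, 0)) := by
  have step : ∀ k, (κ.vtx (e, k + 1) = κ.vtx (e, k) ∧ κ.vtx (e, k + 1 + 2) = κ.vtx (e, k + 2)) ∨
      (κ.vtx (e, k + 1) = κ.vtx (e, k + 2) ∧ κ.vtx (e, k + 1 + 2) = κ.vtx (e, k)) := by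
    intro k
    have h1 := sameFace_turn (κ := κ) ∅ (e, k)
    have h2 := sameFace_turn (κ := κ) ∅ (e, k + 2)
    rw [turn_add_two] at h2
    have ht : κ.turn ∅ (e, k) = (e, k + 1) ∨ κ.turn ∅ (e, k) = (e, k + 1 + 2) := by
      unfold turn
      split_ifs
      · exact Or.inl rfl
      · right; simp only [zmod_four_sub_one]
    rcases ht with ht | ht <;> rw [ht] at h1 h2 <;> rw [sameFace_empty_iff] at h1 h2
    · exact Or.inl ⟨h1.symm, h2.symm⟩
    · simp only [zmod_four_add_four] at h2
      exact Or.inr ⟨h2.symm, h1.symm⟩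
  have h0 := step 0
  have h1 := step 1
  have h2 := step 2
  have c0 : ∀ k : ZMod 4, k = 0 ∨ k = 0 + 1 ∨ k = 1 + 1 ∨ k = 2 + 1 := by decide
  have e2 : (0 : ZMod 4) + 2 = 2 := by decide
  have e3 : (1 : ZMod 4) + 1 = 2 := by decide
  have e4 : (0 : ZMod 4) + 1 = 1 := by decide
  have e5 : (2 : ZMod 4) + 2 = 0 := by decide
  rw [e4, e2] at h0
  rw [e3, e5] at h1
  rw [e5] at h2
  rcases c0 k with rfl | rfl | rfl | rfl
  · left; rw [e2]; exact ⟨rfl, rfl⟩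
  · rw [e4]; exact h0
  · right; rw [e3, e5]; exact ⟨rfl, rfl⟩
  · rcases h2 with h | h
    · exact Or.inr h
    · exact Or.inl h

/-- The half-edges `(e, 0)` and `(e, 2)` border opposite black corners whatever the coloring, so
they name the two ends of `e` uniformly, in the same way as `Pinched` names its two strands. -/
theorem link_iff (e : Fin D.n) (x y : κ.Vertex) :
    κ.Link e x y ↔ (x = κ.vtx (e, 0) ∧ y = κ.vtx (e, 2)) ∨
      (x = κ.vtx (e, 2) ∧ y = κ.vtx (e, 0)) := by
  constructor
  · rintro ⟨k, hk, hx, hy⟩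
    have h1 : x = κ.vtx (e, k) := Subtype.ext (by rw [vtx_of_black hk, hx])
    have h2 : y = κ.vtx (e, k + 2) :=
      Subtype.ext (by rw [vtx_of_black (by rw [κ.black_add_two, hk]), hy])
    rw [h1, h2]
    exact vtx_add_two e k
  · obtain ⟨k, hk⟩ := exists_black_at κ e
    have hk2 : κ.black (e, k + 2) = true := by rw [κ.black_add_two, hk]
    have l1 : κ.Link e (κ.vtx (e, k)) (κ.vtx (e, k + 2)) :=
      ⟨k, hk, (vtx_of_black hk).symm, (vtx_of_black hk2).symm⟩
    have l2 : κ.Link e (κ.vtx (e, k + 2)) (κ.vtx (e, k)) :=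
      ⟨k + 2, hk2, (vtx_of_black hk2).symm,
        by rw [zmod_four_add_four]; exact (vtx_of_black hk).symm⟩
    rcases vtx_add_two (κ := κ) e k with ⟨h1, h2⟩ | ⟨h1, h2⟩ <;> rw [h1, h2] at l1 l2
    · rintro (⟨rfl, rfl⟩ | ⟨rfl, rfl⟩)
      exacts [l1, l2]
    · rintro (⟨rfl, rfl⟩ | ⟨rfl, rfl⟩)
      exacts [l2, l1]

theorem Joined.refl (H : Finset (Fin D.n)) (x : κ.Vertex) : κ.Joined H x x :=
  Relation.EqvGen.refl x

theorem Joined.symm {H : Finset (Fin D.n)} {x y : κ.Vertex} (h : κ.Joined H x y) :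
    κ.Joined H y x := Relation.EqvGen.symm _ _ h

theorem Joined.trans {H : Finset (Fin D.n)} {x y z : κ.Vertex} (h : κ.Joined H x y)
    (h' : κ.Joined H y z) : κ.Joined H x z := Relation.EqvGen.trans _ _ _ h h'

/-- the ends of the edge `e` are joined in `H` -/
def Spans (κ : D.Checkerboard) (H : Finset (Fin D.n)) (e : Fin D.n) : Prop :=
  κ.Joined H (κ.vtx (e, 0)) (κ.vtx (e, 2))

theorem forall_link_iff {e : Fin D.n} {r : κ.Vertex → κ.Vertex → Prop}
    (hr : ∀ x y, r x y → r y x) :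
    (∀ x y, κ.Link e x y → r x y) ↔ r (κ.vtx (e, 0)) (κ.vtx (e, 2)) := by
  constructor
  · exact fun h => h _ _ ((link_iff e _ _).2 (Or.inl ⟨rfl, rfl⟩))
  · rintro h x y hl
    rcases (link_iff e x y).1 hl with ⟨rfl, rfl⟩ | ⟨rfl, rfl⟩
    exacts [h, hr _ _ h]

theorem Joined.induct {H : Finset (Fin D.n)} {r : κ.Vertex → κ.Vertex → Prop}
    (hr : Equivalence r) (hl : ∀ e ∈ H, r (κ.vtx (e, 0)) (κ.vtx (e, 2)))
    {x y : κ.Vertex} (h : κ.Joined H x y) : r x y := by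
  induction h with
  | rel x y h =>
    obtain ⟨e, he, h⟩ := h
    exact (forall_link_iff (r := r) fun _ _ h => hr.symm h).2 (hl e he) x y h
  | refl x => exact hr.refl x
  | symm x y _ ih => exact hr.symm ih
  | trans x y z _ _ ih ih' => exact hr.trans ih ih'

theorem joined_equivalence (H : Finset (Fin D.n)) : Equivalence (κ.Joined H) :=
  ⟨Joined.refl H, Joined.symm, Joined.trans⟩

theorem spans_of_mem {H : Finset (Fin D.n)} {e : Fin D.n} (h : e ∈ H) : κ.Spans H e :=
  Relation.EqvGen.rel _ _ ⟨e, h, (link_iff e _ _).2 (Or.inl ⟨rfl, rfl⟩)⟩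

theorem joined_of_spans {H K : Finset (Fin D.n)} (h : ∀ e ∈ H, κ.Spans K e) {x y : κ.Vertex}
    (hxy : κ.Joined H x y) : κ.Joined K x y :=
  Joined.induct (joined_equivalence K) h hxy

theorem Spans.of_forall {H K : Finset (Fin D.n)} (h : ∀ e ∈ H, κ.Spans K e) {f : Fin D.n}
    (hf : κ.Spans H f) : κ.Spans K f := joined_of_spans h hf

theorem Spans.mono {H K : Finset (Fin D.n)} (h : H ⊆ K) {f : Fin D.n}
    (hf : κ.Spans H f) : κ.Spans K f := hf.of_forall fun _ he => spans_of_mem (h he)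

theorem onCycle_iff (H : Finset (Fin D.n)) (f : Fin D.n) :
    κ.OnCycle H f ↔ f ∈ H ∧ κ.Spans (H.erase f) f :=
  and_congr Iff.rfl (forall_link_iff (r := κ.Joined (H.erase f)) fun _ _ h => h.symm)

theorem joined_insert_iff (H : Finset (Fin D.n)) (e : Fin D.n) (x y : κ.Vertex) :
    κ.Joined (insert e H) x y ↔ κ.Joined H x y ∨
      (κ.Joined H x (κ.vtx (e, 0)) ∧ κ.Joined H y (κ.vtx (e, 2))) ∨
      (κ.Joined H x (κ.vtx (e, 2)) ∧ κ.Joined H y (κ.vtx (e, 0))) := by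
  have hle : ∀ {x y}, κ.Joined H x y → κ.Joined (insert e H) x y := fun h =>
    joined_of_spans (fun f hf => spans_of_mem (Finset.mem_insert_of_mem hf)) h
  have he : κ.Joined (insert e H) (κ.vtx (e, 0)) (κ.vtx (e, 2)) :=
    spans_of_mem (Finset.mem_insert_self e H)
  constructor
  · intro h
    refine Joined.induct (r := fun x y => κ.Joined H x y ∨
      (κ.Joined H x (κ.vtx (e, 0)) ∧ κ.Joined H y (κ.vtx (e, 2))) ∨
      (κ.Joined H x (κ.vtx (e, 2)) ∧ κ.Joined H y (κ.vtx (e, 0)))) ⟨?_, ?_, ?_⟩ ?_ h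
    · exact fun x => Or.inl (Joined.refl H x)
    · rintro a b (h | ⟨h, h'⟩ | ⟨h, h'⟩)
      exacts [Or.inl h.symm, Or.inr (Or.inr ⟨h', h⟩), Or.inr (Or.inl ⟨h', h⟩)]
    · rintro a b c (h1 | ⟨h1, h2⟩ | ⟨h1, h2⟩) (h3 | ⟨h3, h4⟩ | ⟨h3, h4⟩)
      · exact Or.inl (h1.trans h3)
      · exact Or.inr (Or.inl ⟨h1.trans h3, h4⟩)
      · exact Or.inr (Or.inr ⟨h1.trans h3, h4⟩)
      · exact Or.inr (Or.inl ⟨h1, h3.symm.trans h2⟩)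
      · exact Or.inr (Or.inl ⟨h1, h4⟩)
      · exact Or.inl (h1.trans h4.symm)
      · exact Or.inr (Or.inr ⟨h1, h3.symm.trans h2⟩)
      · exact Or.inl (h1.trans h4.symm)
      · exact Or.inr (Or.inr ⟨h1, h4⟩)
    · intro f hf
      rcases Finset.mem_insert.1 hf with rfl | hf
      · exact Or.inr (Or.inl ⟨Joined.refl _ _, Joined.refl _ _⟩)
      · exact Or.inl (spans_of_mem hf)
  · rintro (h1 | ⟨h1, h2⟩ | ⟨h1, h2⟩)
    · exact hle h1
    · exact ((hle h1).trans he).trans (hle h2).symm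
    · exact ((hle h1).trans he.symm).trans (hle h2).symm

/-- The exchange property. -/
theorem Spans.exchange {H : Finset (Fin D.n)} {e f : Fin D.n} (h : κ.Spans (insert e H) f)
    (hn : ¬ κ.Spans H f) : κ.Spans (insert f H) e := by
  have hle : ∀ {x y}, κ.Joined H x y → κ.Joined (insert f H) x y := fun h =>
    joined_of_spans (fun g hg => spans_of_mem (Finset.mem_insert_of_mem hg)) h
  have hf : κ.Spans (insert f H) f := spans_of_mem (Finset.mem_insert_self f H)
  rcases (joined_insert_iff H e _ _).1 h with h1 | ⟨h1, h2⟩ | ⟨h1, h2⟩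
  · exact absurd h1 hn
  · exact ((hle h1).symm.trans hf).trans (hle h2)
  · exact ((hle h2).symm.trans hf.symm).trans (hle h1)

/-! ### Circles and components -/

/-- a circle stays in one component -/
theorem SameFace.joined {H : Finset (Fin D.n)} {a b : D.HalfEdge} (h : κ.SameFace H a b) :
    κ.Joined H (κ.vtx a) (κ.vtx b) := by
  refine SameFace.induct (r := fun a b => κ.Joined H (κ.vtx a) (κ.vtx b))
    ⟨fun _ => Joined.refl _ _, Joined.symm, Joined.trans⟩ (fun a => ?_) (fun a => ?_) h
  · rw [(sameFace_empty_iff a (D.glue a)).1 (sameFace_glue ∅ a)]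
    exact Joined.refl _ _
  · by_cases ha : a.1 ∈ H
    · obtain ⟨e, k⟩ := a
      have ht : κ.turn H (e, k) = (e, (κ.turn H (e, k)).2) := Prod.ext (κ.turn_fst H _) rfl
      have he : κ.Joined H (κ.vtx (e, 0)) (κ.vtx (e, 2)) := spans_of_mem ha
      rw [ht]
      rcases vtx_at_crossing (κ := κ) e k with h1 | h1 <;>
        rcases vtx_at_crossing (κ := κ) e (κ.turn H (e, k)).2 with h2 | h2 <;> rw [h1, h2]
      exacts [Joined.refl _ _, he, he.symm, Joined.refl _ _]
    · have : κ.turn H a = κ.turn ∅ a := by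
        unfold turn; simp [ha]
      rw [this, (sameFace_empty_iff a _).1 (sameFace_turn ∅ a)]
      exact Joined.refl _ _

theorem Pinched.spans {H : Finset (Fin D.n)} {e : Fin D.n} (h : κ.Pinched H e) : κ.Spans H e :=
  SameFace.joined h

/-- the components of the spanning subgraph `H` -/
def joinedSetoid (κ : D.Checkerboard) (H : Finset (Fin D.n)) : Setoid κ.Vertex :=
  ⟨κ.Joined H, joined_equivalence H⟩

/-- the number of components of `H` -/
def comps (κ : D.Checkerboard) (H : Finset (Fin D.n)) : ℕ :=
  Nat.card (Quotient (κ.joinedSetoid H))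

/-- Travel along the knot: following an arc does not change the adjacent black region, and going
straight through a crossing moves to the other end of its edge. -/
theorem connectedSub_univ (κ : D.Checkerboard) : κ.ConnectedSub Finset.univ := by
  have key : ∀ a b : D.HalfEdge, κ.Joined Finset.univ (κ.vtx a) (κ.vtx b) := by
    intro a b
    induction D.one_component a b with
    | rel a b h =>
      rcases h with rfl | rfl
      · rw [(sameFace_empty_iff a (D.glue a)).1 (sameFace_glue ∅ a)]
        exact Joined.refl _ _
      · have he : κ.Joined Finset.univ (κ.vtx (a.1, 0)) (κ.vtx (a.1, 2)) :=
          spans_of_mem (Finset.mem_univ _)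
        rcases vtx_add_two (κ := κ) a.1 a.2 with ⟨h1, h2⟩ | ⟨h1, h2⟩
        · rw [h2, show κ.vtx a = _ from h1]; exact he
        · rw [h2, show κ.vtx a = _ from h1]; exact he.symm
    | refl a => exact Joined.refl _ _
    | symm a b _ ih => exact ih.symm
    | trans a b c _ _ ih ih' => exact ih.trans ih'
  intro u v
  obtain ⟨a, rfl⟩ := vtx_surjective u
  obtain ⟨b, rfl⟩ := vtx_surjective v
  exact key a b

theorem connectedSub_iff (H : Finset (Fin D.n)) : κ.ConnectedSub H ↔ ∀ e, κ.Spans H e :=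
  ⟨fun h _ => h _ _, fun h u v => joined_of_spans (fun e _ => h e) (κ.connectedSub_univ u v)⟩

theorem symmDiff_singleton_of_notMem {H : Finset (Fin D.n)} {e : Fin D.n} (h : e ∉ H) :
    symmDiff H {e} = insert e H := by
  ext x
  simp only [Finset.mem_symmDiff, Finset.mem_singleton, Finset.mem_insert]
  constructor
  · rintro (⟨h1, _⟩ | ⟨h1, _⟩)
    exacts [Or.inr h1, Or.inl h1]
  · rintro (rfl | h1)
    exacts [Or.inr ⟨rfl, h⟩, Or.inl ⟨h1, fun hx => h (hx ▸ h1)⟩]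

theorem symmDiff_singleton_of_mem {H : Finset (Fin D.n)} {e : Fin D.n} (h : e ∈ H) :
    symmDiff H {e} = H.erase e := by
  ext x
  simp only [Finset.mem_symmDiff, Finset.mem_singleton, Finset.mem_erase]
  constructor
  · rintro (⟨h1, h2⟩ | ⟨rfl, h1⟩)
    exacts [⟨h2, h1⟩, absurd h h1]
  · rintro ⟨h1, h2⟩
    exact Or.inl ⟨h2, h1⟩

/-! ### Counting circles and components: Euler's formula for spanning subgraphs -/

theorem faces_toggle_of_not_pinched {H : Finset (Fin D.n)} {e : Fin D.n} (h : ¬ κ.Pinched H e) :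
    κ.faces (symmDiff H {e}) + 1 = κ.faces H :=
  card_quotient_merge (κ.faceSetoid H) (κ.faceSetoid (symmDiff H {e})) (e, 0) (e, 2) h
    (fun a b => sameFace_toggle h a b)

theorem faces_toggle_of_pinched {H : Finset (Fin D.n)} {e : Fin D.n} (h : κ.Pinched H e) :
    κ.faces (symmDiff H {e}) = κ.faces H + 1 := by
  have h1 : ¬ κ.Pinched (symmDiff H {e}) e := fun h' => (pinched_toggle H e).1 h' h
  have := faces_toggle_of_not_pinched h1
  rw [symmDiff_symmDiff_cancel_right] at this
  exact this.symm

theorem comps_insert_of_spans {H : Finset (Fin D.n)} {e : Fin D.n} (h : κ.Spans H e) :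
    κ.comps (insert e H) = κ.comps H := by
  have : κ.joinedSetoid (insert e H) = κ.joinedSetoid H := by
    ext x y
    change κ.Joined _ x y ↔ κ.Joined _ x y
    constructor
    · refine joined_of_spans fun f hf => ?_
      rcases Finset.mem_insert.1 hf with rfl | hf
      exacts [h, spans_of_mem hf]
    · exact joined_of_spans fun f hf => spans_of_mem (Finset.mem_insert_of_mem hf)
  unfold comps
  rw [this]

theorem comps_insert_of_not_spans {H : Finset (Fin D.n)} {e : Fin D.n} (h : ¬ κ.Spans H e) :
    κ.comps (insert e H) + 1 = κ.comps H :=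
  card_quotient_merge (κ.joinedSetoid H) (κ.joinedSetoid (insert e H)) _ _ h
    (fun x y => joined_insert_iff H e x y)

theorem comps_empty : κ.comps ∅ = κ.faces ∅ := by
  refine (Nat.card_congr (Equiv.ofBijective (Quotient.map' (s₁ := κ.faceSetoid ∅)
    (s₂ := κ.joinedSetoid ∅) κ.vtx fun a b h => SameFace.joined h) ⟨?_, ?_⟩)).symm
  · intro q q' h
    induction q using Quotient.inductionOn with | _ a =>
    induction q' using Quotient.inductionOn with | _ b =>
    have hj : κ.Joined ∅ (κ.vtx a) (κ.vtx b) := Quotient.exact h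
    refine Quotient.sound ((sameFace_empty_iff a b).2 ?_)
    exact Joined.induct (r := fun x y => x = y) ⟨fun _ => rfl, Eq.symm, Eq.trans⟩
      (fun e he => absurd he (Finset.notMem_empty e)) hj
  · intro q
    induction q using Quotient.inductionOn with | _ v =>
    obtain ⟨a, rfl⟩ := vtx_surjective v
    exact ⟨Quotient.mk _ a, rfl⟩

theorem comps_univ (a : D.HalfEdge) : κ.comps Finset.univ = 1 := by
  rw [comps, Nat.card_eq_one_iff_unique]
  refine ⟨⟨fun q q' => ?_⟩, ⟨Quotient.mk _ (κ.vtx a)⟩⟩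
  induction q using Quotient.inductionOn with | _ u =>
  induction q' using Quotient.inductionOn with | _ v =>
  exact Quotient.sound (κ.connectedSub_univ u v)

/-- Euler's formula for the spanning subgraph `H` says that this number is a constant. -/
def eulerDefect (κ : D.Checkerboard) (H : Finset (Fin D.n)) : ℤ :=
  (κ.faces H : ℤ) - 2 * κ.comps H - H.card

/-- Inserting an edge changes the number of circles by one and joins at most two components. The
defect is preserved, except when the edge merges two circles of one component; then it drops by 2,
which is a handle. -/
theorem eulerDefect_insert {H : Finset (Fin D.n)} {e : Fin D.n} (he : e ∉ H) :
    κ.eulerDefect (insert e H) ≤ κ.eulerDefect H ∧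
      (κ.Spans H e → ¬ κ.Pinched H e → κ.eulerDefect (insert e H) < κ.eulerDefect H) := by
  unfold eulerDefect
  rw [Finset.card_insert_of_notMem he]
  by_cases hp : κ.Pinched H e
  · have h1 := faces_toggle_of_pinched hp
    have h2 := comps_insert_of_spans hp.spans
    rw [symmDiff_singleton_of_notMem he] at h1
    exact ⟨by omega, fun _ h => absurd hp h⟩
  · have h1 := faces_toggle_of_not_pinched hp
    rw [symmDiff_singleton_of_notMem he] at h1
    by_cases hs : κ.Spans H e
    · have h2 := comps_insert_of_spans hs
      exact ⟨by omega, fun _ _ => by omega⟩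
    · have h2 := comps_insert_of_not_spans hs
      exact ⟨by omega, fun h => absurd h hs⟩

theorem eulerDefect_antitone {H K : Finset (Fin D.n)} (h : H ⊆ K) :
    κ.eulerDefect K ≤ κ.eulerDefect H := by
  obtain ⟨M, rfl⟩ : ∃ M, K = H ∪ M := ⟨K, (Finset.union_eq_right.2 h).symm⟩
  clear h
  induction M using Finset.induction_on with
  | empty => simp
  | insert e M _ ih =>
    rw [Finset.union_insert]
    by_cases he : e ∈ H ∪ M
    · rwa [Finset.insert_eq_of_mem he]
    · exact (eulerDefect_insert he).1.trans ih

/-- On the sphere, the two sides of a missing edge are on the same circle as soon as its ends are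
connected. -/
theorem pinched_iff_spans {H : Finset (Fin D.n)} {e : Fin D.n} (he : e ∉ H) :
    κ.Pinched H e ↔ κ.Spans H e := by
  refine ⟨Pinched.spans, fun hs => ?_⟩
  by_contra hp
  -- The defect equals `- faces ∅` at both `∅` and `univ`, the latter by planarity and
  -- connectedness. Being antitone, it cannot drop in between.
  have h1 := (eulerDefect_insert he).2 hs hp
  have h2 := eulerDefect_antitone (κ := κ) (Finset.empty_subset H)
  have h3 := eulerDefect_antitone (κ := κ) (Finset.subset_univ (insert e H))
  have h4 := faces_empty_add_faces_univ (κ := κ)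
  have h5 := comps_empty (κ := κ)
  have h6 := comps_univ (κ := κ) (e, 0)
  unfold eulerDefect at *
  simp only [Finset.card_empty, Finset.card_univ, Fintype.card_fin] at *
  omega

theorem pinched_iff_of_mem {H : Finset (Fin D.n)} {e : Fin D.n} (he : e ∈ H) :
    κ.Pinched H e ↔ ¬ κ.Spans (H.erase e) e := by
  have h := pinched_toggle (κ := κ) H e
  rw [symmDiff_singleton_of_mem he, pinched_iff_spans (Finset.notMem_erase e H)] at h
  tauto

/-- the circle of a spanning tree -/
theorem sameFace_of_isSpanningTree {T : Finset (Fin D.n)} (hT : κ.IsSpanningTree T)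
    (a b : D.HalfEdge) : κ.SameFace T a b := by
  -- Build the tree edge by edge: no new edge closes a cycle, so each insertion merges two circles,
  -- and circles stay in bijection with components.
  have key : ∀ H ⊆ T, ∀ a b, κ.Joined H (κ.vtx a) (κ.vtx b) → κ.SameFace H a b := by
    intro H
    induction H using Finset.induction_on with
    | empty =>
      intro _ a b h
      refine (sameFace_empty_iff a b).2 ?_
      exact Joined.induct (r := fun x y => x = y) ⟨fun _ => rfl, Eq.symm, Eq.trans⟩
        (fun e he => absurd he (Finset.notMem_empty e)) h
    | insert e H he ih =>
      intro hs a b h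
      have hH : H ⊆ T := (Finset.subset_insert e H).trans hs
      have heT : e ∈ T := hs (Finset.mem_insert_self e H)
      have hp : ¬ κ.Pinched H e := by
        rw [pinched_iff_spans he]
        intro h'
        refine hT.2 e ((onCycle_iff T e).2 ⟨heT, h'.mono fun x hx => ?_⟩)
        exact Finset.mem_erase.2 ⟨fun hxe => he (hxe ▸ hx), hH hx⟩
      rw [← symmDiff_singleton_of_notMem he, sameFace_toggle hp]
      rcases (joined_insert_iff H e _ _).1 h with h | ⟨h1, h2⟩ | ⟨h1, h2⟩
      · exact Or.inl (ih hH _ _ h)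
      · exact Or.inr (Or.inl ⟨ih hH _ _ h1, ih hH _ _ h2⟩)
      · exact Or.inr (Or.inr ⟨ih hH _ _ h1, ih hH _ _ h2⟩)
  exact key T subset_rfl a b (hT.1 _ _)

end
end Checkerboard
end KnotDiagram


namespace KnotDiagram
namespace Checkerboard
noncomputable section
open scoped Classical

variable {D : KnotDiagram} {κ : D.Checkerboard}

/-! ### Spanning trees and activities -/

theorem isSpanningTree_iff (T : Finset (Fin D.n)) :
    κ.IsSpanningTree T ↔ (∀ e, κ.Spans T e) ∧ ∀ e ∈ T, ¬ κ.Spans (T.erase e) e := by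
  unfold IsSpanningTree
  rw [connectedSub_iff]
  simp only [onCycle_iff, not_and]

/-- Together with `mem_cyc_iff` this expresses cuts and cycles by one relation between `e ∈ T` and
`f ∉ T`: `T.erase e` does not span `f`. The symmetry makes the activities of tree and non-tree edges
comparable. -/
theorem mem_cut_iff {T : Finset (Fin D.n)} (hT : κ.IsSpanningTree T) {e : Fin D.n} (he : e ∈ T)
    (f : Fin D.n) : f ∈ κ.cut T e ↔ ¬ κ.Spans (T.erase e) f := by
  obtain ⟨h1, h2⟩ := (isSpanningTree_iff T).1 hT
  change κ.ConnectedSub _ ↔ _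
  rw [connectedSub_iff]
  constructor
  · intro h hf
    refine h2 e he ((h e).of_forall fun g hg => ?_)
    rcases Finset.mem_insert.1 hg with rfl | hg
    exacts [hf, spans_of_mem hg]
  · intro h g
    have hx : κ.Spans (insert f (T.erase e)) e :=
      Spans.exchange (by rw [Finset.insert_erase he]; exact h1 f) h
    refine (h1 g).of_forall fun x hxT => ?_
    by_cases hxe : x = e
    · rw [hxe]; exact hx
    · exact spans_of_mem (Finset.mem_insert_of_mem (Finset.mem_erase.2 ⟨hxe, hxT⟩))

theorem mem_cyc_iff {T : Finset (Fin D.n)} (hT : κ.IsSpanningTree T) {f : Fin D.n} (hf : f ∉ T)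
    (e : Fin D.n) : e ∈ κ.cyc T f ↔ e = f ∨ (e ∈ T ∧ ¬ κ.Spans (T.erase e) f) := by
  obtain ⟨h1, h2⟩ := (isSpanningTree_iff T).1 hT
  change κ.OnCycle _ _ ↔ _
  rw [onCycle_iff]
  by_cases hef : e = f
  · subst hef
    simp only [Finset.mem_insert_self, Finset.erase_insert hf, h1, and_self, true_or]
  · simp only [Finset.mem_insert, hef, false_or]
    refine and_congr_right fun he => ?_
    rw [Finset.erase_insert_of_ne (Ne.symm hef)]
    constructor
    · intro h hs
      refine h2 e he (h.of_forall fun g hg => ?_)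
      rcases Finset.mem_insert.1 hg with rfl | hg
      exacts [hs, spans_of_mem hg]
    · intro h
      exact Spans.exchange (by rw [Finset.insert_erase he]; exact h1 f) h

theorem live_iff_of_mem {T : Finset (Fin D.n)} (hT : κ.IsSpanningTree T)
    {ord : Fin D.n ≃ Fin D.n} {e : Fin D.n} (he : e ∈ T) :
    κ.Live ord T e ↔ ∀ f, f ∉ T → ¬ κ.Spans (T.erase e) f → ord e < ord f := by
  unfold Live
  simp only [he, forall_const, not_true_eq_false, IsEmpty.forall_iff, and_true]
  constructor
  · intro h f hf hs
    refine lt_of_le_of_ne (h f ((mem_cut_iff hT he f).2 hs)) fun hh => ?_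
    exact hf (ord.injective hh ▸ he)
  · intro h f hf
    rw [mem_cut_iff hT he] at hf
    by_cases hfT : f ∈ T
    · by_cases hfe : f = e
      · rw [hfe]
      · exact absurd (spans_of_mem (Finset.mem_erase.2 ⟨hfe, hfT⟩)) hf
    · exact (h f hfT hf).le

theorem live_iff_of_notMem {T : Finset (Fin D.n)} (hT : κ.IsSpanningTree T)
    {ord : Fin D.n ≃ Fin D.n} {f : Fin D.n} (hf : f ∉ T) :
    κ.Live ord T f ↔ ∀ e ∈ T, ¬ κ.Spans (T.erase e) f → ord f < ord e := by
  unfold Live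
  simp only [hf, not_false_eq_true, forall_const, IsEmpty.forall_iff, true_and]
  constructor
  · intro h e he hs
    refine lt_of_le_of_ne (h e ((mem_cyc_iff hT hf e).2 (Or.inr ⟨he, hs⟩))) fun hh => ?_
    exact hf (ord.injective hh ▸ he)
  · intro h e he
    rcases (mem_cyc_iff hT hf e).1 he with rfl | ⟨h1, h2⟩
    exacts [le_rfl, (h e h1 h2).le]

/-- `H` is the edge set of a state of `U(T)`. -/
def Agrees (κ : D.Checkerboard) (ord : Fin D.n ≃ Fin D.n) (T H : Finset (Fin D.n)) : Prop :=
  ∀ e, ¬ κ.Live ord T e → (e ∈ H ↔ e ∈ T)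

theorem inUnknot_iff_agrees {ord : Fin D.n ≃ Fin D.n} {T : Finset (Fin D.n)} {S : κ.Enhanced} :
    κ.InUnknot ord T S ↔ κ.Agrees ord T S.H := by
  refine forall_congr' fun e => imp_congr_right fun he => ?_
  simp [critEdges, he]

/-! ### The spanning tree of a state -/

/-- The order of the greedy algorithm for the state of `H`: first the edges of `H`, in decreasing
order, and then the other edges, in increasing order. -/
def Before (ord : Fin D.n ≃ Fin D.n) (H : Finset (Fin D.n)) (g e : Fin D.n) : Prop :=
  if e ∈ H then g ∈ H ∧ ord e < ord g else g ∈ H ∨ ord g < ord e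

/-- the edges before `e` in the order of the greedy algorithm -/
def pre (ord : Fin D.n ≃ Fin D.n) (H : Finset (Fin D.n)) (e : Fin D.n) : Finset (Fin D.n) :=
  Finset.univ.filter fun g => Before ord H g e

/-- the spanning tree `T` for which the state of `H` belongs to `U(T)` -/
def tree (κ : D.Checkerboard) (ord : Fin D.n ≃ Fin D.n) (H : Finset (Fin D.n)) :
    Finset (Fin D.n) :=
  Finset.univ.filter fun e => ¬ κ.Spans (pre ord H e) e

section Greedy

variable {ord : Fin D.n ≃ Fin D.n} {H : Finset (Fin D.n)}

theorem mem_pre {g e : Fin D.n} : g ∈ pre ord H e ↔ Before ord H g e := by simp [pre]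

theorem mem_tree {e : Fin D.n} : e ∈ κ.tree ord H ↔ ¬ κ.Spans (pre ord H e) e := by simp [tree]

theorem before_irrefl (e : Fin D.n) : ¬ Before ord H e e := by
  unfold Before; split_ifs with h <;> simp [h]

theorem before_trans {a b c : Fin D.n} (h : Before ord H a b) (h' : Before ord H b c) :
    Before ord H a c := by
  unfold Before at *
  by_cases hb : b ∈ H <;> by_cases hc : c ∈ H <;> simp only [hb, hc, if_true, if_false] at *
  · exact ⟨h.1, h'.2.trans h.2⟩
  · exact Or.inl h.1
  · exact absurd h'.1 (by simp)
  · rcases h with h | h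
    · exact Or.inl h
    · exact Or.inr (h.trans (by simpa using h'))

theorem before_or_before {a b : Fin D.n} (h : a ≠ b) : Before ord H a b ∨ Before ord H b a := by
  have h' : ord a ≠ ord b := fun hh => h (ord.injective hh)
  unfold Before
  by_cases ha : a ∈ H <;> by_cases hb : b ∈ H <;> simp only [ha, hb, if_true, if_false]
  · rcases lt_or_gt_of_ne h' with h | h
    exacts [Or.inr ⟨trivial, h⟩, Or.inl ⟨trivial, h⟩]
  · simp
  · simp
  · rcases lt_or_gt_of_ne h' with h | h
    exacts [Or.inl (Or.inr h), Or.inr (Or.inr h)]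

theorem card_pre_lt {a b : Fin D.n} (h : Before ord H a b) :
    (pre ord H a).card < (pre ord H b).card := by
  refine Finset.card_lt_card ⟨fun x hx => ?_, fun hs => ?_⟩
  · exact mem_pre.2 (before_trans (mem_pre.1 hx) h)
  · exact before_irrefl a (mem_pre.1 (hs (mem_pre.2 h)))

/-- Strong induction along the greedy order: an edge is rejected only if earlier edges span it, and
each of these is accepted or already spanned by accepted ones. -/
theorem tree_spans (e : Fin D.n) (he : e ∉ κ.tree ord H) :
    κ.Spans ((κ.tree ord H).filter fun g => Before ord H g e) e := by
  induction hn : (pre ord H e).card using Nat.strong_induction_on generalizing e with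
  | _ n ih =>
    have h : κ.Spans (pre ord H e) e := by rwa [mem_tree, not_not] at he
    refine h.of_forall fun g hg => ?_
    have hg' := mem_pre.1 hg
    by_cases hgT : g ∈ κ.tree ord H
    · exact spans_of_mem (Finset.mem_filter.2 ⟨hgT, hg'⟩)
    · refine (ih _ (hn ▸ card_pre_lt hg') g hgT rfl).mono fun x hx => ?_
      rw [Finset.mem_filter] at hx ⊢
      exact ⟨hx.1, before_trans hx.2 hg'⟩

/-- A minimal such `M` plays the role of a path between the ends of `e`, without paths having to be
defined. -/
theorem exists_minimal_spanning {K : Finset (Fin D.n)} {e : Fin D.n} (h : κ.Spans K e) :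
    ∃ M ⊆ K, κ.Spans M e ∧ ∀ g ∈ M, ¬ κ.Spans (M.erase g) e := by
  induction K using Finset.strongInduction with
  | H K ih =>
    by_cases hK : ∃ g ∈ K, κ.Spans (K.erase g) e
    · obtain ⟨g, hg, hs⟩ := hK
      obtain ⟨M, hM, h1⟩ := ih _ (Finset.erase_ssubset hg) hs
      exact ⟨M, hM.trans (Finset.erase_subset _ _), h1⟩
    · push Not at hK
      exact ⟨K, subset_rfl, h, hK⟩

/-- Every edge of the path of `e` in a tree has `e` in its fundamental cut. -/
theorem not_spans_erase_of_minimal {T M : Finset (Fin D.n)} (hT : κ.IsSpanningTree T)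
    (hMT : M ⊆ T) {e g : Fin D.n} (hM : κ.Spans M e) (hg : g ∈ M) (hmin : ¬ κ.Spans (M.erase g) e) :
    ¬ κ.Spans (T.erase g) e := by
  intro hs
  have hx : κ.Spans (insert e (M.erase g)) g :=
    Spans.exchange (by rw [Finset.insert_erase hg]; exact hM) hmin
  refine ((isSpanningTree_iff T).1 hT).2 g (hMT hg) (hx.of_forall fun x hx => ?_)
  rcases Finset.mem_insert.1 hx with rfl | hx
  · exact hs
  · exact spans_of_mem (Finset.erase_subset_erase g hMT hx)

/-- On a cycle of accepted edges, the last one in the greedy order would have been rejected, since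
the others precede and span it. -/
theorem tree_independent (e : Fin D.n) (he : e ∈ κ.tree ord H) :
    ¬ κ.Spans ((κ.tree ord H).erase e) e := by
  intro hs
  obtain ⟨M, hM, hMe, hmin⟩ := exists_minimal_spanning hs
  have heM : e ∉ M := fun h => (Finset.mem_erase.1 (hM h)).1 rfl
  obtain ⟨m, hm, hmax⟩ := Finset.exists_max_image (insert e M) (fun x => (pre ord H x).card)
    ⟨e, Finset.mem_insert_self e M⟩
  have hlast : ∀ x ∈ insert e M, x ≠ m → Before ord H x m := by
    intro x hx hxm
    rcases before_or_before (ord := ord) (H := H) hxm with h | h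
    · exact h
    · exact absurd (hmax x hx) (not_le.2 (card_pre_lt h))
  have hmT : m ∈ κ.tree ord H := by
    rcases Finset.mem_insert.1 hm with rfl | hm
    exacts [he, Finset.mem_of_mem_erase (hM hm)]
  refine mem_tree.1 hmT ?_
  by_cases hme : m = e
  · subst hme
    exact hMe.mono fun x hx => mem_pre.2 (hlast x (Finset.mem_insert_of_mem hx)
      fun h => heM (h ▸ hx))
  · have hmM : m ∈ M := (Finset.mem_insert.1 hm).resolve_left hme
    have : κ.Spans (insert e (M.erase m)) m :=
      Spans.exchange (by rw [Finset.insert_erase hmM]; exact hMe) (hmin m hmM)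
    refine this.mono fun x hx => mem_pre.2 ?_
    rcases Finset.mem_insert.1 hx with rfl | hx
    · exact hlast _ (Finset.mem_insert_self _ _) (Ne.symm hme)
    · exact hlast x (Finset.mem_insert_of_mem (Finset.mem_of_mem_erase hx))
        (Finset.mem_erase.1 hx).1

variable (κ ord H) in
theorem isSpanningTree_tree : κ.IsSpanningTree (κ.tree ord H) := by
  refine (isSpanningTree_iff _).2 ⟨fun e => ?_, tree_independent⟩
  by_cases he : e ∈ κ.tree ord H
  · exact spans_of_mem he
  · exact (tree_spans e he).mono (Finset.filter_subset _ _)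

theorem before_of_not_spans {e f : Fin D.n} (hf : f ∉ κ.tree ord H)
    (hs : ¬ κ.Spans ((κ.tree ord H).erase e) f) : Before ord H e f := by
  by_contra h
  refine hs ((tree_spans f hf).mono fun x hx => ?_)
  rw [Finset.mem_filter] at hx
  exact Finset.mem_erase.2 ⟨fun hxe => h (hxe ▸ hx.2), hx.1⟩

-- All tree edges in the fundamental cycle of a rejected `f` precede `f`. A tree edge outside `H` is
-- then smaller than every `f` in its cut, and a rejected edge of `H` is smaller than every tree
-- edge of its cycle. So an edge on which `H` and the tree disagree is live.
variable (κ ord H) in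
theorem agrees_tree : κ.Agrees ord (κ.tree ord H) H := by
  have hT := isSpanningTree_tree κ ord H
  intro e hd
  by_contra hne
  by_cases heT : e ∈ κ.tree ord H
  · have heH : e ∉ H := fun h => hne (by simp [h, heT])
    refine hd ((live_iff_of_mem hT heT).2 fun f hf hs => ?_)
    have hb := before_of_not_spans hf hs
    unfold Before at hb
    split_ifs at hb with hfH
    · exact absurd hb.1 heH
    · exact hb.resolve_left heH
  · have heH : e ∈ H := by by_contra h; exact hne (by simp [h, heT])
    refine hd ((live_iff_of_notMem hT heT).2 fun f _ hs => ?_)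
    have hb := before_of_not_spans heT hs
    unfold Before at hb
    rw [if_pos heH] at hb
    exact hb.2

/-- Every state belongs to exactly one twisted unknot. -/
theorem eq_tree {T : Finset (Fin D.n)} (hT : κ.IsSpanningTree T) (hA : κ.Agrees ord T H) :
    T = κ.tree ord H := by
  obtain ⟨h1, h2⟩ := (isSpanningTree_iff T).1 hT
  -- If the edges before `e ∈ T` span `e`, one of them, `f`, is outside `T` and in the cut of `e`.
  -- Liveness of whichever of the two disagrees with `H` contradicts that `f` comes first.
  have hsub : T ⊆ κ.tree ord H := by
    intro e he
    rw [mem_tree]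
    intro hs
    refine h2 e he (hs.of_forall fun f hf => ?_)
    by_contra hn
    have hb := mem_pre.1 hf
    have hfe : f ≠ e := fun h => before_irrefl e (h ▸ hb)
    have hfT : f ∉ T := fun h => hn (spans_of_mem (Finset.mem_erase.2 ⟨hfe, h⟩))
    have hfH : f ∈ H → ord f < ord e := fun h => by
      have hl : κ.Live ord T f := by
        by_contra hl
        exact hfT ((hA f hl).1 h)
      exact (live_iff_of_notMem hT hfT).1 hl e he hn
    unfold Before at hb
    split_ifs at hb with heH
    · exact lt_asymm hb.2 (hfH hb.1)
    · have hl : κ.Live ord T e := by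
        by_contra hl
        exact heH ((hA e hl).2 he)
      have hef := (live_iff_of_mem hT he).1 hl f hfT hn
      rcases hb with hb | hb
      · exact lt_asymm hef (hfH hb)
      · exact lt_asymm hef hb
  refine hsub.antisymm fun e he => ?_
  by_contra heT
  exact tree_independent e he ((h1 e).mono fun x hx =>
    Finset.mem_erase.2 ⟨fun h : x = e => heT (h ▸ hx), hsub hx⟩)

/-! ### The spanning tree along the differential -/

theorem Agrees.toggle {T : Finset (Fin D.n)} (hA : κ.Agrees ord T H) {e : Fin D.n}
    (he : κ.Live ord T e) : κ.Agrees ord T (symmDiff H {e}) := by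
  intro f hf
  have hfe : f ≠ e := fun h => hf (h ▸ he)
  rw [← hA f hf]
  simp [Finset.mem_symmDiff, hfe]

theorem live_of_mem_iff {T : Finset (Fin D.n)} (hA : κ.Agrees ord T H) {e : Fin D.n}
    (h : ¬ (e ∈ H ↔ e ∈ T)) : κ.Live ord T e := by
  by_contra hl
  exact h (hA e hl)

/-- The change of the spanning tree when an edge of the state is removed. -/
theorem tree_erase {e : Fin D.n} (he : e ∈ H) :
    κ.tree ord (H.erase e) = κ.tree ord H ∨
      (e ∈ κ.tree ord H ∧ e ∉ κ.tree ord (H.erase e) ∧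
        ∀ g, ord e < ord g → (g ∈ κ.tree ord H ↔ g ∈ κ.tree ord (H.erase e))) := by
  have hA := agrees_tree κ ord H
  have hA' := agrees_tree κ ord (H.erase e)
  have hT := isSpanningTree_tree κ ord H
  have hT' := isSpanningTree_tree κ ord (H.erase e)
  have hsd : symmDiff H {e} = H.erase e := symmDiff_singleton_of_mem he
  have hsd' : symmDiff (H.erase e) {e} = H := by
    rw [← hsd, symmDiff_symmDiff_cancel_right]
  by_cases h1 : e ∈ κ.tree ord H
  · by_cases h2 : e ∈ κ.tree ord (H.erase e)
    · left
      -- Here `e` is in the tree of `H.erase e` but not in that state, hence live, so toggling it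
      -- stays inside the same twisted unknot.
      have hl := live_of_mem_iff hA' (e := e) (by simp [h2])
      have := hA'.toggle hl
      rw [hsd'] at this
      exact eq_tree hT' this
    · refine Or.inr ⟨h1, h2, fun g hg => ?_⟩
      have hge : g ≠ e := fun h => lt_irrefl _ (h ▸ hg)
      -- For `g` larger than `e`, removing `e` from `H` does not affect whether `e` precedes `g`: it
      -- never does if `g ∈ H`, and it always does if `g ∉ H`.
      have : pre ord H g = pre ord (H.erase e) g := by
        ext x
        rw [mem_pre, mem_pre]
        unfold Before
        simp only [Finset.mem_erase, ne_eq, hge, not_false_eq_true, true_and]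
        by_cases hxe : x = e
        · subst hxe
          by_cases hgH : g ∈ H
          · simp [hgH, hg.le]
          · simp [hgH, he, hg]
        · simp [hxe]
      rw [mem_tree, mem_tree, this]
  · left
    have hl := live_of_mem_iff hA (e := e) (by simp [h1, he])
    have := hA.toggle hl
    rw [hsd] at this
    exact (eq_tree hT this).symm

/-- the position of the spanning tree of a state in a linear order that decreases along the
differential -/
def treePotential (κ : D.Checkerboard) (ord : Fin D.n ≃ Fin D.n) (H : Finset (Fin D.n)) :
    Colex (Finset (Fin D.n)) :=
  toColex ((κ.aEdges (κ.tree ord H)).map ord.toEmbedding)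

theorem mem_aEdges {e : Fin D.n} : e ∈ κ.aEdges H ↔ (κ.PosEdge e ↔ e ∈ H) := by simp [aEdges]

/-- In colexicographic order the largest position of disagreement decides. Above `e` the trees
agree, and at `e` an `A`-marker is lost. -/
theorem treePotential_lt {H' : Finset (Fin D.n)} {e : Fin D.n}
    (h1 : e ∈ κ.aEdges (κ.tree ord H)) (h2 : e ∉ κ.aEdges (κ.tree ord H'))
    (h3 : ∀ g, ord e < ord g → (g ∈ κ.tree ord H ↔ g ∈ κ.tree ord H')) :
    κ.treePotential ord H' < κ.treePotential ord H := by
  unfold treePotential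
  rw [Finset.Colex.toColex_lt_toColex_iff_exists_forall_lt]
  refine ⟨ord e, Finset.mem_map_of_mem _ h1, fun h => h2 ?_, ?_⟩
  · obtain ⟨x, hx, hxe⟩ := Finset.mem_map.1 h
    exact ord.injective hxe ▸ hx
  · intro b hb hb'
    obtain ⟨g, hg, rfl⟩ := Finset.mem_map.1 hb
    have hg' : g ∉ κ.aEdges (κ.tree ord H) := fun h => hb' (Finset.mem_map_of_mem _ h)
    change ord g < ord e
    by_contra hge
    rcases lt_or_eq_of_le (not_lt.1 hge) with hlt | heq
    · rw [mem_aEdges] at hg hg'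
      rw [h3 g hlt] at hg'
      exact hg' hg
    · exact hg' (ord.injective heq ▸ h1)

/-- The differential removes a positive edge or inserts a negative one. If this changes the tree,
the toggled edge leaves respectively enters the tree, which costs an `A`-marker in either case. -/
theorem tree_toggle {e : Fin D.n} (he : e ∈ κ.aEdges H) :
    κ.tree ord (symmDiff H {e}) = κ.tree ord H ∨
      κ.treePotential ord (symmDiff H {e}) < κ.treePotential ord H := by
  rw [mem_aEdges] at he
  by_cases heH : e ∈ H
  · rw [symmDiff_singleton_of_mem heH]
    have hp : κ.PosEdge e := he.2 heH
    rcases tree_erase (κ := κ) (ord := ord) heH with h | ⟨h1, h2, h3⟩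
    · exact Or.inl h
    · refine Or.inr (treePotential_lt (e := e) ?_ ?_ h3) <;> rw [mem_aEdges] <;> simp [hp, h1, h2]
  · rw [symmDiff_singleton_of_notMem heH]
    have hp : ¬ κ.PosEdge e := fun h => heH (he.1 h)
    have := tree_erase (κ := κ) (ord := ord) (Finset.mem_insert_self e H)
    rw [Finset.erase_insert heH] at this
    rcases this with h | ⟨h1, h2, h3⟩
    · exact Or.inl h.symm
    · refine Or.inr (treePotential_lt (e := e) ?_ ?_ fun g hg => (h3 g hg).symm) <;>
        rw [mem_aEdges] <;> simp [hp, h1, h2]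

end Greedy

end
end Checkerboard
end KnotDiagram


namespace KnotDiagram
namespace Checkerboard
noncomputable section
open scoped Classical

variable {D : KnotDiagram} {κ : D.Checkerboard}

/-! ### The tree of circles of a twisted unknot -/

/-- the live edges of `T` -/
abbrev liveEdges (κ : D.Checkerboard) (ord : Fin D.n ≃ Fin D.n) (T : Finset (Fin D.n)) :
    Finset (Fin D.n) := Finset.univ.filter fun e => κ.Live ord T e

/-- `a` and `b` lie on the same circle of the state of `U(T)` in which the live edges in `K` are
present -/
def Conn (κ : D.Checkerboard) (ord : Fin D.n ≃ Fin D.n) (T K : Finset (Fin D.n))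
    (a b : D.HalfEdge) : Prop := κ.SameFace (symmDiff (κ.critEdges ord T) K) a b

section UnknotTree

variable {ord : Fin D.n ≃ Fin D.n} {T : Finset (Fin D.n)}

theorem mem_critEdges {e : Fin D.n} : e ∈ κ.critEdges ord T ↔
    (e ∈ T ∧ ¬ κ.Live ord T e) ∨ (e ∉ T ∧ κ.Live ord T e) := by simp [critEdges]

theorem symmDiff_critEdges_liveEdges :
    symmDiff (κ.critEdges ord T) (κ.liveEdges ord T) = T := by
  ext e
  simp only [Finset.mem_symmDiff, mem_critEdges, Finset.mem_filter, Finset.mem_univ, true_and]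
  tauto

theorem mem_symmDiff_critEdges {K : Finset (Fin D.n)} (hK : K ⊆ κ.liveEdges ord T)
    {e : Fin D.n} (he : ¬ κ.Live ord T e) : e ∈ symmDiff (κ.critEdges ord T) K ↔ e ∈ T := by
  have : e ∉ K := fun h => he (Finset.mem_filter.1 (hK h)).2
  simp [Finset.mem_symmDiff, mem_critEdges, he, this]

/-- Making an absent live edge present always merges two circles, so `G(T)` has no cycles. The
reason is that a live tree edge and a live non-tree edge in its cut cannot coexist: each would be
smaller than the other. -/
theorem not_pinched_critEdges (hT : κ.IsSpanningTree T) {K : Finset (Fin D.n)}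
    (hK : K ⊆ κ.liveEdges ord T) {e : Fin D.n} (he : κ.Live ord T e) (heK : e ∉ K) :
    ¬ κ.Pinched (symmDiff (κ.critEdges ord T) K) e := by
  obtain ⟨h1, h2⟩ := (isSpanningTree_iff T).1 hT
  by_cases heT : e ∈ T
  · have heC : e ∉ symmDiff (κ.critEdges ord T) K := by
      simp [Finset.mem_symmDiff, mem_critEdges, he, heK, heT]
    rw [pinched_iff_spans heC]
    intro hs
    refine h2 e heT (hs.of_forall fun x hx => ?_)
    have hxe : x ≠ e := fun h => heC (h ▸ hx)
    by_cases hxT : x ∈ T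
    · exact spans_of_mem (Finset.mem_erase.2 ⟨hxe, hxT⟩)
    · by_contra hn
      have hxl : κ.Live ord T x := by
        by_contra hxl
        exact hxT ((mem_symmDiff_critEdges hK hxl).1 hx)
      exact lt_asymm ((live_iff_of_mem hT heT).1 he x hxT hn)
        ((live_iff_of_notMem hT hxT).1 hxl e heT hn)
  · have heC : e ∈ symmDiff (κ.critEdges ord T) K := by
      simp [Finset.mem_symmDiff, mem_critEdges, he, heK, heT]
    rw [pinched_iff_of_mem heC, not_not]
    -- The tree path of the live edge `e` consists of dead edges, all of which are kept in the
    -- state.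
    obtain ⟨M, hMT, hM, hmin⟩ := exists_minimal_spanning (h1 e)
    refine hM.mono fun g hg => Finset.mem_erase.2 ⟨fun h : g = e => heT (h ▸ hMT hg), ?_⟩
    have hgT := hMT hg
    have hrel := not_spans_erase_of_minimal hT hMT hM hg (hmin g hg)
    have hgl : ¬ κ.Live ord T g := fun hgl =>
      lt_asymm ((live_iff_of_mem hT hgT).1 hgl e heT hrel)
        ((live_iff_of_notMem hT heT).1 he g hgT hrel)
    exact (mem_symmDiff_critEdges hK hgl).2 hgT

theorem Conn.refl (K : Finset (Fin D.n)) (a : D.HalfEdge) : κ.Conn ord T K a a := SameFace.refl _ a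

theorem Conn.symm {K : Finset (Fin D.n)} {a b : D.HalfEdge} (h : κ.Conn ord T K a b) :
    κ.Conn ord T K b a := SameFace.symm h

theorem Conn.trans {K : Finset (Fin D.n)} {a b c : D.HalfEdge} (h : κ.Conn ord T K a b)
    (h' : κ.Conn ord T K b c) : κ.Conn ord T K a c := SameFace.trans h h'

theorem conn_empty {a b : D.HalfEdge} : κ.Conn ord T ∅ a b ↔ κ.SameVertex ord T a b := by
  unfold Conn SameVertex
  rw [← Finset.bot_eq_empty, symmDiff_bot]

theorem SameVertex.symm {a b : D.HalfEdge} (h : κ.SameVertex ord T a b) :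
    κ.SameVertex ord T b a := SameFace.symm h

theorem SameVertex.trans {a b c : D.HalfEdge} (h : κ.SameVertex ord T a b)
    (h' : κ.SameVertex ord T b c) : κ.SameVertex ord T a c := SameFace.trans h h'

theorem SameVertex.refl (a : D.HalfEdge) : κ.SameVertex ord T a a := SameFace.refl _ a

theorem symmDiff_insert_eq {A K : Finset (Fin D.n)} {e : Fin D.n} (he : e ∉ K) :
    symmDiff A (insert e K) = symmDiff (symmDiff A K) {e} := by
  rw [symmDiff_assoc, symmDiff_singleton_of_notMem he]

theorem conn_insert (hT : κ.IsSpanningTree T)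
    {K : Finset (Fin D.n)} (hK : K ⊆ κ.liveEdges ord T) {e : Fin D.n}
    (he : κ.Live ord T e) (heK : e ∉ K) (a b : D.HalfEdge) :
    κ.Conn ord T (insert e K) a b ↔ κ.Conn ord T K a b ∨
      (κ.Conn ord T K a (e, 0) ∧ κ.Conn ord T K b (e, 2)) ∨
      (κ.Conn ord T K a (e, 2) ∧ κ.Conn ord T K b (e, 0)) := by
  unfold Conn
  rw [symmDiff_insert_eq heK]
  exact sameFace_toggle (not_pinched_critEdges hT hK he heK) a b

theorem Conn.mono (hT : κ.IsSpanningTree T)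
    {K K' : Finset (Fin D.n)} (hK' : K' ⊆ κ.liveEdges ord T) (h : K ⊆ K')
    {a b : D.HalfEdge} (hab : κ.Conn ord T K a b) : κ.Conn ord T K' a b := by
  obtain ⟨M, rfl⟩ : ∃ M, K' = K ∪ M := ⟨K', (Finset.union_eq_right.2 h).symm⟩
  clear h
  induction M using Finset.induction_on with
  | empty => simpa using hab
  | insert e M _ ih =>
    rw [Finset.union_insert] at hK' ⊢
    have hs := (Finset.subset_insert e (K ∪ M)).trans hK'
    by_cases he : e ∈ K ∪ M
    · rw [Finset.insert_eq_of_mem he]; exact ih hs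
    · have hl := (Finset.mem_filter.1 (hK' (Finset.mem_insert_self _ _))).2
      exact (conn_insert hT hs hl he a b).2 (Or.inl (ih hs))

theorem conn_of_sameVertex (hT : κ.IsSpanningTree T)
    {K : Finset (Fin D.n)} (hK : K ⊆ κ.liveEdges ord T)
    {a b : D.HalfEdge} (hab : κ.SameVertex ord T a b) : κ.Conn ord T K a b :=
  Conn.mono hT hK (Finset.empty_subset K) (conn_empty.2 hab)

theorem not_conn_ends (hT : κ.IsSpanningTree T)
    {K : Finset (Fin D.n)} (hK : K ⊆ κ.liveEdges ord T) {e : Fin D.n}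
    (he : κ.Live ord T e) (heK : e ∉ K) : ¬ κ.Conn ord T K (e, 0) (e, 2) :=
  not_pinched_critEdges hT hK he heK

theorem conn_at_present (hT : κ.IsSpanningTree T)
    {K : Finset (Fin D.n)} (hK : K ⊆ κ.liveEdges ord T) {e : Fin D.n}
    (he : e ∈ K) (j k : ZMod 4) : κ.Conn ord T K (e, j) (e, k) := by
  have hl : κ.Live ord T e := (Finset.mem_filter.1 (hK he)).2
  have hp := not_pinched_critEdges hT ((Finset.erase_subset e K).trans hK) hl
    (Finset.notMem_erase e K)
  have hp' := (pinched_toggle _ e).2 hp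
  rw [← symmDiff_insert_eq (Finset.notMem_erase e K), Finset.insert_erase he] at hp'
  have key : ∀ j, κ.Conn ord T K (e, j) (e, 0) := by
    intro j
    rcases at_crossing (κ := κ) (symmDiff (κ.critEdges ord T) K) e j with h | h
    exacts [h, SameFace.trans h (SameFace.symm hp')]
  exact (key j).trans (key k).symm

/-- A vertex that no edge of `K` touches is isolated in `K`. -/
theorem sameVertex_of_isolated (hT : κ.IsSpanningTree T)
    {K : Finset (Fin D.n)} (hK : K ⊆ κ.liveEdges ord T)
    {a b : D.HalfEdge} (h : ∀ f ∈ K, ∀ k, ¬ κ.SameVertex ord T (f, k) a)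
    (hab : κ.Conn ord T K a b) : κ.SameVertex ord T a b := by
  induction K using Finset.induction_on generalizing b with
  | empty => exact conn_empty.1 hab
  | insert e K he ih =>
    have hK' := (Finset.subset_insert e K).trans hK
    have hl := (Finset.mem_filter.1 (hK (Finset.mem_insert_self e K))).2
    have ih' := fun b => ih hK' (fun f hf => h f (Finset.mem_insert_of_mem hf)) (b := b)
    rcases (conn_insert hT hK' hl he a b).1 hab with h1 | ⟨h1, _⟩ | ⟨h1, _⟩
    · exact ih' _ h1
    · exact absurd (ih' _ h1).symm (h e (Finset.mem_insert_self e K) 0)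
    · exact absurd (ih' _ h1).symm (h e (Finset.mem_insert_self e K) 2)

/-- Adding an edge that is not connected to `p` does not change what is connected to `p`. -/
theorem conn_of_conn_insert (hT : κ.IsSpanningTree T) {K : Finset (Fin D.n)} {e : Fin D.n}
    (hK : insert e K ⊆ κ.liveEdges ord T) {b p : D.HalfEdge} (k : ZMod 4)
    (h : ¬ κ.Conn ord T (insert e K) (e, k) p) (hb : κ.Conn ord T (insert e K) b p) :
    κ.Conn ord T K b p := by
  by_cases he : e ∈ K
  · rwa [Finset.insert_eq_of_mem he] at hb
  have hK' := (Finset.subset_insert e K).trans hK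
  have hl := (Finset.mem_filter.1 (hK (Finset.mem_insert_self e K))).2
  have hn : ∀ j, ¬ κ.Conn ord T K p (e, j) := fun j hj =>
    h ((conn_at_present hT hK (Finset.mem_insert_self e K) k j).trans
      (hj.mono hT hK (Finset.subset_insert e K)).symm)
  rcases (conn_insert hT hK' hl he b p).1 hb with h1 | ⟨_, h1⟩ | ⟨_, h1⟩
  exacts [h1, absurd h1 (hn _), absurd h1 (hn _)]

/-- all edges of `R` are connected to the root in `R` -/
def Rooted (κ : D.Checkerboard) (ord : Fin D.n ≃ Fin D.n) (p : D.HalfEdge)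
    (T R : Finset (Fin D.n)) : Prop :=
  R ⊆ κ.liveEdges ord T ∧ ∀ f ∈ R, ∀ k, κ.Conn ord T R (f, k) p

/-- With all live edges present the state is `T` itself, a single circle; so `G(T)` is connected. -/
theorem rooted_liveEdges (hT : κ.IsSpanningTree T) (p : D.HalfEdge) :
    κ.Rooted ord p T (κ.liveEdges ord T) := by
  refine ⟨subset_rfl, fun f _ k => ?_⟩
  unfold Conn
  rw [symmDiff_critEdges_liveEdges]
  exact sameFace_of_isSpanningTree hT _ _

/-- When an edge is removed, each point connected to the root stays connected to it or to one end
of the edge, the other end of which is connected to the root. -/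
theorem conn_erase (hT : κ.IsSpanningTree T) {R : Finset (Fin D.n)}
    (hR : R ⊆ κ.liveEdges ord T) {e : Fin D.n} (he : e ∈ R) {b p : D.HalfEdge}
    (hb : κ.Conn ord T R b p) : κ.Conn ord T (R.erase e) b p ∨
      (κ.Conn ord T (R.erase e) b (e, 0) ∧ κ.Conn ord T (R.erase e) p (e, 2)) ∨
      (κ.Conn ord T (R.erase e) b (e, 2) ∧ κ.Conn ord T (R.erase e) p (e, 0)) := by
  have := conn_insert hT ((Finset.erase_subset e R).trans hR) (Finset.mem_filter.1 (hR he)).2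
    (Finset.notMem_erase e R) b p
  rw [Finset.insert_erase he] at this
  exact this.1 hb

theorem exists_near_end (hT : κ.IsSpanningTree T) {R : Finset (Fin D.n)} {p : D.HalfEdge}
    (hR : κ.Rooted ord p T R) {e : Fin D.n} (he : e ∈ R) :
    (κ.Conn ord T (R.erase e) (e, 0) p ∧ ¬ κ.Conn ord T (R.erase e) (e, 2) p) ∨
    (κ.Conn ord T (R.erase e) (e, 2) p ∧ ¬ κ.Conn ord T (R.erase e) (e, 0) p) := by
  have hn := not_conn_ends hT ((Finset.erase_subset e R).trans hR.1)
    (Finset.mem_filter.1 (hR.1 he)).2 (Finset.notMem_erase e R)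
  rcases conn_erase hT hR.1 he (hR.2 e he 0) with h | ⟨_, h⟩ | ⟨h, _⟩
  · exact Or.inl ⟨h, fun h' => hn (h.trans h'.symm)⟩
  · exact Or.inr ⟨h.symm, fun h' => hn (h'.trans h)⟩
  · exact absurd h hn

/-- Choose an edge with the fewest edges beyond it, as seen from the root. An edge `f` beyond `e`
has strictly fewer edges beyond it, so there are none, and the far end of `e` has degree one. -/
theorem exists_isLeaf (hT : κ.IsSpanningTree T) {R : Finset (Fin D.n)} {p : D.HalfEdge}
    (hR : κ.Rooted ord p T R) (hne : R.Nonempty) : ∃ e a, κ.IsLeaf ord p T R e a := by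
  let beyond : Fin D.n → Finset (Fin D.n) := fun e =>
    R.filter fun f => f ≠ e ∧ ¬ κ.Conn ord T (R.erase e) (f, 0) p
  obtain ⟨e, he, hmin⟩ := Finset.exists_min_image R (fun e => (beyond e).card) hne
  have hsub : ∀ e, R.erase e ⊆ κ.liveEdges ord T := fun e =>
    (Finset.erase_subset e R).trans hR.1
  have hempty : ∀ f, f ∉ beyond e := by
    intro f hf
    obtain ⟨hfR, hfe, hfn⟩ := Finset.mem_filter.1 hf
    have hins : insert f ((R.erase e).erase f) = R.erase e :=
      Finset.insert_erase (Finset.mem_erase.2 ⟨hfe, hfR⟩)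
    have hcom : (R.erase e).erase f ⊆ R.erase f := by
      rw [Finset.erase_right_comm]; exact Finset.erase_subset _ _
    have transfer : ∀ b, κ.Conn ord T (R.erase e) b p → κ.Conn ord T (R.erase f) b p := by
      intro b hb
      refine Conn.mono hT (hsub f) hcom ?_
      rw [← hins] at hfn hb
      exact conn_of_conn_insert hT (by rw [hins]; exact hsub e) 0 hfn hb
    have hlt : (beyond f).card < (beyond e).card := by
      refine Finset.card_lt_card ⟨fun g hg => ?_, fun hs => ?_⟩
      · obtain ⟨hgR, hgf, hgn⟩ := Finset.mem_filter.1 hg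
        refine Finset.mem_filter.2 ⟨hgR, ?_, fun h => hgn (transfer _ h)⟩
        rintro rfl
        have hat := conn_at_present hT (hsub f) (Finset.mem_erase.2 ⟨hgf, hgR⟩)
        rcases exists_near_end hT hR hgR with ⟨h, _⟩ | ⟨h, _⟩
        · exact hgn (transfer _ h)
        · exact hgn ((hat 0 2).trans (transfer _ h))
      · exact (Finset.mem_filter.1 (hs hf)).2.1 rfl
    exact absurd (hmin f hfR) (not_le.2 hlt)
  have main : ∀ k, ¬ κ.Conn ord T (R.erase e) (e, k) p → κ.IsLeaf ord p T R e (e, k) := by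
    intro k hk
    refine ⟨he, rfl, fun h => hk (conn_of_sameVertex hT (hsub e) h), fun f hf j hj => ?_⟩
    by_contra hfe
    refine hempty f (Finset.mem_filter.2 ⟨hf, hfe, fun h => hk ?_⟩)
    exact ((conn_of_sameVertex hT (hsub e) hj).symm.trans
      (conn_at_present hT (hsub e) (Finset.mem_erase.2 ⟨hfe, hf⟩) j 0)).trans h
  rcases exists_near_end hT hR he with ⟨_, h⟩ | ⟨_, h⟩
  exacts [⟨e, _, main 2 h⟩, ⟨e, _, main 0 h⟩]

theorem exists_isLeastLeaf (hT : κ.IsSpanningTree T) {R : Finset (Fin D.n)} {p : D.HalfEdge}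
    (hR : κ.Rooted ord p T R) (hne : R.Nonempty) : ∃ e a, κ.IsLeastLeaf ord p T R e a := by
  obtain ⟨e₀, a₀, h₀⟩ := exists_isLeaf hT hR hne
  obtain ⟨e, he, hmin⟩ := Finset.exists_min_image
    (Finset.univ.filter fun e => ∃ a, κ.IsLeaf ord p T R e a) ord
    ⟨e₀, Finset.mem_filter.2 ⟨Finset.mem_univ _, a₀, h₀⟩⟩
  obtain ⟨a, ha⟩ := (Finset.mem_filter.1 he).2
  exact ⟨e, a, ha, fun e' a' h => hmin e' (Finset.mem_filter.2 ⟨Finset.mem_univ _, a', h⟩)⟩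

/-! ### Leaf edges and their outer vertices -/

section Leaf

variable {R : Finset (Fin D.n)} {p : D.HalfEdge} {e : Fin D.n} {a : D.HalfEdge}

theorem IsLeaf.isolated (h : κ.IsLeaf ord p T R e a) {f : Fin D.n} (hf : f ∈ R.erase e)
    (k : ZMod 4) : ¬ κ.SameVertex ord T (f, k) a :=
  fun hk => (Finset.mem_erase.1 hf).1 (h.2.2.2 f (Finset.mem_of_mem_erase hf) k hk)

theorem IsLeaf.sameVertex_of_conn (h : κ.IsLeaf ord p T R e a) (hT : κ.IsSpanningTree T)
    (hR : R ⊆ κ.liveEdges ord T) {K : Finset (Fin D.n)} (hK : K ⊆ R.erase e) {b : D.HalfEdge}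
    (hb : κ.Conn ord T K a b) : κ.SameVertex ord T a b :=
  sameVertex_of_isolated hT (hK.trans ((Finset.erase_subset e R).trans hR))
    (fun _ hf k => h.isolated (hK hf) k) hb

theorem IsLeaf.not_conn (h : κ.IsLeaf ord p T R e a) (hT : κ.IsSpanningTree T)
    (hR : R ⊆ κ.liveEdges ord T) : ¬ κ.Conn ord T (R.erase e) a p :=
  fun hc => h.2.2.1 (h.sameVertex_of_conn hT hR subset_rfl hc)

/-- Each side of a leaf edge is at its outer vertex or connected to the root. -/
theorem IsLeaf.sides (h : κ.IsLeaf ord p T R e a) (hT : κ.IsSpanningTree T)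
    (hR : κ.Rooted ord p T R) (k : ZMod 4) :
    κ.SameVertex ord T a (e, k) ∨ κ.Conn ord T (R.erase e) (e, k) p := by
  have hs : R.erase e ⊆ κ.liveEdges ord T := (Finset.erase_subset e R).trans hR.1
  have ha : κ.Conn ord T R a p := by
    have := hR.2 e h.1 a.2
    rwa [show ((e, a.2) : D.HalfEdge) = a from Prod.ext h.2.1.symm rfl] at this
  have hk := at_crossing (κ := κ) (κ.critEdges ord T) e k
  rcases conn_erase hT hR.1 h.1 ha with h1 | ⟨h1, h2⟩ | ⟨h1, h2⟩
  · exact absurd h1 (h.not_conn hT hR.1)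
  · have h3 := h.sameVertex_of_conn hT hR.1 subset_rfl h1
    rcases hk with hk | hk
    · exact Or.inl (SameFace.trans h3 (SameFace.symm hk))
    · exact Or.inr ((conn_of_sameVertex hT hs hk).trans h2.symm)
  · have h3 := h.sameVertex_of_conn hT hR.1 subset_rfl h1
    rcases hk with hk | hk
    · exact Or.inr ((conn_of_sameVertex hT hs hk).trans h2.symm)
    · exact Or.inl (SameFace.trans h3 (SameFace.symm hk))

theorem IsLeaf.sameVertex (h : κ.IsLeaf ord p T R e a) (hT : κ.IsSpanningTree T)
    (hR : κ.Rooted ord p T R) {a' : D.HalfEdge} (h' : κ.IsLeaf ord p T R e a') :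
    κ.SameVertex ord T a a' := by
  have ha : ((e, a'.2) : D.HalfEdge) = a' := Prod.ext h'.2.1.symm rfl
  rcases h.sides hT hR a'.2 with h1 | h1 <;> rw [ha] at h1
  exacts [h1, absurd h1 (h'.not_conn hT hR.1)]

/-- A point connected to the root is on the outer vertex of a leaf, or stays connected to the root
when the leaf is removed. -/
theorem IsLeaf.conn_or (h : κ.IsLeaf ord p T R e a) (hT : κ.IsSpanningTree T)
    (hR : κ.Rooted ord p T R) {b : D.HalfEdge} (hb : κ.Conn ord T R b p) :
    κ.SameVertex ord T b a ∨ κ.Conn ord T (R.erase e) b p := by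
  have hs : R.erase e ⊆ κ.liveEdges ord T := (Finset.erase_subset e R).trans hR.1
  have key : ∀ k, κ.Conn ord T (R.erase e) b (e, k) →
      κ.SameVertex ord T b a ∨ κ.Conn ord T (R.erase e) b p := by
    intro k hk
    rcases h.sides hT hR k with h1 | h1
    · exact Or.inl (h.sameVertex_of_conn hT hR.1 subset_rfl
        ((conn_of_sameVertex hT hs h1).trans hk.symm)).symm
    · exact Or.inr (hk.trans h1)
  rcases conn_erase hT hR.1 h.1 hb with h1 | ⟨h1, _⟩ | ⟨h1, _⟩
  exacts [Or.inr h1, key _ h1, key _ h1]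

theorem IsLeaf.rooted (h : κ.IsLeaf ord p T R e a) (hT : κ.IsSpanningTree T)
    (hR : κ.Rooted ord p T R) : κ.Rooted ord p T (R.erase e) := by
  refine ⟨(Finset.erase_subset e R).trans hR.1, fun f hf k => ?_⟩
  rcases h.conn_or hT hR (hR.2 f (Finset.mem_of_mem_erase hf) k) with h1 | h1
  exacts [absurd h1 (h.isolated hf k), h1]

end Leaf

theorem IsLeastLeaf.eq {R : Finset (Fin D.n)} {p : D.HalfEdge} {e e' : Fin D.n}
    {a a' : D.HalfEdge} (h : κ.IsLeastLeaf ord p T R e a) (h' : κ.IsLeastLeaf ord p T R e' a') :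
    e = e' :=
  ord.injective (le_antisymm (h.2 e' a' h'.1) (h'.2 e a h.1))

/-! ### The stages of the recursion -/

/-- The stages of the matching: `R` is the set of edges that are left, and `l` lists the outer
half-edges of the leaves that have been removed. -/
inductive Stage (κ : D.Checkerboard) (ord : Fin D.n ≃ Fin D.n) (p : D.HalfEdge)
    (T : Finset (Fin D.n)) : Finset (Fin D.n) → List D.HalfEdge → Prop
  | start : Stage κ ord p T (κ.liveEdges ord T) []
  | next (R : Finset (Fin D.n)) (l : List D.HalfEdge) (e : Fin D.n) (a : D.HalfEdge) :
      Stage κ ord p T R l → κ.IsLeastLeaf ord p T R e a → Stage κ ord p T (R.erase e) (a :: l)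

section StageFacts

variable {R : Finset (Fin D.n)} {l : List D.HalfEdge} {p : D.HalfEdge}

theorem Stage.rooted (h : κ.Stage ord p T R l) (hT : κ.IsSpanningTree T) :
    κ.Rooted ord p T R := by
  induction h with
  | start => exact rooted_liveEdges hT p
  | next R l e a _ hl ih => exact hl.1.rooted hT ih

theorem Stage.cover (h : κ.Stage ord p T R l) (hT : κ.IsSpanningTree T) (b : D.HalfEdge) :
    κ.Conn ord T R b p ∨ ∃ a ∈ l, κ.SameVertex ord T b a := by
  induction h with
  | start =>
    left
    unfold Conn
    rw [symmDiff_critEdges_liveEdges]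
    exact sameFace_of_isSpanningTree hT _ _
  | next R l e a hs hl ih =>
    rcases ih with ih | ⟨a', ha', h⟩
    · rcases hl.1.conn_or hT (hs.rooted hT) ih with h1 | h1
      exacts [Or.inr ⟨a, List.mem_cons_self, h1⟩, Or.inl h1]
    · exact Or.inr ⟨a', List.mem_cons_of_mem _ ha', h⟩

theorem Stage.mem_or (h : κ.Stage ord p T R l) {e : Fin D.n} (he : κ.Live ord T e) :
    e ∈ R ∨ ∃ a ∈ l, a.1 = e := by
  induction h with
  | start => exact Or.inl (Finset.mem_filter.2 ⟨Finset.mem_univ _, he⟩)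
  | next R l e' a _ hl ih =>
    rcases ih with ih | ⟨a', ha', h⟩
    · by_cases hee : e = e'
      · exact Or.inr ⟨a, List.mem_cons_self, by rw [hee]; exact hl.1.2.1⟩
      · exact Or.inl (Finset.mem_erase.2 ⟨hee, ih⟩)
    · exact Or.inr ⟨a', List.mem_cons_of_mem _ ha', h⟩

theorem Stage.untouched (h : κ.Stage ord p T R l) {a : D.HalfEdge} (ha : a ∈ l)
    {f : Fin D.n} (hf : f ∈ R) (k : ZMod 4) : ¬ κ.SameVertex ord T (f, k) a := by
  induction h with
  | start => simp at ha
  | next R l e a' _ hl ih =>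
    rcases List.mem_cons.1 ha with rfl | ha
    · exact hl.1.isolated hf k
    · exact ih ha (Finset.mem_of_mem_erase hf)

end StageFacts

end UnknotTree

end
end Checkerboard
end KnotDiagram


namespace KnotDiagram
namespace Checkerboard
noncomputable section
open scoped Classical

variable {D : KnotDiagram} {κ : D.Checkerboard}

/-! ### The differential -/

section Incidence

variable {ord : Fin D.n ≃ Fin D.n}

theorem symmDiff_singleton_injective {H : Finset (Fin D.n)} {e f : Fin D.n}
    (h : symmDiff H {e} = symmDiff H {f}) : e = f :=
  Finset.singleton_injective (symmDiff_right_injective H h)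

/-- The edge sets of the two states determine the toggled edge, so at most one summand is nonzero.
-/
theorem incidence_eq {S S' : κ.Enhanced} {e : Fin D.n} (he : e ∈ κ.aEdges S.H)
    (h : κ.LeeTerm e S S') : κ.incidence ord S S' =
      (-1 : ℚ) ^ (Finset.univ.filter fun f => ord f < ord e ∧ f ∉ κ.aEdges S.H).card := by
  unfold incidence
  rw [Finset.sum_eq_single e]
  · rw [if_pos h]
  · intro f _ hfe
    exact if_neg fun h' => hfe (symmDiff_singleton_injective (h'.1.symm.trans h.1))
  · exact fun h' => absurd he h'

theorem incidence_ne_zero_iff {S S' : κ.Enhanced} :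
    κ.incidence ord S S' ≠ 0 ↔ ∃ e ∈ κ.aEdges S.H, κ.LeeTerm e S S' := by
  constructor
  · intro h
    obtain ⟨e, he, h'⟩ := Finset.exists_ne_zero_of_sum_ne_zero h
    exact ⟨e, he, by by_contra hn; exact h' (if_neg hn)⟩
  · rintro ⟨e, he, h⟩
    rw [incidence_eq he h]
    exact pow_ne_zero _ (by norm_num)

theorem hdeg_eq (S : κ.Enhanced) : κ.hdeg S =
    ((Finset.univ.filter fun f => f ∉ κ.aEdges S.H).card : ℤ) - D.nMinus := by
  unfold hdeg
  rw [← Nat.cast_add, ← Finset.card_union_of_disjoint]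
  · congr 3
    ext f
    simp only [Finset.mem_union, Finset.mem_filter, Finset.mem_univ, true_and, mem_aEdges]
    tauto
  · rw [Finset.disjoint_left]
    intro f hf hf'
    exact (Finset.mem_filter.1 hf').2.1 (Finset.mem_filter.1 hf).2.1

theorem hdeg_of_toggle {S S' : κ.Enhanced} {e : Fin D.n} (he : e ∈ κ.aEdges S.H)
    (h : S'.H = symmDiff S.H {e}) : κ.hdeg S' = κ.hdeg S + 1 := by
  rw [hdeg_eq, hdeg_eq]
  have : (Finset.univ.filter fun f => f ∉ κ.aEdges S'.H) =
      insert e (Finset.univ.filter fun f => f ∉ κ.aEdges S.H) := by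
    ext f
    simp only [Finset.mem_insert, Finset.mem_filter, Finset.mem_univ, true_and]
    rw [mem_aEdges] at he
    rw [mem_aEdges, mem_aEdges, h]
    by_cases hfe : f = e
    · subst hfe
      simp only [Finset.mem_symmDiff, Finset.mem_singleton]
      tauto
    · simp [Finset.mem_symmDiff, hfe]
  rw [this, Finset.card_insert_of_notMem (by simp [he])]
  push_cast
  ring

theorem hdeg_of_incidence {S S' : κ.Enhanced} (h : κ.incidence ord S S' ≠ 0) :
    κ.hdeg S' = κ.hdeg S + 1 := by
  obtain ⟨e, he, h⟩ := incidence_ne_zero_iff.1 h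
  exact hdeg_of_toggle he h.1

end Incidence

/-! ### The states of a twisted unknot -/

section States

variable {ord : Fin D.n ≃ Fin D.n} {T : Finset (Fin D.n)}

/-- the live edges that are present in the state `S` -/
def presentEdges (κ : D.Checkerboard) (ord : Fin D.n ≃ Fin D.n) (T : Finset (Fin D.n))
    (S : κ.Enhanced) : Finset (Fin D.n) := symmDiff (κ.critEdges ord T) S.H

theorem mem_presentEdges {S : κ.Enhanced} {e : Fin D.n} :
    e ∈ κ.presentEdges ord T S ↔ κ.Present ord T S e := by
  unfold presentEdges Present
  rw [Finset.mem_symmDiff]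
  tauto

theorem inUnknot_iff {S : κ.Enhanced} :
    κ.InUnknot ord T S ↔ κ.presentEdges ord T S ⊆ κ.liveEdges ord T := by
  constructor
  · intro h e he
    rw [mem_presentEdges] at he
    refine Finset.mem_filter.2 ⟨Finset.mem_univ _, ?_⟩
    by_contra hl
    exact he (h e hl)
  · intro h e hl
    by_contra hn
    exact hl (Finset.mem_filter.1 (h (mem_presentEdges.2 hn))).2

theorem sameFace_iff_conn {S : κ.Enhanced} {a b : D.HalfEdge} :
    κ.SameFace S.H a b ↔ κ.Conn ord T (κ.presentEdges ord T S) a b := by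
  unfold Conn presentEdges
  rw [symmDiff_symmDiff_cancel_left]

theorem presentEdges_toggle {S S' : κ.Enhanced} {e : Fin D.n} (h : S'.H = symmDiff S.H {e}) :
    κ.presentEdges ord T S' = symmDiff (κ.presentEdges ord T S) {e} := by
  unfold presentEdges
  rw [h, symmDiff_assoc]

theorem toggle_symm {S S' : κ.Enhanced} {e : Fin D.n} (h : S'.H = symmDiff S.H {e}) :
    S.H = symmDiff S'.H {e} := by
  rw [h, symmDiff_symmDiff_cancel_right]

theorem present_toggle {S S' : κ.Enhanced} {e : Fin D.n} (h : S'.H = symmDiff S.H {e}) :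
    κ.Present ord T S' e ↔ ¬ κ.Present ord T S e := by
  rw [← mem_presentEdges, ← mem_presentEdges, presentEdges_toggle h]
  simp [Finset.mem_symmDiff]

theorem present_toggle_of_ne {S S' : κ.Enhanced} {e f : Fin D.n} (h : S'.H = symmDiff S.H {f})
    (hef : e ≠ f) : κ.Present ord T S' e ↔ κ.Present ord T S e := by
  rw [← mem_presentEdges, ← mem_presentEdges, presentEdges_toggle h]
  simp [Finset.mem_symmDiff, hef]

/-- if `e` is absent from `S'` and `S` is obtained by toggling `e`, then `e` is inserted -/
theorem presentEdges_insert {S S' : κ.Enhanced} {e : Fin D.n} (h : S'.H = symmDiff S.H {e})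
    (hp : κ.Present ord T S e) :
    κ.presentEdges ord T S = insert e (κ.presentEdges ord T S') ∧
      e ∉ κ.presentEdges ord T S' := by
  have hn : e ∉ κ.presentEdges ord T S' := by
    rw [mem_presentEdges, present_toggle h]
    exact not_not.2 hp
  exact ⟨by rw [presentEdges_toggle (toggle_symm h), symmDiff_singleton_of_notMem hn], hn⟩

/-- At a negative twist the differential removes the edge from the subgraph of `G(T)`; at a positive
twist it inserts it. -/
theorem mem_aEdges_iff_present {S : κ.Enhanced} {e : Fin D.n} (he : κ.Live ord T e) :
    e ∈ κ.aEdges S.H ↔ (κ.Present ord T S e ↔ κ.NegTwist T e) := by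
  rw [mem_aEdges]
  unfold Present NegTwist
  rw [mem_critEdges]
  tauto

theorem lab_eq_of_sameVertex (hT : κ.IsSpanningTree T) {S : κ.Enhanced}
    (hS : κ.InUnknot ord T S) {a b : D.HalfEdge} (h : κ.SameVertex ord T a b) :
    S.lab a = S.lab b :=
  S.lab_eq a b (sameFace_iff_conn.2 (conn_of_sameVertex hT (inUnknot_iff.1 hS) h))

theorem eq_nonCritLabel_iff {e : Fin D.n} {c : KhLabel} :
    c = κ.nonCritLabel T e ↔ c ≠ κ.critLabel T e := by
  unfold critLabel nonCritLabel
  split_ifs <;> cases c <;> decide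

/-- The states `S` and `S'` are paired along the edge `e` with outer vertex `a`; the edge is present
in `S`. -/
structure LeafPair (κ : D.Checkerboard) (ord : Fin D.n ≃ Fin D.n) (T : Finset (Fin D.n))
    (e : Fin D.n) (a : D.HalfEdge) (S S' : κ.Enhanced) : Prop where
  present : κ.Present ord T S e
  remove : S'.H = symmDiff S.H {e}
  outer : ∀ b, κ.SameVertex ord T b a → S'.lab b = κ.nonCritLabel T e
  rest : ∀ b, ¬ κ.SameVertex ord T b a → S'.lab b = S.lab b

theorem LeafPair.absent {e : Fin D.n} {a : D.HalfEdge} {S S' : κ.Enhanced}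
    (h : κ.LeafPair ord T e a S S') : ¬ κ.Present ord T S' e := by
  rw [present_toggle h.remove]
  exact not_not.2 h.present

/-! ### Toggling a leaf edge of a state -/

section Leaf

variable {R : Finset (Fin D.n)} {p : D.HalfEdge} {e : Fin D.n} {a : D.HalfEdge}
  {S S' : κ.Enhanced}

theorem IsLeaf.live (h : κ.IsLeaf ord p T R e a) (hR : R ⊆ κ.liveEdges ord T) :
    κ.Live ord T e := (Finset.mem_filter.1 (hR h.1)).2

theorem IsLeaf.eq_mk (h : κ.IsLeaf ord p T R e a) : a = (e, a.2) := Prod.ext h.2.1 rfl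

/-- The outer end of a leaf edge is one of its two strands, and the other strand is elsewhere. -/
theorem IsLeaf.ends (h : κ.IsLeaf ord p T R e a) (hT : κ.IsSpanningTree T)
    (hR : R ⊆ κ.liveEdges ord T) :
    (κ.SameVertex ord T (e, 0) a ∧ ¬ κ.SameVertex ord T (e, 2) a) ∨
    (κ.SameVertex ord T (e, 2) a ∧ ¬ κ.SameVertex ord T (e, 0) a) := by
  have hn := not_conn_ends hT (Finset.empty_subset _) (h.live hR) (Finset.notMem_empty e)
  rw [conn_empty] at hn
  have := at_crossing (κ := κ) (κ.critEdges ord T) e a.2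
  rw [← h.eq_mk] at this
  rcases this with h1 | h1
  · exact Or.inl ⟨SameFace.symm h1, fun h2 => hn (SameFace.trans h1.symm (SameFace.symm h2))⟩
  · exact Or.inr ⟨SameFace.symm h1, fun h2 => hn (SameFace.trans h2 h1)⟩

theorem erase_of_absent (hS : κ.presentEdges ord T S ⊆ R) (he : ¬ κ.Present ord T S e) :
    κ.presentEdges ord T S ⊆ R.erase e := fun _ hx =>
  Finset.mem_erase.2 ⟨fun h => he (mem_presentEdges.1 (h ▸ hx)), hS hx⟩

theorem IsLeaf.sameVertex_of_sameFace (h : κ.IsLeaf ord p T R e a) (hT : κ.IsSpanningTree T)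
    (hR : R ⊆ κ.liveEdges ord T) (hS : κ.presentEdges ord T S ⊆ R)
    (he : ¬ κ.Present ord T S e) {b : D.HalfEdge} (hb : κ.SameFace S.H b a) :
    κ.SameVertex ord T b a :=
  (h.sameVertex_of_conn hT hR (erase_of_absent hS he) (sameFace_iff_conn.1 hb.symm)).symm

theorem sameFace_of_sameVertex (hT : κ.IsSpanningTree T) (hR : R ⊆ κ.liveEdges ord T)
    (hS : κ.presentEdges ord T S ⊆ R) {b c : D.HalfEdge} (hb : κ.SameVertex ord T b c) :
    κ.SameFace S.H b c :=
  sameFace_iff_conn.2 (conn_of_sameVertex hT (hS.trans hR) hb)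

theorem not_pinched_of_absent (hT : κ.IsSpanningTree T) (hR : R ⊆ κ.liveEdges ord T)
    (hS : κ.presentEdges ord T S ⊆ R) (hl : κ.Live ord T e) (he : ¬ κ.Present ord T S e) :
    ¬ κ.Pinched S.H e := fun h =>
  not_conn_ends hT (hS.trans hR) hl (fun h' => he (mem_presentEdges.1 h')) (sameFace_iff_conn.1 h)

theorem sameFace_of_present (hT : κ.IsSpanningTree T) (hR : R ⊆ κ.liveEdges ord T)
    (hS : κ.presentEdges ord T S ⊆ R) (he : κ.Present ord T S e) (j k : ZMod 4) :
    κ.SameFace S.H (e, j) (e, k) :=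
  sameFace_iff_conn.2 (conn_at_present hT (hS.trans hR) (mem_presentEdges.2 he) j k)

/-- A circle at the outer vertex of an absent leaf edge does not touch other remaining edges. -/
theorem IsLeaf.not_sameFace (h : κ.IsLeaf ord p T R e a) (hT : κ.IsSpanningTree T)
    (hR : R ⊆ κ.liveEdges ord T) (hS : κ.presentEdges ord T S ⊆ R)
    (he : ¬ κ.Present ord T S e) {f : Fin D.n} (hf : f ∈ R) (hfe : f ≠ e) (k : ZMod 4) :
    ¬ κ.SameFace S.H a (f, k) := fun hk =>
  h.isolated (Finset.mem_erase.2 ⟨hfe, hf⟩) k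
    (h.sameVertex_of_sameFace hT hR hS he hk.symm)

/-- Removing a present edge splits a circle into two. -/
theorem sameFace_of_remove (hT : κ.IsSpanningTree T) (hR : R ⊆ κ.liveEdges ord T)
    (hS : κ.presentEdges ord T S ⊆ R) (hp : κ.Present ord T S e)
    (hr : S'.H = symmDiff S.H {e}) (b c : D.HalfEdge) :
    κ.SameFace S.H b c ↔ κ.SameFace S'.H b c ∨
      (κ.SameFace S'.H b (e, 0) ∧ κ.SameFace S'.H c (e, 2)) ∨
      (κ.SameFace S'.H b (e, 2) ∧ κ.SameFace S'.H c (e, 0)) := by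
  obtain ⟨h1, h2⟩ := presentEdges_insert hr hp
  have hl := (Finset.mem_filter.1 (hR (hS (mem_presentEdges.2 hp)))).2
  have h3 := sameFace_toggle (not_pinched_of_absent (S := S') hT subset_rfl
    (((Finset.subset_insert _ _).trans h1.symm.subset).trans (hS.trans hR)) hl
    (fun h => h2 (mem_presentEdges.2 h))) b c
  rwa [← toggle_symm hr] at h3

theorem LeafPair.within (h : κ.LeafPair ord T e a S S') (hS : κ.presentEdges ord T S ⊆ R) :
    κ.presentEdges ord T S' ⊆ R :=
  ((Finset.subset_insert _ _).trans (presentEdges_insert h.remove h.present).1.symm.subset).trans hS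

theorem LeafPair.within' (h : κ.LeafPair ord T e a S S') (he : e ∈ R)
    (hS : κ.presentEdges ord T S' ⊆ R) : κ.presentEdges ord T S ⊆ R := by
  rw [(presentEdges_insert h.remove h.present).1]
  exact Finset.insert_subset he hS

/-- The two states of a pair are terms of each other's Lee maps, in the direction that the type of
the twist gives. -/
theorem LeafPair.leeTerm (h : κ.LeafPair ord T e a S S') (hl : κ.IsLeaf ord p T R e a)
    (hT : κ.IsSpanningTree T) (hR : R ⊆ κ.liveEdges ord T)
    (hS : κ.presentEdges ord T S ⊆ R) :
    (κ.NegTwist T e → κ.LeeTerm e S S') ∧ (¬ κ.NegTwist T e → κ.LeeTerm e S' S) := by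
  have hS' := h.within hS
  have hpin : κ.SameFace S.H (e, 0) (e, 2) := sameFace_of_present hT hR hS h.present 0 2
  have hnpin : ¬ κ.SameFace S'.H (e, 0) (e, 2) :=
    not_pinched_of_absent hT hR hS' (hl.live hR) h.absent
  have hlab : S.lab (e, 0) = S.lab (e, 2) := S.lab_eq _ _ hpin
  constructor
  · intro hneg
    refine ⟨h.remove, fun b hb => h.rest b fun hv => ?_, fun _ => ?_, fun hn => absurd hpin hn⟩
    · have := sameFace_of_sameVertex hT hR hS hv
      rw [hl.eq_mk] at this
      exact hb _ this
    · rcases hl.ends hT hR with ⟨h0, h2⟩ | ⟨h2, h0⟩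
      · rw [h.outer _ h0, h.rest _ h2, ← hlab]
        unfold nonCritLabel
        rw [if_pos hneg]
        cases S.lab (e, 0) <;> trivial
      · rw [h.outer _ h2, h.rest _ h0]
        unfold nonCritLabel
        rw [if_pos hneg]
        cases S.lab (e, 0) <;> trivial
  · intro hpos
    refine ⟨toggle_symm h.remove, fun b hb => (h.rest b fun hv => ?_).symm,
      fun hn => absurd hn hnpin, fun _ => ?_⟩
    · have := sameFace_of_sameVertex hT hR hS' hv
      rw [hl.eq_mk] at this
      exact hb _ this
    · rcases hl.ends hT hR with ⟨h0, h2⟩ | ⟨h2, h0⟩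
      · rw [h.outer _ h0, h.rest _ h2, ← hlab]
        unfold nonCritLabel
        rw [if_neg hpos]
        cases S.lab (e, 0) <;> trivial
      · rw [h.outer _ h2, h.rest _ h0]
        unfold nonCritLabel
        rw [if_neg hpos]
        cases S.lab (e, 0) <;> trivial

/-- The target of a Lee map at a positive twist is determined if the outer vertex has the
noncritical label. -/
theorem leafPair_of_merge (hl : κ.IsLeaf ord p T R e a) (hT : κ.IsSpanningTree T)
    (hR : R ⊆ κ.liveEdges ord T) (hS' : κ.presentEdges ord T S' ⊆ R)
    (hpos : ¬ κ.NegTwist T e) (habs : ¬ κ.Present ord T S' e)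
    (hlab : S'.lab a = κ.nonCritLabel T e) (hLee : κ.LeeTerm e S' S) :
    κ.LeafPair ord T e a S S' := by
  have hpres : κ.Present ord T S e := (present_toggle hLee.1).2 habs
  have hrem : S'.H = symmDiff S.H {e} := toggle_symm hLee.1
  have hS : κ.presentEdges ord T S ⊆ R := by
    rw [(presentEdges_insert hrem hpres).1]
    exact Finset.insert_subset hl.1 hS'
  have hnpin : ¬ κ.SameFace S'.H (e, 0) (e, 2) :=
    not_pinched_of_absent hT hR hS' (hl.live hR) habs
  have hout : ∀ b, κ.SameVertex ord T b a → S'.lab b = κ.nonCritLabel T e := fun b hb => by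
    rw [← hlab]; exact S'.lab_eq _ _ (sameFace_of_sameVertex hT hR hS' hb)
  refine ⟨hpres, hrem, hout, fun b hb => ?_⟩
  by_cases htouch : ∃ k, κ.SameFace S'.H b (e, k)
  · have hm := hLee.2.2.2 hnpin
    obtain ⟨k, hk⟩ := htouch
    have hk' : κ.SameFace S'.H b (e, 0) ∨ κ.SameFace S'.H b (e, 2) := by
      rcases at_crossing (κ := κ) S'.H e k with h | h
      exacts [Or.inl (hk.trans h), Or.inr (hk.trans h)]
    have hS0 : S.lab b = S.lab (e, 0) := by
      have hle : ∀ {c}, κ.SameFace S'.H b c → κ.SameFace S.H b c := fun h =>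
        (sameFace_of_remove hT hR hS hpres hrem _ _).2 (Or.inl h)
      rcases hk' with h | h
      · exact S.lab_eq _ _ (hle h)
      · exact S.lab_eq _ _ ((hle h).trans (sameFace_of_present hT hR hS hpres _ _))
    have hna : ∀ j, κ.SameVertex ord T (e, j) a → ¬ κ.SameFace S'.H b (e, j) := fun j hj hbj =>
      hb (hl.sameVertex_of_sameFace hT hR hS' habs
        (hbj.trans (sameFace_of_sameVertex hT hR hS' hj)))
    rcases hl.ends hT hR with ⟨h0, _⟩ | ⟨h2, _⟩
    · have hb2 := S'.lab_eq _ _ (hk'.resolve_left (hna 0 h0))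
      rw [hS0, hb2]
      rw [hout _ h0] at hm
      unfold nonCritLabel at hm
      rw [if_neg hpos] at hm
      revert hm
      cases S'.lab (e, 2) <;> cases S.lab (e, 0) <;> simp
    · have hb0 := S'.lab_eq _ _ (hk'.resolve_right (hna 2 h2))
      rw [hS0, hb0]
      rw [hout _ h2] at hm
      unfold nonCritLabel at hm
      rw [if_neg hpos] at hm
      revert hm
      cases S'.lab (e, 0) <;> cases S.lab (e, 0) <;> simp
  · push Not at htouch
    exact (hLee.2.1 b htouch).symm

/-- The target of a Lee map at a negative twist is determined if its label at the outer vertex is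
noncritical. -/
theorem leafPair_of_split (hl : κ.IsLeaf ord p T R e a) (hT : κ.IsSpanningTree T)
    (hR : R ⊆ κ.liveEdges ord T) (hS : κ.presentEdges ord T S ⊆ R)
    (hneg : κ.NegTwist T e) (hpres : κ.Present ord T S e)
    (hlab : S'.lab a = κ.nonCritLabel T e) (hLee : κ.LeeTerm e S S') :
    κ.LeafPair ord T e a S S' := by
  have habs : ¬ κ.Present ord T S' e := by
    rw [present_toggle hLee.1]; exact not_not.2 hpres
  have hrem : S'.H = symmDiff S.H {e} := hLee.1
  have hS' : κ.presentEdges ord T S' ⊆ R :=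
    ((Finset.subset_insert _ _).trans (presentEdges_insert hrem hpres).1.symm.subset).trans hS
  have hpin : κ.SameFace S.H (e, 0) (e, 2) := sameFace_of_present hT hR hS hpres 0 2
  have hout : ∀ b, κ.SameVertex ord T b a → S'.lab b = κ.nonCritLabel T e := fun b hb => by
    rw [← hlab]; exact S'.lab_eq _ _ (sameFace_of_sameVertex hT hR hS' hb)
  refine ⟨hpres, hrem, hout, fun b hb => ?_⟩
  by_cases htouch : ∃ k, κ.SameFace S.H b (e, k)
  · have hm := hLee.2.2.1 hpin
    obtain ⟨k, hk⟩ := htouch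
    have hS0 : S.lab b = S.lab (e, 0) :=
      S.lab_eq _ _ (hk.trans (sameFace_of_present hT hR hS hpres _ _))
    have hk' : κ.SameFace S'.H b (e, 0) ∨ κ.SameFace S'.H b (e, 2) := by
      rcases (sameFace_of_remove hT hR hS hpres hrem _ _).1 hk with h | ⟨h, _⟩ | ⟨h, _⟩
      · rcases at_crossing (κ := κ) S'.H e k with h' | h'
        exacts [Or.inl (h.trans h'), Or.inr (h.trans h')]
      exacts [Or.inl h, Or.inr h]
    have hna : ∀ j, κ.SameVertex ord T (e, j) a → ¬ κ.SameFace S'.H b (e, j) := fun j hj hbj =>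
      hb (hl.sameVertex_of_sameFace hT hR hS' habs
        (hbj.trans (sameFace_of_sameVertex hT hR hS' hj)))
    rcases hl.ends hT hR with ⟨h0, _⟩ | ⟨h2, _⟩
    · have hb2 := S'.lab_eq _ _ (hk'.resolve_left (hna 0 h0))
      rw [hS0, hb2]
      rw [hout _ h0] at hm
      unfold nonCritLabel at hm
      rw [if_pos hneg] at hm
      revert hm
      cases S'.lab (e, 2) <;> cases S.lab (e, 0) <;> simp
    · have hb0 := S'.lab_eq _ _ (hk'.resolve_right (hna 2 h2))
      rw [hS0, hb0]
      rw [hout _ h2] at hm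
      unfold nonCritLabel at hm
      rw [if_pos hneg] at hm
      revert hm
      cases S'.lab (e, 0) <;> cases S.lab (e, 0) <;> simp
  · push Not at htouch
    exact hLee.2.1 b htouch

/-- removing a leaf edge from a state -/
theorem exists_leafPair_absent (hl : κ.IsLeaf ord p T R e a) (hT : κ.IsSpanningTree T)
    (hR : R ⊆ κ.liveEdges ord T) (hS : κ.presentEdges ord T S ⊆ R)
    (hpres : κ.Present ord T S e) : ∃ S', κ.LeafPair ord T e a S S' := by
  let H' := symmDiff S.H {e}
  let S₀ : κ.Enhanced := ⟨H', fun _ => .one, fun _ _ _ => rfl⟩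
  have hrem : S₀.H = symmDiff S.H {e} := rfl
  have habs : ¬ κ.Present ord T S₀ e := by
    rw [present_toggle hrem]; exact not_not.2 hpres
  have hS₀ : κ.presentEdges ord T S₀ ⊆ R :=
    ((Finset.subset_insert _ _).trans (presentEdges_insert hrem hpres).1.symm.subset).trans hS
  refine ⟨⟨H', fun b => if κ.SameVertex ord T b a then κ.nonCritLabel T e else S.lab b,
    fun b c hbc => ?_⟩, hpres, rfl, fun b hb => if_pos hb, fun b hb => if_neg hb⟩
  have hbc' : κ.SameFace S₀.H b c := hbc
  have hiff : κ.SameVertex ord T b a ↔ κ.SameVertex ord T c a := by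
    constructor
    · intro h
      exact hl.sameVertex_of_sameFace hT hR hS₀ habs
        (hbc'.symm.trans (sameFace_of_sameVertex hT hR hS₀ h))
    · intro h
      exact hl.sameVertex_of_sameFace hT hR hS₀ habs
        (hbc'.trans (sameFace_of_sameVertex hT hR hS₀ h))
  simp only [hiff]
  split_ifs
  · rfl
  · exact S.lab_eq _ _ ((sameFace_of_remove hT hR hS hpres hrem _ _).2 (Or.inl hbc'))

/-- inserting a leaf edge into a state with the noncritical label at the outer vertex -/
theorem exists_leafPair_present (hl : κ.IsLeaf ord p T R e a) (hT : κ.IsSpanningTree T)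
    (hR : R ⊆ κ.liveEdges ord T) (hS' : κ.presentEdges ord T S' ⊆ R)
    (habs : ¬ κ.Present ord T S' e) (hlab : S'.lab a = κ.nonCritLabel T e) :
    ∃ S, κ.LeafPair ord T e a S S' := by
  let H := symmDiff S'.H {e}
  let S₀ : κ.Enhanced := ⟨H, fun _ => .one, fun _ _ _ => rfl⟩
  have hrem : S'.H = symmDiff S₀.H {e} := toggle_symm (S := S') (S' := S₀) rfl
  have hpres : κ.Present ord T S₀ e := (present_toggle (S := S') (S' := S₀) rfl).2 habs
  have hS₀ : κ.presentEdges ord T S₀ ⊆ R := by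
    rw [(presentEdges_insert hrem hpres).1]
    exact Finset.insert_subset hl.1 hS'
  -- `(e, j)` is the end of `e` away from the outer vertex. The merged circle inherits its label.
  obtain ⟨j, hj0, hja⟩ : ∃ j : ZMod 4, ¬ κ.SameVertex ord T (e, j) a ∧
      ((κ.SameVertex ord T (e, 0) a ∧ j = 2) ∨ (κ.SameVertex ord T (e, 2) a ∧ j = 0)) := by
    rcases hl.ends hT hR with ⟨h0, h2⟩ | ⟨h2, h0⟩
    exacts [⟨2, h2, Or.inl ⟨h0, rfl⟩⟩, ⟨0, h0, Or.inr ⟨h2, rfl⟩⟩]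
  have hout : ∀ b, κ.SameVertex ord T b a → S'.lab b = κ.nonCritLabel T e := fun b hb => by
    rw [← hlab]; exact S'.lab_eq _ _ (sameFace_of_sameVertex hT hR hS' hb)
  refine ⟨⟨H, fun b => if κ.SameVertex ord T b a then S'.lab (e, j) else S'.lab b,
    fun b c hbc => ?_⟩, hpres, hrem, hout, fun b hb => (if_neg hb).symm⟩
  have hmeet : ∀ {b}, κ.SameFace S'.H b a → κ.SameVertex ord T b a :=
    fun h => hl.sameVertex_of_sameFace hT hR hS' habs h
  have hself : ∀ {b}, κ.SameVertex ord T b a → κ.SameFace S'.H b a :=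
    fun h => sameFace_of_sameVertex hT hR hS' h
  have hend : ∀ {b}, (κ.SameFace S'.H b (e, 0) ∨ κ.SameFace S'.H b (e, 2)) →
      (if κ.SameVertex ord T b a then S'.lab (e, j) else S'.lab b) = S'.lab (e, j) := by
    intro b hb
    split_ifs with hba
    · rfl
    · rcases hja with ⟨h0, rfl⟩ | ⟨h2, rfl⟩
      · exact S'.lab_eq _ _ (hb.resolve_left fun h => hba (hmeet (h.trans (hself h0))))
      · exact S'.lab_eq _ _ (hb.resolve_right fun h => hba (hmeet (h.trans (hself h2))))
  rcases (sameFace_of_remove (S := S₀) hT hR hS₀ hpres hrem b c).1 hbc with h | ⟨h, h'⟩ | ⟨h, h'⟩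
  · have hiff : κ.SameVertex ord T b a ↔ κ.SameVertex ord T c a :=
      ⟨fun h1 => hmeet (h.symm.trans (hself h1)), fun h1 => hmeet (h.trans (hself h1))⟩
    simp only [hiff]
    split_ifs
    · rfl
    · exact S'.lab_eq _ _ h
  · exact (hend (Or.inl h)).trans (hend (Or.inr h')).symm
  · exact (hend (Or.inr h)).trans (hend (Or.inl h')).symm

end Leaf

/-! ### The matching -/

/-- the edges of the outer half-edges in `l` are absent, and their outer vertices have the critical
labels -/
def Settled (κ : D.Checkerboard) (ord : Fin D.n ≃ Fin D.n) (T : Finset (Fin D.n))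
    (l : List D.HalfEdge) (S : κ.Enhanced) : Prop :=
  κ.InUnknot ord T S ∧ ∀ a ∈ l, ¬ κ.Present ord T S a.1 ∧ S.lab a = κ.critLabel T a.1

section Matching

variable {R : Finset (Fin D.n)} {l : List D.HalfEdge} {p : D.HalfEdge} {e : Fin D.n}
  {a : D.HalfEdge} {S S' : κ.Enhanced}

theorem Settled.within (h : κ.Settled ord T l S) (hs : κ.Stage ord p T R l) :
    κ.presentEdges ord T S ⊆ R := by
  intro e he
  rcases hs.mem_or (Finset.mem_filter.1 (inUnknot_iff.1 h.1 he)).2 with h1 | ⟨a, ha, rfl⟩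
  · exact h1
  · exact absurd (mem_presentEdges.1 he) (h.2 a ha).1

theorem settled_cons (hl : a.1 = e) : κ.Settled ord T (a :: l) S ↔
    κ.Settled ord T l S ∧ ¬ κ.Present ord T S e ∧ S.lab a = κ.critLabel T e := by
  subst hl
  unfold Settled
  simp only [List.forall_mem_cons]
  tauto

theorem LeafPair.settled (h : κ.LeafPair ord T e a S S') (hs : κ.Stage ord p T R l)
    (hl : κ.IsLeaf ord p T R e a) (hT : κ.IsSpanningTree T) :
    κ.Settled ord T l S ↔ κ.Settled ord T l S' := by
  have hR := (hs.rooted hT).1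
  have hlab : ∀ b ∈ l, S'.lab b = S.lab b := fun b hb => h.rest b fun hv => by
    have := hs.untouched hb hl.1 a.2
    rw [← hl.eq_mk] at this
    exact this hv.symm
  have hpres : ∀ b ∈ l, (κ.Present ord T S' b.1 ↔ κ.Present ord T S b.1) := fun b hb => by
    refine present_toggle_of_ne h.remove fun hbe => ?_
    have := hs.untouched hb hl.1 b.2
    rw [← hbe] at this
    exact this (SameVertex.refl b)
  have hun : κ.InUnknot ord T S ↔ κ.InUnknot ord T S' := by
    rw [inUnknot_iff, inUnknot_iff]
    exact ⟨h.within, h.within' (hR hl.1)⟩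
  unfold Settled
  refine and_congr hun (forall₂_congr fun b hb => ?_)
  rw [hlab b hb, hpres b hb]

/-- The least leaf edge is unique, and any two half-edges representing its outer vertex are on the
same circle. Hence inversion can be stated for a prescribed `e` and `a`. -/
theorem PairedIn.cases (h : κ.PairedIn ord p T R S S') (hl : κ.IsLeastLeaf ord p T R e a)
    (hT : κ.IsSpanningTree T) (hR : κ.Rooted ord p T R) (hS : κ.InUnknot ord T S)
    (hS' : κ.InUnknot ord T S') :
    κ.LeafPair ord T e a S S' ∨ (¬ κ.Present ord T S e ∧ ¬ κ.Present ord T S' e ∧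
      S.lab a = κ.critLabel T e ∧ S'.lab a = κ.critLabel T e ∧
      κ.PairedIn ord p T (R.erase e) S S') := by
  cases h with
  | leaf _ e' a' _ _ least present remove outer rest =>
    obtain rfl := hl.eq least
    have hv := hl.1.sameVertex hT hR least.1
    exact Or.inl ⟨present, remove, fun b hb => outer b (hb.trans hv),
      fun b hb => rest b fun h => hb (h.trans hv.symm)⟩
  | step _ e' a' _ _ least absent absent' crit crit' paired =>
    obtain rfl := hl.eq least
    have hv := hl.1.sameVertex hT hR least.1
    exact Or.inr ⟨absent, absent', (lab_eq_of_sameVertex hT hS hv).trans crit,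
      (lab_eq_of_sameVertex hT hS' hv).trans crit', paired⟩

theorem Stage.descend (hs : κ.Stage ord p T R l) (hT : κ.IsSpanningTree T)
    (hS : κ.Settled ord T l S) (hS' : κ.Settled ord T l S')
    (h : κ.PairedIn ord p T (κ.liveEdges ord T) S S') : κ.PairedIn ord p T R S S' := by
  induction hs with
  | start => exact h
  | next R l e a hs hl ih =>
    rw [settled_cons hl.1.2.1] at hS hS'
    rcases (ih hS.1 hS'.1).cases hl hT (hs.rooted hT) hS.1.1 hS'.1.1 with h | h
    exacts [absurd h.present hS.2.1, h.2.2.2.2]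

theorem Stage.ascend (hs : κ.Stage ord p T R l)
    (hS : κ.Settled ord T l S) (hS' : κ.Settled ord T l S')
    (h : κ.PairedIn ord p T R S S') : κ.PairedIn ord p T (κ.liveEdges ord T) S S' := by
  induction hs with
  | start => exact h
  | next R l e a hs hl ih =>
    rw [settled_cons hl.1.2.1] at hS hS'
    exact ih hS.1 hS'.1 (.step R e a S S' hl hS.2.1 hS'.2.1 hS.2.2 hS'.2.2 h)

theorem LeafPair.matched (h : κ.LeafPair ord T e a S S') (hs : κ.Stage ord p T R l)
    (hl : κ.IsLeastLeaf ord p T R e a) (hT : κ.IsSpanningTree T)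
    (hS : κ.Settled ord T l S) :
    (κ.NegTwist T e → κ.Matched ord p S S') ∧ (¬ κ.NegTwist T e → κ.Matched ord p S' S) := by
  have hS' := (h.settled hs hl.1 hT).1 hS
  have hR := hs.rooted hT
  have hpair : κ.Paired ord p S S' := ⟨T, hT, hS.1, hS'.1, hs.ascend hS hS'
    (.leaf R e a S S' hl h.present h.remove h.outer h.rest)⟩
  have hLee := h.leeTerm hl.1 hT hR.1 (hS.within hs)
  have hlive := hl.1.live hR.1
  constructor
  · intro hn
    refine ⟨incidence_ne_zero_iff.2 ⟨e, ?_, hLee.1 hn⟩, Or.inl hpair⟩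
    rw [mem_aEdges_iff_present hlive]
    exact iff_of_true h.present hn
  · intro hn
    refine ⟨incidence_ne_zero_iff.2 ⟨e, ?_, hLee.2 hn⟩, Or.inr hpair⟩
    rw [mem_aEdges_iff_present hlive]
    exact iff_of_false h.absent hn

end Matching

end States

end
end Checkerboard
end KnotDiagram


/-! ### Cycles of a relation and nilpotent weight matrices -/

section Cycles

variable {α : Type*} {r : α → α → Prop}

theorem transGen_restrict {P : α → Prop} (h : ∀ a b, r a b → P a → P b) {x y : α} (hx : P x)
    (hxy : Relation.TransGen r x y) :
    Relation.TransGen (fun a b => r a b ∧ P a ∧ P b) x y ∧ P y := by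
  induction hxy with
  | single hab => exact ⟨.single ⟨hab, hx, h _ _ hab hx⟩, h _ _ hab hx⟩
  | tail _ hbc ih => exact ⟨ih.1.tail ⟨hbc, ih.2, h _ _ hbc ih.2⟩, h _ _ hbc ih.2⟩

/-- A function that decreases along a relation is constant on each cycle. -/
theorem transGen_const {β : Type*} [PartialOrder β] (f : α → β)
    (h : ∀ a b, r a b → f b ≤ f a) {x : α} (hx : Relation.TransGen r x x) :
    Relation.TransGen (fun a b => r a b ∧ f a = f x ∧ f b = f x) x x := by
  have key : ∀ y, Relation.TransGen r x y → f y ≤ f x ∧ (f y = f x →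
      Relation.TransGen (fun a b => r a b ∧ f a = f x ∧ f b = f x) x y) := by
    intro y hy
    induction hy with
    | single hab => exact ⟨h _ _ hab, fun hf => .single ⟨hab, rfl, hf⟩⟩
    | tail _ hbc ih =>
      refine ⟨(h _ _ hbc).trans ih.1, fun hf => ?_⟩
      have hb := le_antisymm ih.1 (hf ▸ h _ _ hbc)
      exact (ih.2 hb).tail ⟨hbc, hb, hf⟩
  exact (key x hx).2 rfl

/-- The matrix of an acyclic weighted graph is nilpotent. -/
theorem matrix_pow_card_eq_zero [Fintype α] [DecidableEq α] (W : Matrix α α ℚ)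
    (h : ∀ x, ¬ Relation.TransGen (fun a b => W a b ≠ 0) x x) : W ^ Fintype.card α = 0 := by
  classical
  -- The number of reachable points drops along each edge, which bounds the length of paths.
  let reach : α → Finset α := fun a =>
    Finset.univ.filter fun b => Relation.TransGen (fun a b => W a b ≠ 0) a b
  have hlt : ∀ a b, W a b ≠ 0 → (reach b).card < (reach a).card := by
    intro a b hab
    refine Finset.card_lt_card ⟨fun c hc => ?_, fun hs => ?_⟩
    · exact Finset.mem_filter.2 ⟨Finset.mem_univ _, .head hab (Finset.mem_filter.1 hc).2⟩
    · have : b ∈ reach b := hs (Finset.mem_filter.2 ⟨Finset.mem_univ _, .single hab⟩)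
      exact h b (Finset.mem_filter.1 this).2
  have hpow : ∀ k a b, (W ^ k) a b ≠ 0 → (reach b).card + k ≤ (reach a).card := by
    intro k
    induction k with
    | zero =>
      intro a b hab
      rw [pow_zero, Matrix.one_apply] at hab
      have : a = b := by by_contra hne; exact hab (if_neg hne)
      rw [this]; rfl
    | succ k ih =>
      intro a b hab
      rw [pow_succ, Matrix.mul_apply] at hab
      obtain ⟨c, _, hc⟩ := Finset.exists_ne_zero_of_sum_ne_zero hab
      have h1 := ih a c (left_ne_zero_of_mul hc)
      have h2 := hlt c b (right_ne_zero_of_mul hc)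
      omega
  ext a b
  by_contra hne
  have h1 := hpow _ a b hne
  have h2 : (reach a).card < Fintype.card α := by
    refine Finset.card_lt_univ_of_notMem (x := a) fun ha => ?_
    exact h a (Finset.mem_filter.1 ha).2
  omega

end Cycles

namespace KnotDiagram
namespace Checkerboard
noncomputable section
open scoped Classical

variable {D : KnotDiagram} {κ : D.Checkerboard} {ord : Fin D.n ≃ Fin D.n} {p : D.HalfEdge}

/-! ### The matching is acyclic -/

theorem tree_eq_of_inUnknot {T : Finset (Fin D.n)} (hT : κ.IsSpanningTree T) {S : κ.Enhanced}
    (h : κ.InUnknot ord T S) : T = κ.tree ord S.H :=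
  eq_tree hT (inUnknot_iff_agrees.1 h)

theorem inUnknot_tree (S : κ.Enhanced) : κ.InUnknot ord (κ.tree ord S.H) S :=
  inUnknot_iff_agrees.2 (agrees_tree κ ord S.H)

theorem Paired.tree_eq {S S' : κ.Enhanced} (h : κ.Paired ord p S S') :
    κ.tree ord S.H = κ.tree ord S'.H := by
  obtain ⟨T, hT, h1, h2, -⟩ := h
  rw [← tree_eq_of_inUnknot hT h1, ← tree_eq_of_inUnknot hT h2]

theorem Matched.tree_eq {S S' : κ.Enhanced} (h : κ.Matched ord p S S') :
    κ.tree ord S.H = κ.tree ord S'.H := by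
  rcases h.2 with h | h
  exacts [h.tree_eq, h.tree_eq.symm]

theorem Paired.pairedIn {T : Finset (Fin D.n)} (hT : κ.IsSpanningTree T) {S S' : κ.Enhanced}
    (h : κ.Paired ord p S S') (hS : κ.InUnknot ord T S) :
    κ.InUnknot ord T S' ∧ κ.PairedIn ord p T (κ.liveEdges ord T) S S' := by
  obtain ⟨T', hT', h1, h2, h3⟩ := h
  obtain rfl : T' = T := by
    rw [tree_eq_of_inUnknot hT hS, tree_eq_of_inUnknot hT' h1]
  exact ⟨h2, h3⟩

theorem weight_ne_zero {S S' : κ.Enhanced} (h : κ.weight ord p S S' ≠ 0) :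
    κ.Matched ord p S' S ∨ (κ.incidence ord S S' ≠ 0 ∧ ¬ κ.Matched ord p S S') := by
  unfold weight at h
  split_ifs at h with h1 h2
  exacts [Or.inl h1, absurd rfl h, Or.inr ⟨h, h2⟩]

theorem not_pairedIn_empty {T : Finset (Fin D.n)} (A B : κ.Enhanced) :
    ¬ κ.PairedIn ord p T ∅ A B := by
  intro h
  cases h with
  | leaf _ e a _ _ least => exact Finset.notMem_empty _ least.1.1
  | step _ e a _ _ least => exact Finset.notMem_empty _ least.1.1

/-! ### Acyclicity on a single twisted unknot -/

section Classes

variable {T R : Finset (Fin D.n)} {l : List D.HalfEdge} {e : Fin D.n} {a : D.HalfEdge}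
  {S S' : κ.Enhanced}

/-- The position of a state in an order of the three classes of states with respect to the leaf
edge `e`: those which contain `e`, and the others, according to the label at the outer vertex. -/
def leafClass (κ : D.Checkerboard) (ord : Fin D.n ≃ Fin D.n) (T : Finset (Fin D.n)) (e : Fin D.n)
    (a : D.HalfEdge) (S : κ.Enhanced) : ℕ :=
  if κ.Present ord T S e then 1
  else if S.lab a = κ.critLabel T e then (if κ.NegTwist T e then 0 else 2)
  else if κ.NegTwist T e then 2 else 0

theorem leafClass_eq_iff : κ.leafClass ord T e a S = (if κ.NegTwist T e then 0 else 2) ↔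
    ¬ κ.Present ord T S e ∧ S.lab a = κ.critLabel T e := by
  unfold leafClass
  split_ifs <;> simp_all

theorem leafClass_of_present (h : κ.Present ord T S e) : κ.leafClass ord T e a S = 1 := if_pos h

theorem leafClass_of_nonCrit (h : ¬ κ.Present ord T S e) (h' : S.lab a = κ.nonCritLabel T e) :
    κ.leafClass ord T e a S = if κ.NegTwist T e then 2 else 0 := by
  unfold leafClass
  rw [if_neg h, if_neg (eq_nonCritLabel_iff.1 h')]

theorem LeafPair.remove_mem {S S' A B : κ.Enhanced} (h : κ.LeafPair ord T e a A B)
    (hinc : κ.incidence ord S S' ≠ 0) (hAB : (S = A ∧ S' = B) ∨ (S = B ∧ S' = A)) :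
    e ∈ κ.aEdges S.H := by
  obtain ⟨f, hf, hLee⟩ := incidence_ne_zero_iff.1 hinc
  have : S'.H = symmDiff S.H {e} := by
    rcases hAB with ⟨rfl, rfl⟩ | ⟨rfl, rfl⟩
    exacts [h.remove, toggle_symm h.remove]
  rwa [← symmDiff_singleton_injective (hLee.1.symm.trans this)]

/-- At a negative twist, arrows can only go from noncritical (by a reversed matched edge) to present
to critical. At a positive twist they go from critical to present to noncritical. Matched edges
within one class occur only in the critical class, where the recursion continues. -/
theorem leafClass_step (hT : κ.IsSpanningTree T) (hs : κ.Stage ord p T R l)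
    (hl : κ.IsLeastLeaf ord p T R e a) (hS : κ.Settled ord T l S) (hS' : κ.Settled ord T l S')
    (hw : κ.weight ord p S S' ≠ 0) :
    κ.leafClass ord T e a S' ≤ κ.leafClass ord T e a S ∧
      (κ.leafClass ord T e a S' = κ.leafClass ord T e a S →
        κ.leafClass ord T e a S = (if κ.NegTwist T e then 0 else 2) ∨
          κ.hdeg S' = κ.hdeg S + 1) := by
  have hR := hs.rooted hT
  have hlive := hl.1.live hR.1
  rcases weight_ne_zero hw with hm | ⟨hinc, hm⟩
  · have hpair : ∀ A B : κ.Enhanced, (S' = A ∧ S = B) ∨ (S' = B ∧ S = A) →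
        κ.PairedIn ord p T (κ.liveEdges ord T) A B → κ.Settled ord T l A →
        κ.Settled ord T l B → κ.LeafPair ord T e a A B ∨
          (κ.leafClass ord T e a S' = (if κ.NegTwist T e then 0 else 2) ∧
            κ.leafClass ord T e a S = (if κ.NegTwist T e then 0 else 2)) := by
      intro A B hAB hp hA hB
      rcases (hs.descend hT hA hB hp).cases hl hT hR hA.1 hB.1 with h | ⟨h1, h2, h3, h4, _⟩
      · exact Or.inl h
      · right
        rcases hAB with ⟨rfl, rfl⟩ | ⟨rfl, rfl⟩
        · exact ⟨leafClass_eq_iff.2 ⟨h1, h3⟩, leafClass_eq_iff.2 ⟨h2, h4⟩⟩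
        · exact ⟨leafClass_eq_iff.2 ⟨h2, h4⟩, leafClass_eq_iff.2 ⟨h1, h3⟩⟩
    have hcases : κ.LeafPair ord T e a S' S ∨ κ.LeafPair ord T e a S S' ∨
          (κ.leafClass ord T e a S' = (if κ.NegTwist T e then 0 else 2) ∧
            κ.leafClass ord T e a S = (if κ.NegTwist T e then 0 else 2)) := by
      rcases hm.2 with h | h
      · rcases hpair S' S (Or.inl ⟨rfl, rfl⟩) (h.pairedIn hT hS'.1).2 hS' hS with h | h
        exacts [Or.inl h, Or.inr (Or.inr h)]
      · rcases hpair S S' (Or.inr ⟨rfl, rfl⟩) (h.pairedIn hT hS.1).2 hS hS' with h | h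
        exacts [Or.inr (Or.inl h), Or.inr (Or.inr h)]
    rcases hcases with h | h | ⟨h1, h2⟩
    · have ha := h.remove_mem hm.1 (Or.inl ⟨rfl, rfl⟩)
      rw [mem_aEdges_iff_present hlive] at ha
      have hn := ha.1 h.present
      rw [leafClass_of_present h.present,
        leafClass_of_nonCrit h.absent (h.outer a (SameVertex.refl a)), if_pos hn]
      omega
    · have ha := h.remove_mem hm.1 (Or.inr ⟨rfl, rfl⟩)
      rw [mem_aEdges_iff_present hlive] at ha
      have hn : ¬ κ.NegTwist T e := fun hn => h.absent (ha.2 hn)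
      rw [leafClass_of_present h.present,
        leafClass_of_nonCrit h.absent (h.outer a (SameVertex.refl a)), if_neg hn]
      omega
    · rw [h1, h2]
      exact ⟨le_rfl, fun _ => Or.inl rfl⟩
  · have hdeg := hdeg_of_incidence hinc
    refine ⟨?_, fun _ => Or.inr hdeg⟩
    obtain ⟨f, hf, hLee⟩ := incidence_ne_zero_iff.1 hinc
    have hSR := hS.within hs
    have hSR' := hS'.within hs
    by_cases hfe : f = e
    · subst hfe
      have ha := (mem_aEdges_iff_present hlive).1 hf
      by_cases hpres : κ.Present ord T S f
      · have hn := ha.1 hpres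
        have habs : ¬ κ.Present ord T S' f := by
          rw [present_toggle hLee.1]; exact not_not.2 hpres
        rw [leafClass_of_present hpres]
        by_cases hcrit : S'.lab a = κ.critLabel T f
        · have := leafClass_eq_iff.2 ⟨habs, hcrit⟩
          rw [if_pos hn] at this
          omega
        · have hpair := leafPair_of_split hl.1 hT hR.1 hSR hn hpres
            (eq_nonCritLabel_iff.2 hcrit) hLee
          exact absurd ((hpair.matched hs hl hT hS).1 hn) hm
      · have hn : ¬ κ.NegTwist T f := fun hn => hpres (ha.2 hn)
        have hpres' : κ.Present ord T S' f := (present_toggle hLee.1).2 hpres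
        rw [leafClass_of_present hpres']
        by_cases hcrit : S.lab a = κ.critLabel T f
        · have := leafClass_eq_iff.2 ⟨hpres, hcrit⟩
          rw [if_neg hn] at this
          omega
        · have hpair := leafPair_of_merge hl.1 hT hR.1 hSR hn hpres
            (eq_nonCritLabel_iff.2 hcrit) hLee
          exact absurd ((hpair.matched hs hl hT hS').2 hn) hm
    · have hpres := present_toggle_of_ne (ord := ord) (T := T) hLee.1 (Ne.symm hfe)
      by_cases hp : κ.Present ord T S e
      · rw [leafClass_of_present hp, leafClass_of_present (hpres.2 hp)]
      · have hfR : f ∈ R := by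
          by_cases h : κ.Present ord T S f
          · exact hSR (mem_presentEdges.2 h)
          · exact hSR' (mem_presentEdges.2 ((present_toggle hLee.1).2 h))
        have hlab : S'.lab a = S.lab a :=
          -- The outer vertex is isolated, so a Lee map at another remaining edge leaves its label
          -- unchanged.
          hLee.2.1 a fun k => hl.1.not_sameFace hT hR.1 hSR hp hfR hfe k
        unfold leafClass
        rw [hpres, hlab]

theorem transGen_hdeg_lt {r : κ.Enhanced → κ.Enhanced → Prop}
    (h : ∀ A B, r A B → κ.hdeg B = κ.hdeg A + 1) {x y : κ.Enhanced}
    (hxy : Relation.TransGen r x y) : κ.hdeg x < κ.hdeg y := by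
  induction hxy with
  | single hab => have := h _ _ hab; omega
  | tail _ hbc ih => have := h _ _ hbc; omega

/-- The class at the least leaf is constant on a cycle. Outside the critical class every step raises
the degree, which is impossible; inside it the leaf can be removed, and induction applies. -/
theorem Settled.acyclic (hT : κ.IsSpanningTree T) (hs : κ.Stage ord p T R l) (x : κ.Enhanced) :
    ¬ Relation.TransGen (fun S S' => κ.weight ord p S S' ≠ 0 ∧ κ.Settled ord T l S ∧
      κ.Settled ord T l S') x x := by
  induction hn : R.card using Nat.strong_induction_on generalizing R l with
  | _ n ih =>
    intro hx
    rcases R.eq_empty_or_nonempty with rfl | hne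
    · obtain ⟨y, hxy, -⟩ := Relation.TransGen.head'_iff.1 hx
      obtain ⟨hw, hS, hS'⟩ := hxy
      rcases weight_ne_zero hw with hm | ⟨hinc, -⟩
      · rcases hm.2 with h | h
        · exact not_pairedIn_empty _ _ (hs.descend hT hS' hS (h.pairedIn hT hS'.1).2)
        · exact not_pairedIn_empty _ _ (hs.descend hT hS hS' (h.pairedIn hT hS.1).2)
      · obtain ⟨f, hf, hLee⟩ := incidence_ne_zero_iff.1 hinc
        by_cases h : κ.Present ord T x f
        · exact Finset.notMem_empty _ (hS.within hs (mem_presentEdges.2 h))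
        · exact Finset.notMem_empty _
            (hS'.within hs (mem_presentEdges.2 ((present_toggle hLee.1).2 h)))
    · obtain ⟨e, a, hl⟩ := exists_isLeastLeaf hT (hs.rooted hT) hne
      have hstep : ∀ A B : κ.Enhanced, (κ.weight ord p A B ≠ 0 ∧ κ.Settled ord T l A ∧
          κ.Settled ord T l B) → κ.leafClass ord T e a B ≤ κ.leafClass ord T e a A :=
        fun A B h => (leafClass_step hT hs hl h.2.1 h.2.2 h.1).1
      have hx' := transGen_const (κ.leafClass ord T e a) hstep hx
      by_cases hcls : κ.leafClass ord T e a x = (if κ.NegTwist T e then 0 else 2)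
      · refine ih _ ?_ (.next R l e a hs hl) rfl (Relation.TransGen.mono ?_ _ _ hx')
        · rw [← hn]; exact Finset.card_erase_lt_of_mem hl.1.1
        · rintro A B ⟨⟨hw, hA, hB⟩, h1, h2⟩
          rw [hcls] at h1 h2
          exact ⟨hw, (settled_cons hl.1.2.1).2 ⟨hA, leafClass_eq_iff.1 h1⟩,
            (settled_cons hl.1.2.1).2 ⟨hB, leafClass_eq_iff.1 h2⟩⟩
      · refine lt_irrefl _ (transGen_hdeg_lt ?_ hx')
        rintro A B ⟨⟨hw, hA, hB⟩, h1, h2⟩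
        refine ((leafClass_step hT hs hl hA hB hw).2 (h2.trans h1.symm)).resolve_left ?_
        rw [h1]; exact hcls

end Classes

/-- The tree potential does not increase along arrows, and it drops when the tree changes. So a
cycle stays in one twisted unknot. -/
theorem weight_acyclic (x : κ.Enhanced) :
    ¬ Relation.TransGen (fun S S' => κ.weight ord p S S' ≠ 0) x x := by
  intro hx
  have hstep : ∀ A B : κ.Enhanced, κ.weight ord p A B ≠ 0 →
      κ.tree ord B.H = κ.tree ord A.H ∨
        κ.treePotential ord B.H < κ.treePotential ord A.H := by
    intro A B h
    rcases weight_ne_zero h with hm | ⟨hinc, -⟩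
    · exact Or.inl hm.tree_eq
    · obtain ⟨f, hf, hLee⟩ := incidence_ne_zero_iff.1 hinc
      rw [hLee.1]
      exact tree_toggle hf
  have hle : ∀ A B : κ.Enhanced, κ.weight ord p A B ≠ 0 →
      κ.treePotential ord B.H ≤ κ.treePotential ord A.H := by
    intro A B h
    rcases hstep A B h with h | h
    · unfold treePotential; rw [h]
    · exact h.le
  have hx1 := transGen_const (fun A : κ.Enhanced => κ.treePotential ord A.H) hle hx
  have hx2 := (transGen_restrict (P := fun A : κ.Enhanced => κ.tree ord A.H = κ.tree ord x.H)
    (fun A B h hA => by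
      rcases hstep A B h.1 with h' | h'
      · exact h'.trans hA
      · exact absurd (h.2.2.trans h.2.1.symm) h'.ne) rfl hx1).1
  refine Settled.acyclic (p := p) (isSpanningTree_tree κ ord x.H) (Stage.start (ord := ord)) x
    (Relation.TransGen.mono ?_ _ _ hx2)
  rintro A B ⟨⟨hw, -⟩, hA, hB⟩
  refine ⟨hw, ⟨hA ▸ inUnknot_tree A, by simp⟩, ⟨hB ▸ inUnknot_tree B, by simp⟩⟩

theorem weight_pow_card (κ : D.Checkerboard) (ord : Fin D.n ≃ Fin D.n) (p : D.HalfEdge) :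
    κ.weight ord p ^ Fintype.card κ.Enhanced = 0 :=
  matrix_pow_card_eq_zero _ weight_acyclic

/-! ### Every state has at most one partner -/

theorem LeafPair.eq_of_left {T : Finset (Fin D.n)} {e : Fin D.n} {a : D.HalfEdge}
    {S A B : κ.Enhanced} (hA : κ.LeafPair ord T e a S A) (hB : κ.LeafPair ord T e a S B) :
    A = B := by
  refine Enhanced.ext (hA.remove.trans hB.remove.symm) (funext fun b => ?_)
  by_cases hb : κ.SameVertex ord T b a
  · rw [hA.outer b hb, hB.outer b hb]
  · rw [hA.rest b hb, hB.rest b hb]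

/-- While `e` is present, the outer vertex is on the same circle as the other end of `e`, whose
label is not changed by the pairing. -/
theorem LeafPair.eq_of_right {T R : Finset (Fin D.n)} {e : Fin D.n} {a : D.HalfEdge}
    {S A B : κ.Enhanced} (hl : κ.IsLeaf ord p T R e a) (hT : κ.IsSpanningTree T)
    (hR : R ⊆ κ.liveEdges ord T) (hS : κ.presentEdges ord T S ⊆ R)
    (hA : κ.LeafPair ord T e a A S) (hB : κ.LeafPair ord T e a B S) : A = B := by
  obtain ⟨j, hj⟩ : ∃ j : ZMod 4, ¬ κ.SameVertex ord T (e, j) a := by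
    rcases hl.ends hT hR with ⟨_, h⟩ | ⟨_, h⟩
    exacts [⟨2, h⟩, ⟨0, h⟩]
  have key : ∀ X : κ.Enhanced, κ.LeafPair ord T e a X S → ∀ b, κ.SameVertex ord T b a →
      X.lab b = S.lab (e, j) := by
    intro X hX b hb
    have hXR := hX.within' hl.1 hS
    rw [hX.rest _ hj]
    refine X.lab_eq _ _ ((sameFace_of_sameVertex hT hR hXR hb).trans ?_)
    rw [hl.eq_mk]
    exact sameFace_of_present hT hR hXR hX.present _ _
  refine Enhanced.ext ((toggle_symm hA.remove).trans (toggle_symm hB.remove).symm)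
    (funext fun b => ?_)
  by_cases hb : κ.SameVertex ord T b a
  · rw [key A hA b hb, key B hB b hb]
  · rw [← hA.rest b hb, ← hB.rest b hb]

theorem Stage.partner_unique {T R : Finset (Fin D.n)} {l : List D.HalfEdge}
    (hT : κ.IsSpanningTree T) (hs : κ.Stage ord p T R l) {A S B : κ.Enhanced}
    (hA : κ.Settled ord T l A) (hS : κ.Settled ord T l S) (hB : κ.Settled ord T l B)
    (hAS : κ.PairedIn ord p T R A S ∨ κ.PairedIn ord p T R S A)
    (hBS : κ.PairedIn ord p T R B S ∨ κ.PairedIn ord p T R S B) : A = B := by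
  induction hn : R.card using Nat.strong_induction_on generalizing R l with
  | _ n ih =>
    have hR := hs.rooted hT
    rcases R.eq_empty_or_nonempty with rfl | hne
    · rcases hAS with h | h <;> exact absurd h (not_pairedIn_empty _ _)
    · obtain ⟨e, a, hl⟩ := exists_isLeastLeaf hT hR hne
      have key : ∀ X, κ.Settled ord T l X →
          (κ.PairedIn ord p T R X S ∨ κ.PairedIn ord p T R S X) →
          ((κ.LeafPair ord T e a X S ∨ κ.LeafPair ord T e a S X) ∧
            ¬ κ.Settled ord T (a :: l) S) ∨
          (κ.Settled ord T (a :: l) S ∧ κ.Settled ord T (a :: l) X ∧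
            (κ.PairedIn ord p T (R.erase e) X S ∨ κ.PairedIn ord p T (R.erase e) S X)) := by
        intro X hX h
        simp only [settled_cons hl.1.2.1]
        rcases h with h | h
        · rcases h.cases hl hT hR hX.1 hS.1 with h | ⟨h1, h2, h3, h4, h5⟩
          · refine Or.inl ⟨Or.inl h, fun h' => ?_⟩
            exact eq_nonCritLabel_iff.1 (h.outer a (SameVertex.refl a)) h'.2.2
          · exact Or.inr ⟨⟨hS, h2, h4⟩, ⟨hX, h1, h3⟩, Or.inl h5⟩
        · rcases h.cases hl hT hR hS.1 hX.1 with h | ⟨h1, h2, h3, h4, h5⟩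
          · exact Or.inl ⟨Or.inr h, fun h' => h'.2.1 h.present⟩
          · exact Or.inr ⟨⟨hS, h1, h3⟩, ⟨hX, h2, h4⟩, Or.inr h5⟩
      rcases key A hA hAS with ⟨h1, h2⟩ | ⟨h1, h2, h3⟩ <;>
        rcases key B hB hBS with ⟨h1', h2'⟩ | ⟨h1', h2', h3'⟩
      · rcases h1 with h1 | h1 <;> rcases h1' with h1' | h1'
        · exact LeafPair.eq_of_right hl.1 hT hR.1 (hS.within hs) h1 h1'
        · exact absurd h1'.present h1.absent
        · exact absurd h1.present h1'.absent
        · exact h1.eq_of_left h1'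
      · exact absurd h1' h2
      · exact absurd h1 h2'
      · exact ih _ (hn ▸ Finset.card_erase_lt_of_mem hl.1.1) (.next R l e a hs hl) h2 h1 h2'
          h3 h3' rfl

theorem partner_unique {A S B : κ.Enhanced}
    (h : κ.Paired ord p A S ∨ κ.Paired ord p S A) (h' : κ.Paired ord p B S ∨ κ.Paired ord p S B) :
    A = B := by
  have hT := isSpanningTree_tree κ ord S.H
  have hS : κ.InUnknot ord (κ.tree ord S.H) S := inUnknot_tree S
  have hun : ∀ X : κ.Enhanced, (κ.Paired ord p X S ∨ κ.Paired ord p S X) →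
      κ.InUnknot ord (κ.tree ord S.H) X := by
    rintro X (h | h)
    exacts [h.tree_eq ▸ inUnknot_tree X, h.tree_eq ▸ inUnknot_tree X]
  have hA := hun A h
  have hB := hun B h'
  exact Stage.partner_unique hT .start ⟨hA, by simp⟩ ⟨hS, by simp⟩ ⟨hB, by simp⟩
    (h.imp (fun h => (h.pairedIn hT hA).2) (fun h => (h.pairedIn hT hS).2))
    (h'.imp (fun h => (h.pairedIn hT hB).2) (fun h => (h.pairedIn hT hS).2))

/-- Both partners of `S` would coincide, but one has lower and the other higher degree. -/
theorem not_matched_matched {A S B : κ.Enhanced} (h : κ.Matched ord p A S) :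
    ¬ κ.Matched ord p S B := by
  intro h'
  have h1 := hdeg_of_incidence h.1
  have h2 := hdeg_of_incidence h'.1
  have := partner_unique h.2 h'.2.symm
  rw [this] at h1
  omega

theorem Matched.left_unique {A S B : κ.Enhanced} (h : κ.Matched ord p A S)
    (h' : κ.Matched ord p B S) : A = B := partner_unique h.2 h'.2

theorem Matched.right_unique {A S B : κ.Enhanced} (h : κ.Matched ord p S A)
    (h' : κ.Matched ord p S B) : A = B := partner_unique h.2.symm h'.2.symm

/-! ### The critical states of a twisted unknot -/

section CriticalStates

variable {T R : Finset (Fin D.n)} {l : List D.HalfEdge}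

/-- At the least leaf, a present edge can be removed and a noncritical label allows insertion.
Either would give a partner. -/
theorem Stage.settled_of_critical (hs : κ.Stage ord p T R l) (hT : κ.IsSpanningTree T)
    {S : κ.Enhanced} (hS : κ.InUnknot ord T S)
    (hc : ∀ S', ¬ κ.Matched ord p S S' ∧ ¬ κ.Matched ord p S' S) : κ.Settled ord T l S := by
  induction hs with
  | start => exact ⟨hS, by simp⟩
  | next R l e a hs hl ih =>
    have hR := hs.rooted hT
    have hSR := ih.within hs
    refine (settled_cons hl.1.2.1).2 ⟨ih, ?_⟩
    by_cases hp : κ.Present ord T S e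
    · obtain ⟨S', h⟩ := exists_leafPair_absent hl.1 hT hR.1 hSR hp
      have := h.matched hs hl hT ih
      by_cases hn : κ.NegTwist T e
      exacts [absurd (this.1 hn) (hc S').1, absurd (this.2 hn) (hc S').2]
    · refine ⟨hp, ?_⟩
      by_contra hcrit
      obtain ⟨S', h⟩ := exists_leafPair_present hl.1 hT hR.1 hSR hp (eq_nonCritLabel_iff.2 hcrit)
      have := h.matched hs hl hT ((h.settled hs hl.1 hT).2 ih)
      by_cases hn : κ.NegTwist T e
      exacts [absurd (this.1 hn) (hc S').2, absurd (this.2 hn) (hc S').1]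

theorem Stage.exists_final (hs : κ.Stage ord p T R l) (hT : κ.IsSpanningTree T) :
    ∃ l', κ.Stage ord p T ∅ l' := by
  induction hn : R.card using Nat.strong_induction_on generalizing R l with
  | _ n ih =>
    rcases R.eq_empty_or_nonempty with rfl | hne
    · exact ⟨l, hs⟩
    · obtain ⟨e, a, hl⟩ := exists_isLeastLeaf hT (hs.rooted hT) hne
      exact ih _ (hn ▸ Finset.card_erase_lt_of_mem hl.1.1) (.next R l e a hs hl) rfl

theorem Stage.pairedIn_of_settled (hs : κ.Stage ord p T R l) (hT : κ.IsSpanningTree T)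
    {S S' : κ.Enhanced} (hS : κ.Settled ord T l S) (hS' : κ.InUnknot ord T S')
    (h : κ.PairedIn ord p T (κ.liveEdges ord T) S S' ∨
      κ.PairedIn ord p T (κ.liveEdges ord T) S' S) :
    κ.PairedIn ord p T R S S' ∨ κ.PairedIn ord p T R S' S := by
  induction hs with
  | start => exact h
  | next R l e a hs hl ih =>
    obtain ⟨hS, habs, hcrit⟩ := (settled_cons hl.1.2.1).1 hS
    rcases ih hS with h | h
    · rcases h.cases hl hT (hs.rooted hT) hS.1 hS' with h | h
      exacts [absurd h.present habs, Or.inl h.2.2.2.2]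
    · rcases h.cases hl hT (hs.rooted hT) hS' hS.1 with h | h
      exacts [absurd hcrit (eq_nonCritLabel_iff.1 (h.outer a (SameVertex.refl a))),
        Or.inr h.2.2.2.2]

theorem Stage.critical_of_settled (hs : κ.Stage ord p T ∅ l) (hT : κ.IsSpanningTree T)
    {S : κ.Enhanced} (hS : κ.Settled ord T l S) (S' : κ.Enhanced) :
    ¬ κ.Matched ord p S S' ∧ ¬ κ.Matched ord p S' S := by
  have key : ¬ (κ.Paired ord p S S' ∨ κ.Paired ord p S' S) := by
    intro h
    have hS' : κ.InUnknot ord T S' := by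
      have : κ.tree ord S.H = κ.tree ord S'.H := by
        rcases h with h | h
        exacts [h.tree_eq, h.tree_eq.symm]
      rw [tree_eq_of_inUnknot hT hS.1, this]
      exact inUnknot_tree S'
    have h' := hs.pairedIn_of_settled hT hS hS'
      (h.imp (fun h => (h.pairedIn hT hS.1).2) (fun h => (h.pairedIn hT hS').2))
    rcases h' with h | h <;> exact not_pairedIn_empty _ _ h
  exact ⟨fun h => key h.2, fun h => key h.2.symm⟩

theorem Settled.edges_eq (hs : κ.Stage ord p T ∅ l) {S : κ.Enhanced}
    (hS : κ.Settled ord T l S) : S.H = κ.critEdges ord T := by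
  have h := Finset.subset_empty.1 (hS.within hs)
  unfold presentEdges at h
  rw [← Finset.bot_eq_empty, symmDiff_eq_bot] at h
  exact h.symm

/-- At the last stage every circle is the root or the outer vertex of a removed leaf, whose label is
forced. -/
theorem Settled.eq_of_lab (hs : κ.Stage ord p T ∅ l) (hT : κ.IsSpanningTree T)
    {S S' : κ.Enhanced} (hS : κ.Settled ord T l S) (hS' : κ.Settled ord T l S')
    (h : S.lab p = S'.lab p) : S = S' := by
  refine Enhanced.ext ((hS.edges_eq hs).trans (hS'.edges_eq hs).symm) (funext fun b => ?_)
  rcases hs.cover hT b with hb | ⟨a, ha, hb⟩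
  · rw [conn_empty] at hb
    rw [lab_eq_of_sameVertex hT hS.1 hb, lab_eq_of_sameVertex hT hS'.1 hb, h]
  · rw [lab_eq_of_sameVertex hT hS.1 hb, lab_eq_of_sameVertex hT hS'.1 hb, (hS.2 a ha).2,
      (hS'.2 a ha).2]

theorem present_of_edges_eq {S : κ.Enhanced} (h : S.H = κ.critEdges ord T) (e : Fin D.n) :
    ¬ κ.Present ord T S e := by
  unfold Present; rw [h]; simp

/-- Relabel the outer vertices one after another. Each differs from the root and, by
`Stage.untouched`, from the earlier ones, so the labels already fixed survive. -/
theorem Stage.exists_settled (hs : κ.Stage ord p T R l) (s : KhLabel) :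
    ∃ S : κ.Enhanced, S.H = κ.critEdges ord T ∧ S.lab p = s ∧ κ.Settled ord T l S := by
  have hun : ∀ {S : κ.Enhanced}, S.H = κ.critEdges ord T → κ.InUnknot ord T S :=
    fun h e _ => by rw [h]
  induction hs with
  | start => exact ⟨⟨κ.critEdges ord T, fun _ => s, fun _ _ _ => rfl⟩, rfl, rfl, hun rfl, by simp⟩
  | next R l e a hs hl ih =>
    obtain ⟨S, hH, hp, hS⟩ := ih
    refine ⟨⟨S.H, fun b => if κ.SameVertex ord T b a then κ.critLabel T e else S.lab b,
      fun b c hbc => ?_⟩, hH, ?_, ?_⟩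
    · have hv : κ.SameVertex ord T b c := by unfold SameVertex; rw [← hH]; exact hbc
      have hiff : κ.SameVertex ord T b a ↔ κ.SameVertex ord T c a :=
        ⟨fun h => hv.symm.trans h, fun h => hv.trans h⟩
      simp only [hiff]
      rw [S.lab_eq b c hbc]
    · exact (if_neg fun h => hl.1.2.2.1 h.symm).trans hp
    · refine ⟨hun hH, fun b hb => ⟨present_of_edges_eq (S := ⟨S.H, _, _⟩) hH b.1, ?_⟩⟩
      rcases List.mem_cons.1 hb with rfl | hb
      · refine (if_pos (SameVertex.refl b)).trans ?_
        rw [hl.1.2.1]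
      · refine (if_neg fun h => ?_).trans (hS.2 b hb).2
        have := hs.untouched hb hl.1.1 a.2
        rw [← hl.1.eq_mk] at this
        exact this h.symm

end CriticalStates

end
end Checkerboard
end KnotDiagram


namespace KnotDiagram
namespace Checkerboard
noncomputable section
open scoped Classical

variable {D : KnotDiagram} {κ : D.Checkerboard}

/-! ### The oriented resolution -/

/-- the state of the oriented resolution -/
abbrev redEdges (κ : D.Checkerboard) : Finset (Fin D.n) := Finset.univ.filter fun e => κ.Red e

theorem mem_redEdges {e : Fin D.n} : e ∈ κ.redEdges ↔ κ.Red e := by simp [redEdges]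

/-- Opposite half-edges have opposite directions, so both white corners give the same answer. -/
theorem red_iff {e : Fin D.n} {k : ZMod 4} (hk : κ.black (e, k) = false) :
    κ.Red e ↔ D.out (e, k) ≠ D.out (e, k + 1) := by
  constructor
  · rintro ⟨j, hj, hout⟩
    have hk1 : κ.black (e, k + 1) = true := by rw [κ.black_adj, hk]; rfl
    have hj' : ¬ (j = k + 1 ∨ j = k + 1 + 2) := fun h =>
      absurd ((black_at_iff e hk1 j).2 h) (by rw [hj]; decide)
    have hcases : ∀ j k : ZMod 4, ¬ (j = k + 1 ∨ j = k + 1 + 2) → j = k ∨ j = k + 2 := by decide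
    rcases hcases j k hj' with rfl | rfl
    · exact hout
    · have h1 := D.out_opposite e k
      have h2 := D.out_opposite e (k + 1)
      rw [show k + 1 + 2 = k + 2 + 1 by ring] at h2
      rw [h1, h2] at hout
      exact fun h => hout (by rw [h])
  · exact fun h => ⟨k, hk, h⟩

theorem red_iff_of_black {e : Fin D.n} {k : ZMod 4} (hk : κ.black (e, k) = true) :
    κ.Red e ↔ D.out (e, k) = D.out (e, k + 1) := by
  have h1 : κ.black (e, k - 1) = false := by rw [κ.black_sub_one, hk]; rfl
  rw [red_iff h1, sub_add_cancel]
  have h2 := D.out_opposite e (k - 1)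
  rw [show k - 1 + 2 = k + 1 by ring] at h2
  rw [h2]
  cases D.out (e, k - 1) <;> cases D.out (e, k) <;> decide

/-- This is what identifies the state of the red edges as the oriented resolution: each turn leads
from an incoming to an outgoing half-edge or back. -/
theorem out_turn_redEdges (a : D.HalfEdge) : D.out (κ.turn κ.redEdges a) = !D.out a := by
  obtain ⟨e, k⟩ := a
  unfold turn
  simp only [mem_redEdges]
  cases hk : κ.black (e, k)
  · have h1 : κ.black (e, k - 1) = true := by rw [κ.black_sub_one, hk]; rfl
    have hb := red_iff_of_black h1
    rw [sub_add_cancel] at hb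
    have hw := red_iff hk
    by_cases hr : κ.Red e
    · simp only [hr, true_iff] at hb hw
      simp only [hr, not_true_eq_false, Bool.false_eq_true, if_true]
      revert hw
      cases D.out (e, k) <;> cases D.out (e, k + 1) <;> decide
    · simp only [hr, false_iff] at hb hw
      simp only [hr, not_false_eq_true, Bool.false_eq_true, if_false, false_iff, not_true_eq_false]
      revert hb
      cases D.out (e, k) <;> cases D.out (e, k - 1) <;> decide
  · have h1 : κ.black (e, k - 1) = false := by rw [κ.black_sub_one, hk]; rfl
    have hw := red_iff h1
    rw [sub_add_cancel] at hw
    have hb := red_iff_of_black hk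
    by_cases hr : κ.Red e
    · simp only [hr, true_iff] at hb hw
      simp only [hr, not_true_eq_false, true_iff, if_false]
      revert hw
      cases D.out (e, k) <;> cases D.out (e, k - 1) <;> decide
    · simp only [hr, false_iff] at hb hw
      simp only [hr, not_false_eq_true, if_true]
      revert hb
      cases D.out (e, k) <;> cases D.out (e, k + 1) <;> decide

/-- Whether the orientation of the diagram at the half-edge `a` agrees with the orientation of the
circle as boundary of the black side. -/
def facing (κ : D.Checkerboard) (a : D.HalfEdge) : Bool := D.out a != κ.black a

theorem facing_eq {a b : D.HalfEdge} (h : κ.SameFace κ.redEdges a b) :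
    κ.facing a = κ.facing b := by
  refine SameFace.induct (r := fun a b => κ.facing a = κ.facing b)
    ⟨fun _ => rfl, Eq.symm, Eq.trans⟩ (fun a => ?_) (fun a => ?_) h
  · unfold facing
    rw [D.out_glue, κ.black_glue]
    cases D.out a <;> cases κ.black a <;> rfl
  · unfold facing
    rw [out_turn_redEdges, κ.black_turn]
    cases D.out a <;> cases κ.black a <;> rfl

theorem facing_add_two (e : Fin D.n) (k : ZMod 4) :
    κ.facing (e, k + 2) = !κ.facing (e, k) := by
  unfold facing
  rw [D.out_opposite, κ.black_add_two]
  cases D.out (e, k) <;> cases κ.black (e, k) <;> rfl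

/-- At each crossing, two different circles of the oriented resolution meet. -/
theorem not_pinched_redEdges (e : Fin D.n) : ¬ κ.Pinched κ.redEdges e := by
  intro h
  have h1 := facing_eq h
  have h2 := facing_add_two (κ := κ) e 0
  rw [zero_add] at h2
  rw [h1] at h2
  cases h : κ.facing (e, 2) <;> rw [h] at h2 <;> cases h2

/-- No red edge is a bridge of the red subgraph; by `not_spans_redEdges`, no black edge has its ends
joined there. Both express that the circles at a crossing differ, and they drive the computation of
the activities. -/
theorem spans_redEdges_erase {e : Fin D.n} (he : κ.Red e) : κ.Spans (κ.redEdges.erase e) e := by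
  have h := not_pinched_redEdges (κ := κ) e
  rwa [pinched_iff_of_mem (mem_redEdges.2 he), not_not] at h

theorem not_spans_redEdges {e : Fin D.n} (he : ¬ κ.Red e) : ¬ κ.Spans κ.redEdges e := by
  rw [← pinched_iff_spans (fun h => he (mem_redEdges.1 h))]
  exact not_pinched_redEdges e

theorem mem_aEdges_redEdges (e : Fin D.n) : e ∈ κ.aEdges κ.redEdges ↔ D.PosCrossing e := by
  rw [mem_aEdges, mem_redEdges]
  unfold PosEdge PosCrossing
  cases h : κ.black (e, 1)
  · rw [red_iff h]
    have := D.out_opposite e 0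
    rw [zero_add] at this
    rw [show (1 : ZMod 4) + 1 = 2 by decide, this]
    cases D.out (e, 0) <;> cases D.out (e, 1) <;> decide
  · have h0 : κ.black (e, 0) = false := by
      have := κ.black_sub_one e 1
      rw [h, sub_self] at this
      exact this
    rw [red_iff h0, zero_add]
    simp

theorem hdeg_redEdges {S : κ.Enhanced} (h : S.H = κ.redEdges) : κ.hdeg S = 0 := by
  rw [hdeg_eq, h]
  unfold nMinus
  simp only [mem_aEdges_redEdges]
  exact sub_self _

/-! ### The orientation preserving tree -/

section OrientationTree

variable {T : Finset (Fin D.n)}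

theorem Pruned.spans_iff {P : Fin D.n → Prop} {H K : Finset (Fin D.n)} (h : κ.Pruned P H K)
    (e : Fin D.n) : κ.Spans H e ↔ κ.Spans K e := h.2.2.1 _ _

theorem Pruned.mem {P : Fin D.n → Prop} {H K : Finset (Fin D.n)} (h : κ.Pruned P H K)
    {e : Fin D.n} (he : e ∈ H) (hP : ¬ P e) : e ∈ K := by
  by_contra hK
  exact hP (h.2.1 e he hK)

theorem Pruned.not_spans {P : Fin D.n → Prop} {H K : Finset (Fin D.n)} (h : κ.Pruned P H K)
    {e : Fin D.n} (he : e ∈ K) (hP : P e) : ¬ κ.Spans (K.erase e) e := fun hs =>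
  h.2.2.2 e he hP ((onCycle_iff K e).2 ⟨he, hs⟩)

/-- The properties of the orientation preserving tree that come from the order in which edges are
removed. -/
structure OrientationTreeFacts (κ : D.Checkerboard) (T : Finset (Fin D.n)) : Prop where
  isSpanningTree : κ.IsSpanningTree T
  spans_red : ∀ e, κ.Red e → κ.Spans (T.filter fun f => κ.Red f) e
  spans_erase_black : ∀ e ∈ T, ¬ κ.Red e → κ.PosEdge e → ∀ f, f ∉ T → ¬ κ.Red f → ¬ κ.PosEdge f →
    κ.Spans (T.erase e) f
  spans_erase_red : ∀ f ∈ T, κ.Red f → κ.PosEdge f → ∀ e, e ∉ T → κ.Red e → ¬ κ.PosEdge e →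
    κ.Spans (T.erase f) e

theorem IsOrientationTree.facts (h : κ.IsOrientationTree T) : κ.OrientationTreeFacts T := by
  obtain ⟨H₁, H₂, H₃, h1, h2, h3, h4⟩ := h
  have hH₂red : ∀ e ∈ H₂, κ.Red e := fun e he => mem_redEdges.1 (h1.1 (h2.1 he))
  have hH₂T : H₂ ⊆ T := fun e he =>
    h4.mem (h3.mem (Finset.mem_union_left _ he) fun h => h.1 (hH₂red e he))
      fun h => h.1 (hH₂red e he)
  have hTH₂ : ∀ e ∈ T, κ.Red e → e ∈ H₂ := fun e he hr => by
    rcases Finset.mem_union.1 (h3.1 (h4.1 he)) with h | h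
    exacts [h, absurd hr (Finset.mem_filter.1 h).2]
  have hfilter : (T.filter fun f => κ.Red f) = H₂ := by
    ext e
    rw [Finset.mem_filter]
    exact ⟨fun h => hTH₂ e h.1 h.2, fun h => ⟨hH₂T h, hH₂red e h⟩⟩
  have hspan : ∀ e, κ.Red e → κ.Spans H₂ e := fun e he =>
    (h2.spans_iff e).1 ((h1.spans_iff e).1 (spans_of_mem (mem_redEdges.2 he)))
  have hall : ∀ e, κ.Spans T e := by
    intro e
    by_cases he : κ.Red e
    · exact (hspan e he).mono hH₂T
    · exact (h4.spans_iff e).1 ((h3.spans_iff e).1 (spans_of_mem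
        (Finset.mem_union_right _ (Finset.mem_filter.2 ⟨Finset.mem_univ _, he⟩))))
  have hblack : ∀ e ∈ T, ¬ κ.Red e → ¬ κ.Spans (T.erase e) e := by
    intro e he hr
    by_cases hp : κ.PosEdge e
    · exact fun hs => h3.not_spans (h4.1 he) ⟨hr, hp⟩ (hs.mono (Finset.erase_subset_erase e h4.1))
    · exact h4.not_spans he ⟨hr, hp⟩
  have hH₂ : ∀ e ∈ H₂, ¬ κ.Spans (H₂.erase e) e := by
    intro e he
    by_cases hp : κ.PosEdge e
    · exact fun hs => h1.not_spans (h2.1 he) hp (hs.mono (Finset.erase_subset_erase e h2.1))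
    · exact h2.not_spans he hp
  -- A cycle through a red edge of `T` either contains a black edge, which would then be redundant,
  -- or lies in the pruned red subgraph.
  have hred : ∀ e ∈ T, κ.Red e → ¬ κ.Spans (T.erase e) e := by
    intro e he hr hs
    obtain ⟨M, hM, hMe, hmin⟩ := exists_minimal_spanning hs
    by_cases hg : ∃ g ∈ M, ¬ κ.Red g
    · obtain ⟨g, hg, hgr⟩ := hg
      have hx : κ.Spans (insert e (M.erase g)) g :=
        Spans.exchange (by rw [Finset.insert_erase hg]; exact hMe) (hmin g hg)
      have hgT := Finset.mem_of_mem_erase (hM hg)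
      refine hblack g hgT hgr (hx.mono fun x hx => ?_)
      rcases Finset.mem_insert.1 hx with rfl | hx
      · exact Finset.mem_erase.2 ⟨fun h => hgr (h ▸ hr), he⟩
      · exact Finset.mem_erase.2 ⟨(Finset.mem_erase.1 hx).1,
          Finset.mem_of_mem_erase (hM (Finset.mem_of_mem_erase hx))⟩
    · push Not at hg
      refine hH₂ e (hTH₂ e he hr) (hMe.mono fun x hx => ?_)
      have := Finset.mem_erase.1 (hM hx)
      exact Finset.mem_erase.2 ⟨this.1, hTH₂ x this.2 (hg x hx)⟩
  refine ⟨(isSpanningTree_iff T).2 ⟨hall, fun e he => ?_⟩, fun e he => hfilter ▸ hspan e he, ?_, ?_⟩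
  · by_cases hr : κ.Red e
    exacts [hred e he hr, hblack e he hr]
  · intro e he her hep f hf hfr hfp
    -- The negative black edge `f` survived the pruning of positive black edges. If it were in the
    -- cut of `e`, then `e` would lie on a cycle of `H₃` and would have been pruned.
    by_contra hn
    have hfH₃ : f ∈ H₃ := h3.mem (Finset.mem_union_right _
      (Finset.mem_filter.2 ⟨Finset.mem_univ _, hfr⟩)) fun h => hfp h.2
    have hx : κ.Spans (insert f (T.erase e)) e :=
      Spans.exchange (by rw [Finset.insert_erase he]; exact hall f) hn
    refine h3.not_spans (h4.1 he) ⟨her, hep⟩ (hx.mono fun x hx => ?_)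
    rcases Finset.mem_insert.1 hx with rfl | hx
    · exact Finset.mem_erase.2 ⟨fun h => hf (h ▸ he), hfH₃⟩
    · exact Finset.erase_subset_erase e h4.1 hx
  · intro f hf hfr hfp e he her hep
    -- The same argument one level earlier: the negative red edge `e` is still in `H₁` and would
    -- close a cycle through `f`.
    by_contra hn
    have heH₁ : e ∈ H₁ := h1.mem (mem_redEdges.2 her) hep
    have hfH₂ := hTH₂ f hf hfr
    have hx : κ.Spans (insert e (H₂.erase f)) f :=
      Spans.exchange (by rw [Finset.insert_erase hfH₂]; exact hspan e her)
        fun hs => hn (hs.mono (Finset.erase_subset_erase f hH₂T))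
    refine h1.not_spans (h2.1 hfH₂) hfp (hx.mono fun x hx => ?_)
    rcases Finset.mem_insert.1 hx with rfl | hx
    · exact Finset.mem_erase.2 ⟨fun h => he (h ▸ hf), heH₁⟩
    · exact Finset.erase_subset_erase f h2.1 hx

variable {ord : Fin D.n ≃ Fin D.n}

/-- The live edges of the orientation preserving tree. -/
theorem OrientationTreeFacts.live_iff (h : κ.OrientationTreeFacts T)
    (hord : κ.IsAdaptedOrder T ord) (e : Fin D.n) :
    κ.Live ord T e ↔ ¬ (κ.Red e ↔ e ∈ T) := by
  have hT := h.isSpanningTree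
  have hblock : ∀ {e f}, κ.block T e < κ.block T f → ord e < ord f := fun h => hord _ _ h
  by_cases heT : e ∈ T <;> by_cases her : κ.Red e
  · simp only [heT, her, iff_self, not_true_eq_false, iff_false]
    -- Since `e` is not a bridge of the red subgraph, its cut contains a red edge outside `T`, which
    -- lies in the lowest block.
    intro hl
    rw [live_iff_of_mem hT heT] at hl
    refine ((isSpanningTree_iff T).1 hT).2 e heT
      ((spans_redEdges_erase her).of_forall fun f hf => ?_)
    by_contra hn
    obtain ⟨hfe, hfr⟩ := Finset.mem_erase.1 hf
    have hfT : f ∉ T := fun h => hn (spans_of_mem (Finset.mem_erase.2 ⟨hfe, h⟩))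
    refine lt_asymm (hl f hfT hn) (hblock ?_)
    simp [block, heT, her, hfT, mem_redEdges.1 hfr]
  · simp only [heT, her, iff_true, not_false_eq_true, live_iff_of_mem hT heT]
    intro f hf hn
    -- The red edges of `T` span all red edges, so only black edges outside `T`, from the highest
    -- block, can be in the cut of the black edge `e`.
    by_cases hfr : κ.Red f
    · refine absurd ((h.spans_red f hfr).mono fun x hx => ?_) hn
      obtain ⟨hx, hxr⟩ := Finset.mem_filter.1 hx
      exact Finset.mem_erase.2 ⟨fun h => her (h ▸ hxr), hx⟩
    · exact hblock (by simp [block, heT, her, hf, hfr])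
  · simp only [heT, her, iff_false, not_true_eq_false, not_false_eq_true, iff_true,
      live_iff_of_notMem hT heT]
    intro g hg _
    refine hblock ?_
    by_cases hgr : κ.Red g <;> simp [block, heT, her, hg, hgr]
  · simp only [heT, her, not_true_eq_false, iff_false]
    -- The red edges do not join the ends of `e`, so its tree path contains a black edge, of a lower
    -- block.
    intro hl
    rw [live_iff_of_notMem hT heT] at hl
    obtain ⟨M, hMT, hM, hmin⟩ := exists_minimal_spanning (((isSpanningTree_iff T).1 hT).1 e)
    refine not_spans_redEdges her (hM.mono fun g hg => mem_redEdges.2 ?_)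
    by_contra hgr
    refine lt_asymm (hl g (hMT hg) (not_spans_erase_of_minimal hT hMT hM hg (hmin g hg)))
      (hblock ?_)
    simp [block, heT, her, hMT hg, hgr]

theorem OrientationTreeFacts.critEdges_eq (h : κ.OrientationTreeFacts T)
    (hord : κ.IsAdaptedOrder T ord) : κ.critEdges ord T = κ.redEdges := by
  ext e
  rw [mem_critEdges, h.live_iff hord, mem_redEdges]
  tauto

/-- The dead positive crossings do not link the two sides of a negative twist. -/
theorem OrientationTreeFacts.conn_of_posCrossing (h : κ.OrientationTreeFacts T)
    (hord : κ.IsAdaptedOrder T ord) {e f : Fin D.n} (he : κ.Live ord T e) (hneg : κ.NegTwist T e)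
    (hf : f ∈ κ.aEdges κ.redEdges) :
    κ.Conn ord T ((κ.liveEdges ord T).erase e) (f, 0) (f, 2) := by
  have hT := h.isSpanningTree
  have heR := (h.live_iff hord e).1 he
  have hfR := (mem_aEdges (κ := κ)).1 hf
  rw [mem_redEdges] at hfR
  unfold NegTwist at hneg
  -- A live negative twist has no `A`-marker in the oriented resolution.
  have hfe : f ≠ e := by
    rintro rfl
    tauto
  by_cases hfl : κ.Live ord T f
  · exact conn_at_present hT (Finset.erase_subset _ _)
      (Finset.mem_erase.2 ⟨hfe, Finset.mem_filter.2 ⟨Finset.mem_univ _, hfl⟩⟩) 0 2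
  have hfT : κ.Red f ↔ f ∈ T := by
    by_contra hn
    exact hfl ((h.live_iff hord f).2 hn)
  -- With all live edges but `e` present, the state is the tree with `e` toggled, so the claim
  -- becomes one about connectivity near `T`.
  have hstate : symmDiff (κ.critEdges ord T) ((κ.liveEdges ord T).erase e) = symmDiff T {e} := by
    rw [← symmDiff_singleton_of_mem (Finset.mem_filter.2 ⟨Finset.mem_univ e, he⟩ :
      e ∈ κ.liveEdges ord T), ← symmDiff_assoc, symmDiff_critEdges_liveEdges]
  unfold Conn
  rw [hstate]
  change κ.Pinched _ f
  obtain ⟨hT1, hT2⟩ := (isSpanningTree_iff T).1 hT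
  by_cases heT : e ∈ T
  · rw [symmDiff_singleton_of_mem heT]
    by_cases hfT' : f ∈ T
    · rw [pinched_iff_of_mem (Finset.mem_erase.2 ⟨hfe, hfT'⟩)]
      exact fun hs => hT2 f hfT' (hs.mono (Finset.erase_subset_erase f (Finset.erase_subset e T)))
    · rw [pinched_iff_spans (fun h => hfT' (Finset.mem_of_mem_erase h))]
      -- Here `e` is black and positive, `f` black and negative: the order of the second pruning
      -- applies.
      exact h.spans_erase_black e heT (by tauto) (by tauto) f hfT' (by tauto) (by tauto)
  · rw [symmDiff_singleton_of_notMem heT]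
    by_cases hfT' : f ∈ T
    · rw [pinched_iff_of_mem (Finset.mem_insert_of_mem hfT'), Finset.erase_insert_of_ne
        (Ne.symm hfe)]
      intro hs
      refine hT2 f hfT' (hs.of_forall fun x hx => ?_)
      rcases Finset.mem_insert.1 hx with rfl | hx
      -- Here `e` is red and negative, `f` red and positive: the order of the first pruning applies.
      · exact h.spans_erase_red f hfT' (by tauto) (by tauto) x heT (by tauto) (by tauto)
      · exact spans_of_mem hx
    · rw [pinched_iff_spans (by simp [hfe, hfT'])]
      exact (hT1 f).mono (Finset.subset_insert e T)

end OrientationTree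

end
end Checkerboard
end KnotDiagram


namespace KnotDiagram
namespace Checkerboard
noncomputable section
open scoped Classical

variable {D : KnotDiagram} {κ : D.Checkerboard}

/-! ### Paths in the Morse complex -/

section Morse

variable {ord : Fin D.n ≃ Fin D.n} {p : D.HalfEdge}

/-- Paths are split at their first edge. This is the geometric series of a nilpotent matrix, so
truncation loses nothing. -/
theorem Gam_eq_add (A X : κ.Enhanced) : κ.Gam ord p A X =
    (if A = X then 1 else 0) + ∑ B, κ.weight ord p A B * κ.Gam ord p B X := by
  have h := mul_neg_geom_sum (κ.weight ord p) (Fintype.card κ.Enhanced)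
  rw [weight_pow_card, sub_zero, sub_mul, one_mul, sub_eq_iff_eq_add] at h
  have h' := congrFun (congrFun h A) X
  rw [Matrix.add_apply, Matrix.one_apply, Matrix.mul_apply] at h'
  simp only [Matrix.sum_apply] at h'
  exact h'

theorem Gam_eq_zero_of_closed {P : κ.Enhanced → Prop} {X : κ.Enhanced}
    (hP : ∀ A B, P A → κ.weight ord p A B ≠ 0 → P B) (hX : ¬ P X) {A : κ.Enhanced} (hA : P A) :
    κ.Gam ord p A X = 0 := by
  refine Finset.sum_eq_zero fun k hk => ?_
  clear hk
  induction k generalizing A with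
  | zero => rw [pow_zero, Matrix.one_apply, if_neg (by rintro rfl; exact hX hA)]
  | succ k ih =>
    rw [pow_succ', Matrix.mul_apply]
    refine Finset.sum_eq_zero fun B _ => ?_
    by_cases hB : κ.weight ord p A B = 0
    · rw [hB, zero_mul]
    · rw [ih (hP A B hA hB), mul_zero]

/-- There is no path to a critical state of degree `d` from the states of larger degree. -/
theorem Gam_eq_zero_of_hdeg_lt {A X : κ.Enhanced}
    (hX : ∀ S', ¬ κ.Matched ord p X S' ∧ ¬ κ.Matched ord p S' X) (h : κ.hdeg X < κ.hdeg A) :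
    κ.Gam ord p A X = 0 := by
  -- A reversed edge lowers the degree by one and ends at the source of a matched edge. From a
  -- source no further reversed edge starts, so the next step goes up again; the critical `X` is not
  -- a source.
  refine Gam_eq_zero_of_closed
    (P := fun A => κ.hdeg X < κ.hdeg A ∨ (κ.hdeg X ≤ κ.hdeg A ∧ ∃ B, κ.Matched ord p A B))
    (fun A B hA hw => ?_) ?_ (Or.inl h)
  · rcases weight_ne_zero hw with hm | ⟨hi, -⟩
    · have := hdeg_of_incidence hm.1
      rcases hA with hA | ⟨-, C, hC⟩
      · exact Or.inr ⟨by omega, A, hm⟩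
      · exact absurd hC (not_matched_matched hm)
    · have := hdeg_of_incidence hi
      left
      rcases hA with hA | ⟨hA, -⟩ <;> omega
  · rintro (h | ⟨-, B, hB⟩)
    exacts [lt_irrefl _ h, (hX B).1 hB]

/-- A cycle of the Lee complex, homogeneous of degree `d`, whose support consists of one critical
state and of states that are matched to states of degree `d + 1` makes the critical state a cycle of
the Morse complex. -/
theorem Gam_eq_zero_of_cycle {z : κ.Enhanced → ℚ} {S₀ X : κ.Enhanced} (hz : z S₀ ≠ 0)
    (hcycle : ∀ S', ∑ S, z S * κ.incidence ord S S' = 0)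
    (hdeg : ∀ S, z S ≠ 0 → κ.hdeg S = κ.hdeg S₀)
    (hsupp : ∀ S, z S ≠ 0 → S = S₀ ∨ ∃ B, κ.Matched ord p S B)
    (hS₀ : ∀ S', ¬ κ.Matched ord p S₀ S' ∧ ¬ κ.Matched ord p S' S₀)
    (hX : ∀ S', ¬ κ.Matched ord p X S' ∧ ¬ κ.Matched ord p S' X)
    (hXdeg : κ.hdeg X = κ.hdeg S₀ + 1) : κ.Gam ord p S₀ X = 0 := by
  have hne : ∀ S, κ.hdeg S = κ.hdeg S₀ → S ≠ X := by
    rintro S h rfl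
    omega
  have h0 : ∑ B, κ.incidence ord S₀ B * κ.Gam ord p B X = κ.Gam ord p S₀ X := by
    rw [Gam_eq_add S₀ X, if_neg (hne S₀ rfl), zero_add]
    refine Finset.sum_congr rfl fun B _ => ?_
    unfold weight
    rw [if_neg (hS₀ B).2, if_neg (hS₀ B).1]
  have hmatched : ∀ S B, κ.hdeg S = κ.hdeg S₀ → κ.Matched ord p S B →
      ∑ B, κ.incidence ord S B * κ.Gam ord p B X = 0 := by
    intro S B hS hm
    -- From `B`, which has the degree of `X`, only the reversed edge to `S` matters; every other
    -- edge leads above the degree of `X`.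
    have hBX : κ.Gam ord p B X = - (κ.incidence ord S B)⁻¹ * κ.Gam ord p S X := by
      rw [Gam_eq_add B X, if_neg (by rintro rfl; exact (hX S).2 hm), zero_add,
        Finset.sum_eq_single S]
      · unfold weight
        rw [if_pos hm]
      · intro A _ hA
        by_cases hw : κ.weight ord p B A = 0
        · rw [hw, zero_mul]
        · rcases weight_ne_zero hw with hm' | ⟨hi, -⟩
          · exact absurd (hm'.left_unique hm) hA
          · have h1 := hdeg_of_incidence hi
            have h2 := hdeg_of_incidence hm.1
            rw [Gam_eq_zero_of_hdeg_lt hX (by omega), mul_zero]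
      · exact fun h => absurd (Finset.mem_univ _) h
    have hSX : κ.Gam ord p S X = ∑ A, κ.weight ord p S A * κ.Gam ord p A X := by
      rw [Gam_eq_add S X, if_neg (hne S hS), zero_add]
    -- Incidence numbers and weights out of `S` differ only at the matched target `B`; that missing
    -- contribution is cancelled by the paths that return from `B` to `S`.
    have hsplit : ∀ A, κ.incidence ord S A * κ.Gam ord p A X =
        κ.weight ord p S A * κ.Gam ord p A X +
          if A = B then κ.incidence ord S B * κ.Gam ord p B X else 0 := by
      intro A
      have hn : ¬ κ.Matched ord p A S := fun h => not_matched_matched h hm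
      unfold weight
      rw [if_neg hn]
      by_cases hA : A = B
      · subst hA
        rw [if_pos hm, if_pos rfl, zero_mul, zero_add]
      · rw [if_neg (fun h => hA (h.right_unique hm)), if_neg hA, add_zero]
    rw [Finset.sum_congr rfl fun A _ => hsplit A, Finset.sum_add_distrib, ← hSX,
      Finset.sum_ite_eq' Finset.univ B, if_pos (Finset.mem_univ _), hBX, ← mul_assoc, mul_neg,
      mul_inv_cancel₀ hm.1, neg_one_mul, add_neg_cancel]
  -- The sum is `Γ(·, X)` applied to the boundary of the cycle `z`; only the summand of `S₀`
  -- survives.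
  have hsum : ∑ S, z S * ∑ B, κ.incidence ord S B * κ.Gam ord p B X = 0 := by
    simp only [Finset.mul_sum]
    rw [Finset.sum_comm]
    refine Finset.sum_eq_zero fun B _ => ?_
    simp only [← mul_assoc]
    rw [← Finset.sum_mul, hcycle, zero_mul]
  rw [Finset.sum_eq_single S₀, h0] at hsum
  · exact (mul_eq_zero.1 hsum).resolve_left hz
  · intro S _ hS
    by_cases hzS : z S = 0
    · rw [hzS, zero_mul]
    · obtain ⟨B, hB⟩ := (hsupp S hzS).resolve_left hS
      rw [hmatched S B (hdeg S hzS) hB, mul_zero]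
  · exact fun h => absurd (Finset.mem_univ _) h

end Morse

/-! ### Exchanging the labels at a crossing -/

/-- the exchange of the two labels -/
def swapLabel : KhLabel → KhLabel
  | .one => .x
  | .x => .one

/-- the two circles at the crossing `f` -/
def Touches (κ : D.Checkerboard) (H : Finset (Fin D.n)) (f : Fin D.n) (b : D.HalfEdge) : Prop :=
  κ.SameFace H b (f, 0) ∨ κ.SameFace H b (f, 2)

theorem touches_congr {H : Finset (Fin D.n)} {f : Fin D.n} {b c : D.HalfEdge}
    (h : κ.SameFace H b c) : κ.Touches H f b ↔ κ.Touches H f c :=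
  or_congr ⟨h.symm.trans, h.trans⟩ ⟨h.symm.trans, h.trans⟩

/-- exchange the labels of the circles at the crossing `f` -/
def flip (f : Fin D.n) (S : κ.Enhanced) : κ.Enhanced where
  H := S.H
  lab b := if κ.Touches S.H f b then swapLabel (S.lab b) else S.lab b
  lab_eq b c h := by simp only [touches_congr h, S.lab_eq b c h]

theorem flip_lab_of_touches {f : Fin D.n} {S : κ.Enhanced} {b : D.HalfEdge}
    (h : κ.Touches S.H f b) : (flip f S).lab b = swapLabel (S.lab b) := if_pos h

theorem flip_lab_of_not_touches {f : Fin D.n} {S : κ.Enhanced} {b : D.HalfEdge}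
    (h : ¬ κ.Touches S.H f b) : (flip f S).lab b = S.lab b := if_neg h

theorem swapLabel_ne (c : KhLabel) : swapLabel c ≠ c := by cases c <;> decide

theorem swapLabel_swapLabel (c : KhLabel) : swapLabel (swapLabel c) = c := by cases c <;> rfl

theorem swapLabel_ne_iff {c c' : KhLabel} : swapLabel c ≠ c' ↔ c = c' := by
  cases c <;> cases c' <;> decide

theorem flip_flip (f : Fin D.n) (S : κ.Enhanced) : flip f (flip f S) = S := by
  refine Enhanced.ext rfl (funext fun b => ?_)
  by_cases h : κ.Touches S.H f b
  · rw [flip_lab_of_touches (S := flip f S) h, flip_lab_of_touches h, swapLabel_swapLabel]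
  · rw [flip_lab_of_not_touches (S := flip f S) h, flip_lab_of_not_touches h]

theorem flip_ne (f : Fin D.n) (S : κ.Enhanced) : flip f S ≠ S := fun h => by
  have h1 := congrArg (fun X : κ.Enhanced => X.lab (f, 0)) h
  exact swapLabel_ne _ ((flip_lab_of_touches (Or.inl (SameFace.refl _ _))).symm.trans h1)

/-- The merge maps do not see the exchange of both labels. -/
theorem leeTerm_flip {f : Fin D.n} {S S' : κ.Enhanced} (hf : ¬ κ.Pinched S.H f)
    (h : κ.LeeTerm f S S') : κ.LeeTerm f (flip f S) S' := by
  refine ⟨h.1, fun a ha => ?_, fun hp => absurd hp hf, fun _ => ?_⟩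
  · rw [flip_lab_of_not_touches (f := f) (S := S) fun ht => ht.elim (ha 0) (ha 2)]
    exact h.2.1 a ha
  · have hm := h.2.2.2 hf
    rw [flip_lab_of_touches (Or.inl (SameFace.refl _ _)),
      flip_lab_of_touches (Or.inr (SameFace.refl _ _))]
    -- Exchanging the labels is multiplication by `x`; doing it to both factors changes nothing, as
    -- `x * x = 1`.
    revert hm
    cases S.lab (f, 0) <;> cases S.lab (f, 2) <;> cases S'.lab (f, 0) <;> simp [swapLabel]

theorem incidence_flip {ord : Fin D.n ≃ Fin D.n} {f : Fin D.n} {S S' : κ.Enhanced}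
    (hf : ¬ κ.Pinched S.H f) (h : S'.H = symmDiff S.H {f}) :
    κ.incidence ord (flip f S) S' = κ.incidence ord S S' := by
  unfold incidence
  refine Finset.sum_congr rfl fun e _ => ?_
  have : κ.LeeTerm e (flip f S) S' ↔ κ.LeeTerm e S S' := by
    by_cases he : e = f
    · subst he
      refine ⟨fun h => ?_, leeTerm_flip hf⟩
      rw [← flip_flip e S]
      exact leeTerm_flip (S := flip e S) hf h
    · exact iff_of_false (fun h' => he (symmDiff_singleton_injective (h'.1.symm.trans h)))
        (fun h' => he (symmDiff_singleton_injective (h'.1.symm.trans h)))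
  rw [if_congr this rfl rfl]
  rfl

/-! ### Lee's canonical cycles -/

/-- the circles of the oriented resolution -/
abbrev Circle (κ : D.Checkerboard) : Type := Quotient (κ.faceSetoid κ.redEdges)

/-- the circle of a half-edge -/
def circle (κ : D.Checkerboard) (b : D.HalfEdge) : κ.Circle :=
  Quotient.mk (κ.faceSetoid κ.redEdges) b

theorem circle_eq_iff {a b : D.HalfEdge} : κ.circle a = κ.circle b ↔ κ.SameFace κ.redEdges a b :=
  Quotient.eq

theorem circle_out (c : κ.Circle) : κ.circle c.out = c := Quotient.out_eq c

theorem sameFace_out (b : D.HalfEdge) : κ.SameFace κ.redEdges (κ.circle b).out b :=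
  circle_eq_iff.1 (circle_out _)

/-- Two half-edges are linked if their circles are connected by crossings at which an edge of the
Hasse diagram starts. -/
def Linked (κ : D.Checkerboard) (a b : D.HalfEdge) : Prop :=
  Relation.EqvGen (fun a b => κ.SameFace κ.redEdges a b ∨
    ∃ f ∈ κ.aEdges κ.redEdges, a = (f, 0) ∧ b = (f, 2)) a b

theorem linked_equivalence : Equivalence κ.Linked := Relation.EqvGen.is_equivalence _

theorem Linked.of_sameFace {a b : D.HalfEdge} (h : κ.SameFace κ.redEdges a b) : κ.Linked a b :=
  .rel _ _ (Or.inl h)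

theorem Linked.of_crossing {f : Fin D.n} (hf : f ∈ κ.aEdges κ.redEdges) :
    κ.Linked (f, 0) (f, 2) := .rel _ _ (Or.inr ⟨f, hf, rfl, rfl⟩)

/-- the label of the circle `c` in `S` differs from the label in `S₀` -/
def Deviates (S₀ S : κ.Enhanced) (c : κ.Circle) : Prop := S.lab c.out ≠ S₀.lab c.out

/-- the number modulo two of the deviating circles that are linked to `b` -/
def parity (S₀ S : κ.Enhanced) (b : D.HalfEdge) : ZMod 2 :=
  ∑ c : κ.Circle, if κ.Linked c.out b then (if Deviates S₀ S c then 1 else 0) else 0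

/-- the sign of a circle -/
def circleSign (c : κ.Circle) : ℚ := if κ.facing c.out = true then 1 else -1

/-- A Lee cycle that contains `S₀`. -/
def leeCycle (S₀ S : κ.Enhanced) : ℚ :=
  if S.H = κ.redEdges ∧ ∀ b, parity S₀ S b = 0 then
    ∏ c : κ.Circle, if Deviates S₀ S c then circleSign c else 1 else 0

theorem leeCycle_self {S₀ : κ.Enhanced} (h : S₀.H = κ.redEdges) : leeCycle S₀ S₀ = 1 := by
  have hn : ∀ c, ¬ Deviates S₀ S₀ c := fun c h => h rfl
  unfold leeCycle
  rw [if_pos ⟨h, fun b => by unfold parity; simp [hn]⟩]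
  simp [hn]

theorem leeCycle_ne_zero {S₀ S : κ.Enhanced} (h : leeCycle S₀ S ≠ 0) :
    S.H = κ.redEdges ∧ ∀ b, parity S₀ S b = 0 := by
  by_contra hn
  exact h (if_neg hn)

section FlipCycle

variable {S₀ S : κ.Enhanced} {f : Fin D.n}

theorem circle_ne (f : Fin D.n) : κ.circle (f, 0) ≠ κ.circle (f, 2) := fun h =>
  not_pinched_redEdges f (circle_eq_iff.1 h)

theorem touches_out {c : κ.Circle} :
    κ.Touches κ.redEdges f c.out ↔ c = κ.circle (f, 0) ∨ c = κ.circle (f, 2) := by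
  unfold Touches
  rw [← circle_eq_iff, ← circle_eq_iff, circle_out]

theorem deviates_flip (hS : S.H = κ.redEdges) (c : κ.Circle) : Deviates S₀ (flip f S) c ↔
    (if c = κ.circle (f, 0) ∨ c = κ.circle (f, 2) then ¬ Deviates S₀ S c else Deviates S₀ S c) := by
  unfold Deviates
  split_ifs with h
  · rw [flip_lab_of_touches (hS.symm ▸ touches_out.2 h), swapLabel_ne_iff, not_not]
  · rw [flip_lab_of_not_touches (hS.symm ▸ fun h' => h (touches_out.1 h'))]

/-- The two circles at a positive crossing are linked, so both or neither are counted, and each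
changes its status. -/
theorem parity_flip (hS : S.H = κ.redEdges) (hf : f ∈ κ.aEdges κ.redEdges) (b : D.HalfEdge) :
    parity S₀ (flip f S) b = parity S₀ S b := by
  have hlink : κ.Linked (κ.circle (f, 0)).out b ↔ κ.Linked (κ.circle (f, 2)).out b := by
    have h : κ.Linked (κ.circle (f, 0)).out (κ.circle (f, 2)).out :=
      linked_equivalence.trans (Linked.of_sameFace (sameFace_out _))
        (linked_equivalence.trans (Linked.of_crossing hf)
          (linked_equivalence.symm (Linked.of_sameFace (sameFace_out _))))
    exact ⟨linked_equivalence.trans (linked_equivalence.symm h), linked_equivalence.trans h⟩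
  have key : ∀ c : κ.Circle,
      (if κ.Linked c.out b then (if Deviates S₀ (flip f S) c then (1 : ZMod 2) else 0) else 0) =
      (if κ.Linked c.out b then (if Deviates S₀ S c then 1 else 0) else 0) +
      ((if c = κ.circle (f, 0) then (if κ.Linked (κ.circle (f, 0)).out b then 1 else 0) else 0) +
        (if c = κ.circle (f, 2) then (if κ.Linked (κ.circle (f, 0)).out b then 1 else 0)
          else 0)) := by
    intro c
    have h2 : (1 : ZMod 2) + 1 = 0 := by decide
    rw [deviates_flip hS]
    by_cases h0 : c = κ.circle (f, 0)
    · subst h0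
      by_cases hd : Deviates S₀ S (κ.circle (f, 0)) <;>
        by_cases hl : κ.Linked (κ.circle (f, 0)).out b <;> simp [circle_ne, hd, hl, h2]
    · by_cases h2' : c = κ.circle (f, 2)
      · subst h2'
        by_cases hd : Deviates S₀ S (κ.circle (f, 2)) <;>
          by_cases hl : κ.Linked (κ.circle (f, 2)).out b <;>
          simp [h0, hlink, hd, hl, h2]
      · simp [h0, h2']
  unfold parity
  rw [Finset.sum_congr rfl fun c _ => key c, Finset.sum_add_distrib, Finset.sum_add_distrib,
    Finset.sum_ite_eq', Finset.sum_ite_eq', if_pos (Finset.mem_univ _), if_pos (Finset.mem_univ _),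
    CharTwo.add_self_eq_zero, add_zero]

/-- The two strands run oppositely with respect to the black sides. -/
theorem circleSign_mul (f : Fin D.n) :
    circleSign (κ.circle (f, 0)) * circleSign (κ.circle (f, 2)) = -1 := by
  have h := facing_add_two (κ := κ) f 0
  rw [zero_add] at h
  unfold circleSign
  rw [facing_eq (sameFace_out (f, 0)), facing_eq (sameFace_out (f, 2)), h]
  cases κ.facing (f, 0) <;> norm_num

/-- Exchanging both labels at `f` toggles two factors of the product, hence multiplies it by the two
circle signs; the parity condition is unaffected. -/
theorem leeCycle_flip (hS : S.H = κ.redEdges) (hf : f ∈ κ.aEdges κ.redEdges) :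
    leeCycle S₀ (flip f S) = - leeCycle S₀ S := by
  have hsq : ∀ c : κ.Circle, circleSign c * circleSign c = 1 := fun c => by
    unfold circleSign; split_ifs <;> norm_num
  have key : ∀ c : κ.Circle, (if Deviates S₀ (flip f S) c then circleSign c else 1) =
      (if Deviates S₀ S c then circleSign c else 1) *
      ((if c = κ.circle (f, 0) then circleSign (κ.circle (f, 0)) else 1) *
      (if c = κ.circle (f, 2) then circleSign (κ.circle (f, 2)) else 1)) := by
    intro c
    rw [deviates_flip hS]
    by_cases h0 : c = κ.circle (f, 0)
    · subst h0
      by_cases hd : Deviates S₀ S (κ.circle (f, 0)) <;> simp [circle_ne, hd, hsq]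
    · by_cases h2' : c = κ.circle (f, 2)
      · subst h2'
        by_cases hd : Deviates S₀ S (κ.circle (f, 2)) <;> simp [h0, hd, hsq]
      · simp [h0, h2']
  unfold leeCycle
  have hiff : ((flip f S).H = κ.redEdges ∧ ∀ b, parity S₀ (flip f S) b = 0) ↔
      (S.H = κ.redEdges ∧ ∀ b, parity S₀ S b = 0) :=
    and_congr Iff.rfl (forall_congr' fun b => by rw [parity_flip hS hf])
  rw [if_congr hiff rfl rfl, Finset.prod_congr rfl fun c _ => key c, Finset.prod_mul_distrib,
    Finset.prod_mul_distrib, Finset.prod_ite_eq', Finset.prod_ite_eq', if_pos (Finset.mem_univ _),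
    if_pos (Finset.mem_univ _), circleSign_mul]
  split_ifs <;> ring

end FlipCycle

/-- A target determines the crossing `f` of the merge. Flipping at `f` is a fixed-point-free
involution that preserves incidence numbers and negates coefficients. -/
theorem sum_leeCycle_mul_incidence {ord : Fin D.n ≃ Fin D.n} (S₀ S' : κ.Enhanced) :
    ∑ S, leeCycle S₀ S * κ.incidence ord S S' = 0 := by
  by_cases hf : ∃ f ∈ κ.aEdges κ.redEdges, S'.H = symmDiff κ.redEdges {f}
  · obtain ⟨f, hf, hS'⟩ := hf
    refine Finset.sum_involution (fun S _ => flip f S) (fun S _ => ?_) (fun S _ _ => flip_ne f S)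
      (fun _ _ => Finset.mem_univ _) (fun S _ => flip_flip f S)
    by_cases hS : S.H = κ.redEdges
    · rw [leeCycle_flip hS hf, incidence_flip (hS.symm ▸ not_pinched_redEdges f) (hS.symm ▸ hS')]
      ring
    · rw [leeCycle, if_neg fun h => hS h.1, leeCycle, if_neg fun h => hS h.1]
      ring
  · refine Finset.sum_eq_zero fun S _ => ?_
    by_contra hne
    have hS := (leeCycle_ne_zero (left_ne_zero_of_mul hne)).1
    obtain ⟨f, hfa, hLee⟩ := incidence_ne_zero_iff.1 (right_ne_zero_of_mul hne)
    exact hf ⟨f, hS ▸ hfa, hS ▸ hLee.1⟩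

theorem parity_eq_one {S₀ S : κ.Enhanced} (hS₀ : S₀.H = κ.redEdges) (hS : S.H = κ.redEdges)
    {b : D.HalfEdge} (hb : S.lab b ≠ S₀.lab b)
    (h : ∀ a, κ.Linked a b → S.lab a ≠ S₀.lab a → κ.SameFace κ.redEdges a b) :
    parity S₀ S b = 1 := by
  have hout := sameFace_out (κ := κ) b
  unfold parity
  rw [Finset.sum_eq_single (κ.circle b)]
  · rw [if_pos (Linked.of_sameFace hout), if_pos]
    unfold Deviates
    rwa [S.lab_eq _ b (hS.symm ▸ hout), S₀.lab_eq _ b (hS₀.symm ▸ hout)]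
  · intro c _ hc
    by_cases hl : κ.Linked c.out b
    · rw [if_pos hl, if_neg]
      intro hd
      exact hc (by rw [← circle_out c]; exact circle_eq_iff.2 (h _ hl hd))
    · rw [if_neg hl]
  · exact fun h => absurd (Finset.mem_univ _) h

/-! ### The orientation preserving tree is a cycle -/

section Main

variable {T : Finset (Fin D.n)} {ord : Fin D.n ≃ Fin D.n} {p : D.HalfEdge}

/-- Separation by `e` is needed in all of `G(T)`, not only in `R`, because positive crossings may
link circles that the recursion has already removed. -/
theorem IsLeaf.not_conn_erase_liveEdges {R : Finset (Fin D.n)} {e : Fin D.n} {a : D.HalfEdge}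
    (h : κ.IsLeaf ord p T R e a) (hT : κ.IsSpanningTree T) (hR : κ.Rooted ord p T R) :
    ¬ κ.Conn ord T ((κ.liveEdges ord T).erase e) a p := by
  intro hc
  have hsub : (κ.liveEdges ord T).erase e ⊆ κ.liveEdges ord T := Finset.erase_subset _ _
  have hn := not_conn_ends hT hsub (h.live hR.1) (Finset.notMem_erase e _)
  have hfar : ∀ k, ¬ κ.SameVertex ord T (e, k) a →
      κ.Conn ord T ((κ.liveEdges ord T).erase e) (e, k) p := fun k hk =>
    ((h.sides hT hR k).resolve_left fun h' => hk h'.symm).mono hT hsub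
      (Finset.erase_subset_erase e hR.1)
  rcases h.ends hT hR.1 with ⟨h0, h2⟩ | ⟨h2, h0⟩
  · exact hn ((conn_of_sameVertex hT hsub h0).trans (hc.trans (hfar 2 h2).symm))
  · exact hn ((hfar 0 h0).trans (hc.symm.trans (conn_of_sameVertex hT hsub h2).symm))

/-- Linked half-edges are not separated by a negative twist. -/
theorem OrientationTreeFacts.conn_of_linked (h : κ.OrientationTreeFacts T)
    (hord : κ.IsAdaptedOrder T ord) {e : Fin D.n} (he : κ.Live ord T e) (hneg : κ.NegTwist T e)
    {a b : D.HalfEdge} (hab : κ.Linked a b) :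
    κ.Conn ord T ((κ.liveEdges ord T).erase e) a b := by
  induction hab with
  | rel a b hab =>
    rcases hab with hab | ⟨f, hf, rfl, rfl⟩
    · refine conn_of_sameVertex h.isSpanningTree (Finset.erase_subset _ _) ?_
      unfold SameVertex
      rwa [h.critEdges_eq hord]
    · exact h.conn_of_posCrossing hord he hneg hf
  | refl a => exact Conn.refl _ a
  | symm a b _ ih => exact ih.symm
  | trans a b c _ _ ih ih' => exact ih.trans ih'

theorem OrientationTreeFacts.matched_of_parity (h : κ.OrientationTreeFacts T)
    (hord : κ.IsAdaptedOrder T ord) {R : Finset (Fin D.n)} {l : List D.HalfEdge}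
    (hs : κ.Stage ord p T R l) {S₀ S : κ.Enhanced} (hS₀ : κ.InUnknot ord T S₀)
    (hcrit : ∀ S', ¬ κ.Matched ord p S₀ S' ∧ ¬ κ.Matched ord p S' S₀)
    (hH₀ : S₀.H = κ.redEdges) (hH : S.H = κ.redEdges) (hpar : ∀ b, parity S₀ S b = 0)
    (hset : κ.Settled ord T l S) : S = S₀ ∨ ∃ B, κ.Matched ord p S B := by
  have hT := h.isSpanningTree
  have hC := h.critEdges_eq hord
  have hsv : ∀ {a b : D.HalfEdge}, κ.SameVertex ord T a b ↔ κ.SameFace κ.redEdges a b := by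
    intro a b
    unfold SameVertex
    rw [hC]
  have hpar' : ∀ b, S.lab b ≠ S₀.lab b →
      ¬ ∀ a, κ.Linked a b → S.lab a ≠ S₀.lab a → κ.SameVertex ord T a b := fun b hb hall => by
    have := parity_eq_one hH₀ hH hb fun a h1 h2 => hsv.1 (hall a h1 h2)
    rw [hpar b] at this
    exact zero_ne_one this
  -- On outer vertices of removed leaves, `S` and the critical `S₀` both have the critical label.
  have hdone : ∀ {R : Finset (Fin D.n)} {l : List D.HalfEdge}, κ.Stage ord p T R l →
      κ.Settled ord T l S → ∀ {a b}, a ∈ l → κ.SameVertex ord T b a → S.lab b = S₀.lab b := by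
    intro R l hs hset a b ha hb
    rw [lab_eq_of_sameVertex hT hset.1 hb, lab_eq_of_sameVertex hT hS₀ hb, (hset.2 a ha).2,
      ((hs.settled_of_critical hT hS₀ hcrit).2 a ha).2]
  induction hn : R.card using Nat.strong_induction_on generalizing R l with
  | _ n ih =>
    have hR := hs.rooted hT
    rcases R.eq_empty_or_nonempty with rfl | hne
    · left
      refine Settled.eq_of_lab hs hT hset (hs.settled_of_critical hT hS₀ hcrit) ?_
      by_contra hlab
      -- Only the root is left to deviate, and a linked class cannot contain exactly one deviating
      -- circle.
      refine hpar' p hlab fun a _ ha => ?_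
      rcases hs.cover hT a with hb | ⟨a', ha', hb⟩
      · exact conn_empty.1 hb
      · exact absurd (hdone hs hset ha' hb) ha
    · obtain ⟨e, a, hl⟩ := exists_isLeastLeaf hT hR hne
      have habs : ¬ κ.Present ord T S e := present_of_edges_eq (hH.trans hC.symm) e
      have hlive := hl.1.live hR.1
      by_cases hlab : S.lab a = κ.critLabel T e
      · exact ih _ (hn ▸ Finset.card_erase_lt_of_mem hl.1.1) (.next R l e a hs hl)
          ((settled_cons hl.1.2.1).2 ⟨hset, habs, hlab⟩) rfl
      · obtain ⟨X, hX⟩ := exists_leafPair_present hl.1 hT hR.1 (hset.within hs) habs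
          (eq_nonCritLabel_iff.2 hlab)
        have hXset := (hX.settled hs hl.1 hT).2 hset
        by_cases hneg : κ.NegTwist T e
        · exfalso
          have h₀ := ((Stage.next R l e a hs hl).settled_of_critical hT hS₀ hcrit).2 a
            List.mem_cons_self
          rw [hl.1.2.1] at h₀
          -- A deviating circle linked to `a` is on the outer side of `e`. There it is `a` itself or
          -- the outer vertex of a removed leaf, where nothing deviates. So `a` would deviate alone
          -- in its class.
          refine hpar' a (by rwa [h₀.2]) fun b hba hb => ?_
          have hconn := h.conn_of_linked hord hlive hneg hba
          rcases hs.cover hT b with hbp | ⟨a', ha', hb'⟩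
          · refine (hl.1.conn_or hT hR hbp).resolve_right fun hbp => ?_
            exact hl.1.not_conn_erase_liveEdges hT hR (hconn.symm.trans
              (hbp.mono hT (Finset.erase_subset _ _) (Finset.erase_subset_erase e hR.1)))
          · exact absurd (hdone hs hset ha' hb') hb
        -- At a positive twist the matched edge inserts `e`, so `S` is its source.
        · exact Or.inr ⟨X, (hX.matched hs hl hT hXset).2 hneg⟩

theorem OrientationTreeFacts.edges_eq_of_critical (h : κ.OrientationTreeFacts T)
    (hord : κ.IsAdaptedOrder T ord) {S : κ.Enhanced} (hS : κ.InUnknot ord T S)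
    (hcrit : ∀ S', ¬ κ.Matched ord p S S' ∧ ¬ κ.Matched ord p S' S) : S.H = κ.redEdges := by
  have hT := h.isSpanningTree
  obtain ⟨l, hl⟩ := (Stage.start (κ := κ) (ord := ord) (p := p) (T := T)).exists_final hT
  rw [(hl.settled_of_critical hT hS hcrit).edges_eq hl, h.critEdges_eq hord]

theorem OrientationTreeFacts.Gam_eq_zero (h : κ.OrientationTreeFacts T)
    (hord : κ.IsAdaptedOrder T ord) {S₀ X : κ.Enhanced} (hS₀ : κ.InUnknot ord T S₀)
    (hcrit : ∀ S', ¬ κ.Matched ord p S₀ S' ∧ ¬ κ.Matched ord p S' S₀)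
    (hX : ∀ S', ¬ κ.Matched ord p X S' ∧ ¬ κ.Matched ord p S' X)
    (hdeg : κ.hdeg X = κ.hdeg S₀ + 1) : κ.Gam ord p S₀ X = 0 := by
  have hH₀ := h.edges_eq_of_critical hord hS₀ hcrit
  refine Gam_eq_zero_of_cycle (z := leeCycle S₀) (by rw [leeCycle_self hH₀]; exact one_ne_zero)
    (sum_leeCycle_mul_incidence S₀) (fun S hS => ?_) (fun S hS => ?_) hcrit hX hdeg
  · rw [hdeg_redEdges (leeCycle_ne_zero hS).1, hdeg_redEdges hH₀]
  · obtain ⟨hH, hpar⟩ := leeCycle_ne_zero hS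
    refine h.matched_of_parity hord .start hS₀ hcrit hH₀ hH hpar ⟨fun e _ => ?_, by simp⟩
    rw [hH, h.critEdges_eq hord]

end Main

end
end Checkerboard
end KnotDiagram

theorem proposition5p3 (D : KnotDiagram) (κ : D.Checkerboard) (p : D.HalfEdge)
    (T : Finset (Fin D.n)) (hT : κ.IsOrientationTree T)
    (ord : Fin D.n ≃ Fin D.n) (hord : κ.IsAdaptedOrder T ord) :
    κ.IsSpanningTree T ∧
    (∀ s : KhLabel, ∃ S : κ.Critical ord p,
      (∀ S' : κ.Critical ord p, κ.IsSignedTree ord p T s S' ↔ S' = S) ∧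
      κ.hdeg S.1 = 0 ∧
      κ.dST ord p (Finsupp.single S 1) = 0) ∧
    (∀ (T₁ : Finset (Fin D.n)) (S S₁ : κ.Critical ord p), κ.IsSpanningTree T₁ →
      κ.IsSignedTree ord p T KhLabel.one S → κ.IsSignedTree ord p T₁ KhLabel.x S₁ →
      κ.hdeg S₁.1 = κ.hdeg S.1 + 1 → κ.Gam ord p S.1 S₁.1 = 0) := by
  have h := hT.facts
  have hspan := h.isSpanningTree
  refine ⟨hspan, fun s => ?_, fun T₁ S S₁ _ hS _ hdeg => h.Gam_eq_zero hord hS.1 S.2 S₁.2 hdeg⟩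
  obtain ⟨l, hl⟩ := (KnotDiagram.Checkerboard.Stage.start
    (κ := κ) (ord := ord) (p := p) (T := T)).exists_final hspan
  obtain ⟨S, hH, hlab, hset⟩ := hl.exists_settled s
  refine ⟨⟨S, hl.critical_of_settled hspan hset⟩, fun S' => ⟨fun hS' => ?_, ?_⟩, ?_, ?_⟩
  · exact Subtype.ext (KnotDiagram.Checkerboard.Settled.eq_of_lab hl hspan
      (hl.settled_of_critical hspan hS'.1 S'.2) hset (hS'.2.trans hlab.symm))
  · rintro rfl
    exact ⟨hset.1, hlab⟩
  · exact KnotDiagram.Checkerboard.hdeg_redEdges (hH.trans (h.critEdges_eq hord))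
  · refine (Finsupp.linearCombination_single ℚ _ _).trans ((one_smul ℚ _).trans ?_)
    refine Finset.sum_eq_zero fun S' hS' => ?_
    rw [h.Gam_eq_zero hord hset.1 (hl.critical_of_settled hspan hset) S'.2
      (Finset.mem_filter.1 hS').2, Finsupp.single_zero]
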